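/- Let $U\subseteq\mathbb R$ be open and let all functions of $u$ be real-valued and $C^\infty$ on $U$. A differential polynomial is a polynomial in $u_x,u_{xx},u_{xxx},\dots$ whose coefficients are functions of $u$; with $u_{(0)}=u$ and $u_{(k)}=\partial_x^k u$, it is homogeneous when graded by $\deg f(u)=0$, $\deg u_{(k)}=k$. For differential polynomials $\alpha,\beta$ put \[ \{\alpha,\beta\}=\sum_{j\ge 0}\Big(\partial_x^{j+1}\beta\,\frac{\partial\alpha}{\partial u_{(j)}}-\partial_x^{j+1}\alpha\,\frac{\partial\beta}{\partial u_{(j)}}\Big), \] extended bilinearly to formal power series in $\epsilon$. A deformation of a function $f(u)$ is a series $f(u)+\sum_{n\ge1}\epsilon^n g_n$ with $g_n$ a homogeneous differential polynomial of degree $n$. A deformation $\omega$ (or the conservation law $u_t=\partial_x\omega$) is integrable up to the order $\epsilon^k$ if every function $f(u)$ has a deformation $\omega_f$ with $\{\omega,\omega_f\}=O(\epsilon^{k+1})$. Let $\omega=\omega_{u^2}$ be a deformation of $u^2$ in normal form, i.e. no term of order $\epsilon^n$ with $n\ge2$ contains $u_x$; thus \[ \omega=u^2+\epsilon\,a\,u_x+\epsilon^2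 b_1u_{xx}+\epsilon^3c_1u_{xxx}+\epsilon^4(d_1u_{4x}+d_2u_{xx}^2)+\epsilon^5(e_1u_{5x}+e_2u_{xx}u_{xxx})+O(\epsilon^6), \] where $a,b_1,c_1,d_1,d_2,e_1,e_2$ are functions of $u$. Assume that $a(u)\neq0$ for all $u\in U$. (i) $\omega$ is integrable up to the order $\epsilon^5$ if and only if \[ b_1=\Big(\frac{a^2}{2!}\Big)',\qquad c_1=\Big(\frac{a^3}{3!}\Big)'',\qquad d_1=\Big(\frac{a^4}{4!}\Big)''', \] \[ d_2 = - \tfrac{5}{32}a^{3} a^{(4)} - \tfrac{31}{24}a^{2} a' a''' - \tfrac{3}{4}a^{2} (a'')^{2} - 2a (a')^{2} a'' \] (ii) $\omega$ is integrable up to the order $\epsilon^6$ if and only if, in addition to the four equations of (i), \[ e_1=\Big(\frac{a^5}{5!}\Big)^{(4)}, \] \[ e_2 = - \tfrac{49}{240}a^{4} a^{(5)} - \tfrac{299}{96}a^{3} a' a^{(4)} - \tfrac{115}{24}a^{3} a'' a''' - \tfrac{305}{24}a^{2} (a')^{2} a''' - \tfrac{117}{8}a^{2} a' (a'')^{2}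 - 13a (a')^{3} a'' \] (iii) Suppose that $\omega$ is integrable up to the order $\epsilon^5$. A deformation $\omega_f$ of a function $f(u)$ satisfies $\{\omega,\omega_f\}=O(\epsilon^6)$ if and only if \[ \begin{aligned}\omega_f={}&f+\epsilon Au_x+\epsilon^2(B_1u_{xx}+B_2u_x^2)+\epsilon^3(C_1u_{xxx}+C_2u_xu_{xx}+C_3u_x^3)\\&+\epsilon^4(D_1u_{4x}+D_2u_xu_{xxx}+D_3u_{xx}^2+D_4u_x^2u_{xx}+D_5u_x^4)\\&+\epsilon^5(E_1u_{5x}+E_2u_xu_{4x}+E_3u_{xx}u_{xxx}+E_4u_x^2u_{xxx}+E_5u_xu_{xx}^2+E_6u_x^3u_{xx}+E_7u_x^5)+O(\epsilon^6)\end{aligned} \] with \[ A = \tfrac{1}{2}a f'' \] \[ B_1 = \tfrac{1}{2}b_1 f'' + \tfrac{1}{6}a^{2} f''' \] \[ B_2 = \tfrac{1}{4}b_1 f''' + \tfrac{1}{4}a a' f''' + \tfrac{1}{8}a^{2} f^{(4)} \] \[ C_1 = \tfrac{1}{2}c_1 f'' + \tfrac{1}{3}a^{2} a' f''' + \tfrac{1}{24}a^{3}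 f^{(4)} \] \[ C_2 = \tfrac{3}{4}c_1 f''' + \tfrac{7}{24}a^{2} a'' f''' + \tfrac{11}{12}a (a')^{2} f''' + \tfrac{5}{6}a^{2} a' f^{(4)} + \tfrac{1}{12}a^{3} f^{(5)} \] \[ C_3 = \tfrac{1}{6}c_1 f^{(4)} + \tfrac{1}{18}a^{2} a''' f''' + \tfrac{1}{3}a a' a'' f''' + \tfrac{1}{6}a^{2} a'' f^{(4)} + \tfrac{11}{24}a (a')^{2} f^{(4)} + \tfrac{1}{4}a^{2} a' f^{(5)} + \tfrac{1}{48}a^{3} f^{(6)} \] \[ D_1 = \tfrac{1}{2}d_1 f'' + \tfrac{1}{6}a^{3} a'' f''' + \tfrac{1}{2}a^{2} (a')^{2} f''' + \tfrac{1}{8}a^{3} a' f^{(4)} + \tfrac{1}{120}a^{4} f^{(5)} \] \[ D_2 = d_1 f''' + \tfrac{1}{6}a^{3} a''' f''' + \tfrac{7}{4}a^{2} a' a'' f''' + \tfrac{3}{2}a (a')^{3} f''' + \tfrac{9}{16}a^{3} a'' f^{(4)} + \tfrac{15}{8}a^{2} (a')^{2} f^{(4)} + \tfrac{3}{8}a^{3}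 a' f^{(5)} + \tfrac{1}{48}a^{4} f^{(6)} \] \[ D_3 = \tfrac{1}{2}d_2 f'' + \tfrac{3}{4}d_1 f''' + \tfrac{1}{72}a^{3} a''' f''' + \tfrac{17}{24}a^{2} a' a'' f''' + \tfrac{11}{12}a (a')^{3} f''' + \tfrac{17}{48}a^{3} a'' f^{(4)} + \tfrac{5}{4}a^{2} (a')^{2} f^{(4)} + \tfrac{1}{4}a^{3} a' f^{(5)} + \tfrac{1}{72}a^{4} f^{(6)} \] \[ D_4 = \tfrac{1}{5}d_2 f''' + d_1 f^{(4)} + \tfrac{1}{12}a^{3} a^{(4)} f''' + \tfrac{29}{30}a^{2} a' a''' f''' + \tfrac{9}{10}a^{2} (a'')^{2} f''' + \tfrac{29}{10}a (a')^{2} a'' f''' + \tfrac{1}{3}a^{3} a''' f^{(4)} + 4a^{2} a' a'' f^{(4)} + \tfrac{27}{8}a (a')^{3} f^{(4)} + \tfrac{3}{4}a^{3} a'' f^{(5)} + \tfrac{21}{8}a^{2} (a')^{2} f^{(5)} + \tfrac{7}{16}a^{3} a' f^{(6)} + \tfrac{1}{48}a^{4} f^{(7)} \] \[ D_5 = \tfrac{1}{8}d_1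 f^{(5)} + \tfrac{1}{144}a^{3} a^{(5)} f''' + \tfrac{13}{144}a^{2} a' a^{(4)} f''' + \tfrac{23}{144}a^{2} a'' a''' f''' + \tfrac{7}{18}a (a')^{2} a''' f''' + \tfrac{3}{16}a a' (a'')^{2} f''' + \tfrac{23}{576}a^{3} a^{(4)} f^{(4)} + \tfrac{73}{144}a^{2} a' a''' f^{(4)} + \tfrac{19}{48}a^{2} (a'')^{2} f^{(4)} + \tfrac{4}{3}a (a')^{2} a'' f^{(4)} + \tfrac{13}{144}a^{3} a''' f^{(5)} + \tfrac{47}{48}a^{2} a' a'' f^{(5)} + \tfrac{3}{4}a (a')^{3} f^{(5)} + \tfrac{1}{8}a^{3} a'' f^{(6)} + \tfrac{7}{16}a^{2} (a')^{2} f^{(6)} + \tfrac{1}{16}a^{3} a' f^{(7)} + \tfrac{1}{384}a^{4} f^{(8)} \] \[ E_1 = \tfrac{1}{2}e_1 f'' + \tfrac{1}{18}a^{4} a''' f''' + \tfrac{2}{3}a^{3} a' a'' f''' + \tfrac{2}{3}a^{2} (a')^{3} f''' + \tfrac{1}{16}a^{4} a'' f^{(4)} + \tfrac{1}{4}a^{3}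 (a')^{2} f^{(4)} + \tfrac{1}{30}a^{4} a' f^{(5)} + \tfrac{1}{720}a^{5} f^{(6)} \] \[ E_2 = \tfrac{5}{4}e_1 f''' + \tfrac{1}{16}a^{4} a^{(4)} f''' + \tfrac{79}{72}a^{3} a' a''' f''' + \tfrac{19}{24}a^{3} (a'')^{2} f''' + \tfrac{67}{12}a^{2} (a')^{2} a'' f''' + \tfrac{9}{4}a (a')^{4} f''' + \tfrac{37}{144}a^{4} a''' f^{(4)} + \tfrac{155}{48}a^{3} a' a'' f^{(4)} + \tfrac{7}{2}a^{2} (a')^{3} f^{(4)} + \tfrac{59}{240}a^{4} a'' f^{(5)} + \tfrac{21}{20}a^{3} (a')^{2} f^{(5)} + \tfrac{7}{60}a^{4} a' f^{(6)} + \tfrac{1}{240}a^{5} f^{(7)} \] \[ E_3 = \tfrac{1}{2}e_2 f'' + \tfrac{5}{2}e_1 f''' - \tfrac{35}{576}a^{4} a^{(4)} f''' + \tfrac{13}{144}a^{3} a' a''' f''' + \tfrac{7}{24}a^{3} (a'')^{2} f''' + \tfrac{31}{6}a^{2} (a')^{2} a'' f''' + \tfrac{10}{3}a (a')^{4} f'''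 + \tfrac{17}{48}a^{4} a''' f^{(4)} + \tfrac{241}{48}a^{3} a' a'' f^{(4)} + \tfrac{35}{6}a^{2} (a')^{3} f^{(4)} + \tfrac{19}{48}a^{4} a'' f^{(5)} + \tfrac{7}{4}a^{3} (a')^{2} f^{(5)} + \tfrac{7}{36}a^{4} a' f^{(6)} + \tfrac{1}{144}a^{5} f^{(7)} \] \[ E_4 = \tfrac{1}{12}e_2 f''' + \tfrac{5}{3}e_1 f^{(4)} + \tfrac{17}{576}a^{4} a^{(5)} f''' + \tfrac{743}{1152}a^{3} a' a^{(4)} f''' + \tfrac{101}{72}a^{3} a'' a''' f''' + \tfrac{383}{96}a^{2} (a')^{2} a''' f''' + \tfrac{167}{24}a^{2} a' (a'')^{2} f''' + \tfrac{23}{3}a (a')^{3} a'' f''' + \tfrac{49}{288}a^{4} a^{(4)} f^{(4)} + \tfrac{13}{4}a^{3} a' a''' f^{(4)} + \tfrac{61}{24}a^{3} (a'')^{2} f^{(4)} + \tfrac{215}{12}a^{2} (a')^{2} a'' f^{(4)} + \tfrac{85}{12}a (a')^{4} f^{(4)} + \tfrac{67}{144}a^{4} a''' f^{(5)} + \tfrac{299}{48}a^{3}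 a' a'' f^{(5)} + 7a^{2} (a')^{3} f^{(5)} + \tfrac{19}{48}a^{4} a'' f^{(6)} + \tfrac{7}{4}a^{3} (a')^{2} f^{(6)} + \tfrac{1}{6}a^{4} a' f^{(7)} + \tfrac{1}{192}a^{5} f^{(8)} \] \[ E_5 = \tfrac{11}{28}e_2 f''' + \tfrac{5}{2}e_1 f^{(4)} + \tfrac{1}{144}a^{4} a^{(5)} f''' + \tfrac{545}{2688}a^{3} a' a^{(4)} f''' + \tfrac{121}{112}a^{3} a'' a''' f''' + \tfrac{1241}{672}a^{2} (a')^{2} a''' f''' + \tfrac{87}{14}a^{2} a' (a'')^{2} f''' + \tfrac{253}{42}a (a')^{3} a'' f''' + \tfrac{85}{1152}a^{4} a^{(4)} f^{(4)} + \tfrac{85}{32}a^{3} a' a''' f^{(4)} + \tfrac{121}{48}a^{3} (a'')^{2} f^{(4)} + \tfrac{965}{48}a^{2} (a')^{2} a'' f^{(4)} + \tfrac{55}{6}a (a')^{4} f^{(4)} + \tfrac{79}{144}a^{4} a''' f^{(5)} + \tfrac{383}{48}a^{3} a' a'' f^{(5)} + \tfrac{28}{3}a^{2} (a')^{3} f^{(5)}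 + \tfrac{149}{288}a^{4} a'' f^{(6)} + \tfrac{7}{3}a^{3} (a')^{2} f^{(6)} + \tfrac{2}{9}a^{4} a' f^{(7)} + \tfrac{1}{144}a^{5} f^{(8)} \] \[ E_6 = \tfrac{1}{12}e_2 f^{(4)} + \tfrac{5}{4}e_1 f^{(5)} + \tfrac{31}{3456}a^{4} a^{(6)} f''' + \tfrac{137}{576}a^{3} a' a^{(5)} f''' + \tfrac{91}{192}a^{3} a'' a^{(4)} f''' + \tfrac{113}{288}a^{3} (a''')^{2} f''' + \tfrac{1055}{576}a^{2} (a')^{2} a^{(4)} f''' + \tfrac{599}{96}a^{2} a' a'' a''' f''' + \tfrac{47}{48}a^{2} (a'')^{3} f''' + \tfrac{85}{16}a (a')^{3} a''' f''' + \tfrac{11}{3}a (a')^{2} (a'')^{2} f''' + \tfrac{5}{64}a^{4} a^{(5)} f^{(4)} + \tfrac{1865}{1152}a^{3} a' a^{(4)} f^{(4)} + \tfrac{89}{24}a^{3} a'' a''' f^{(4)} + \tfrac{997}{96}a^{2} (a')^{2} a''' f^{(4)} + \tfrac{103}{6}a^{2} a' (a'')^{2} f^{(4)} + \tfrac{37}{2}a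 (a')^{3} a'' f^{(4)} + \tfrac{127}{576}a^{4} a^{(4)} f^{(5)} + \tfrac{629}{144}a^{3} a' a''' f^{(5)} + \tfrac{85}{24}a^{3} (a'')^{2} f^{(5)} + \tfrac{145}{6}a^{2} (a')^{2} a'' f^{(5)} + \tfrac{37}{4}a (a')^{4} f^{(5)} + \tfrac{95}{216}a^{4} a''' f^{(6)} + \tfrac{221}{36}a^{3} a' a'' f^{(6)} + 7a^{2} (a')^{3} f^{(6)} + \tfrac{1}{3}a^{4} a'' f^{(7)} + \tfrac{3}{2}a^{3} (a')^{2} f^{(7)} + \tfrac{1}{8}a^{4} a' f^{(8)} + \tfrac{1}{288}a^{5} f^{(9)} \] \[ E_7 = \tfrac{1}{10}e_1 f^{(6)} + \tfrac{1}{1440}a^{4} a^{(7)} f''' + \tfrac{3}{160}a^{3} a' a^{(6)} f''' + \tfrac{1}{24}a^{3} a'' a^{(5)} f''' + \tfrac{173}{2880}a^{3} a''' a^{(4)} f''' + \tfrac{7}{48}a^{2} (a')^{2} a^{(5)} f''' + \tfrac{37}{60}a^{2} a' a'' a^{(4)} f''' + \tfrac{151}{480}a^{2} (a'')^{2} a'''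 f''' + \tfrac{79}{360}a^{2} a' (a''')^{2} f''' + \tfrac{23}{48}a (a')^{3} a^{(4)} f''' + \tfrac{69}{80}a (a')^{2} a'' a''' f''' + \tfrac{13}{160}a a' (a'')^{3} f''' + \tfrac{31}{5760}a^{4} a^{(6)} f^{(4)} + \tfrac{121}{960}a^{3} a' a^{(5)} f^{(4)} + \tfrac{181}{640}a^{3} a'' a^{(4)} f^{(4)} + \tfrac{281}{1440}a^{3} (a''')^{2} f^{(4)} + \tfrac{61}{64}a^{2} (a')^{2} a^{(4)} f^{(4)} + \tfrac{737}{240}a^{2} a' a'' a''' f^{(4)} + \tfrac{9}{16}a^{2} (a'')^{3} f^{(4)} + \tfrac{107}{48}a (a')^{3} a''' f^{(4)} + \tfrac{17}{8}a (a')^{2} (a'')^{2} f^{(4)} + \tfrac{91}{4800}a^{4} a^{(5)} f^{(5)} + \tfrac{127}{320}a^{3} a' a^{(4)} f^{(5)} + \tfrac{79}{96}a^{3} a'' a''' f^{(5)} + \tfrac{49}{20}a^{2} (a')^{2} a''' f^{(5)} + \tfrac{115}{32}a^{2} a' (a'')^{2} f^{(5)} + \tfrac{79}{20}a (a')^{3}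 a'' f^{(5)} + \tfrac{211}{5760}a^{4} a^{(4)} f^{(6)} + \tfrac{323}{480}a^{3} a' a''' f^{(6)} + \tfrac{251}{480}a^{3} (a'')^{2} f^{(6)} + \tfrac{409}{120}a^{2} (a')^{2} a'' f^{(6)} + \tfrac{97}{80}a (a')^{4} f^{(6)} + \tfrac{7}{144}a^{4} a''' f^{(7)} + \tfrac{2}{3}a^{3} a' a'' f^{(7)} + \tfrac{3}{4}a^{2} (a')^{3} f^{(7)} + \tfrac{1}{32}a^{4} a'' f^{(8)} + \tfrac{9}{64}a^{3} (a')^{2} f^{(8)} + \tfrac{1}{96}a^{4} a' f^{(9)} + \tfrac{1}{3840}a^{5} f^{(10)} \] Here $b_1,c_1,d_1,d_2$ are given by (i); when $\omega$ is integrable up to the order $\epsilon^6$, also $e_1,e_2$ are given by (ii), and then all the coefficients of $\omega$ and of $\omega_f$ up to the order $\epsilon^5$ are explicit in $a$ and $f$. (iv) Every nowhere vanishing function $a$ occurs: there is a deformation $\omega$ of $u^2$ in normal form with first-order term $\epsilon\,a\,u_x$ that is integrable up to the order $\epsilon^6$. Thus, up to $O(\epsilon^6)$, the integrable normal forms and their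 commuting flows are parametrized exactly by the single function $a$. -/

import Mathlib

open MvPolynomial
open scoped Differential

noncomputable section

/-! Smooth functions of one real variable on an open set. -/

section Smooth

open scoped ContDiff

/-- The algebra of real-valued functions on the open set `U ⊆ ℝ` that are `C^∞` on `U`. -/
def SmoothFn (U : TopologicalSpace.Opens ℝ) : Subalgebra ℝ (U → ℝ) where
  carrier := {g | ContDiffOn ℝ ∞ (Function.extend Subtype.val g (fun _ => 0)) U}
  mul_mem' {g h} hg hh := by
    refine (ContDiffOn.mul hg hh).congr fun x hx => ?_
    have e (k : U → ℝ) : Function.extend Subtype.val k (fun _ => 0) x = k ⟨x, hx⟩ :=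
      Subtype.val_injective.extend_apply k _ ⟨x, hx⟩
    simp [e]
  add_mem' {g h} hg hh := by
    refine (ContDiffOn.add hg hh).congr fun x hx => ?_
    have e (k : U → ℝ) : Function.extend Subtype.val k (fun _ => 0) x = k ⟨x, hx⟩ :=
      Subtype.val_injective.extend_apply k _ ⟨x, hx⟩
    simp [e]
  algebraMap_mem' r := by
    refine (contDiffOn_const (c := r)).congr fun x hx => ?_
    exact Subtype.val_injective.extend_apply _ _ ⟨x, hx⟩

namespace SmoothFn

variable {U : TopologicalSpace.Opens ℝ}

/-- Extension of a smooth function on `U` by zero to the whole line. -/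
def ext0 (g : SmoothFn U) : ℝ → ℝ := Function.extend Subtype.val g.1 (fun _ => 0)

lemma ext0_apply (g : SmoothFn U) (x : U) : (ext0 g) x = g.1 x :=
  Subtype.val_injective.extend_apply g.1 _ x

lemma contDiffOn_ext0 (g : SmoothFn U) : ContDiffOn ℝ ∞ (ext0 g) U := g.2

lemma differentiableAt_ext0 (g : SmoothFn U) (x : U) : DifferentiableAt ℝ (ext0 g) (x : ℝ) :=
  ((contDiffOn_ext0 g).differentiableOn (by simp)).differentiableAt (U.isOpen.mem_nhds x.2)

/-- The ordinary derivative of a smooth function on `U`. -/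
def derivFn (g : SmoothFn U) : SmoothFn U :=
  ⟨fun x => deriv (ext0 g) x, by
    have h : ContDiffOn ℝ ∞ (deriv (ext0 g)) U :=
      (contDiffOn_ext0 g).deriv_of_isOpen U.isOpen (by simp)
    refine h.congr fun x hx => ?_
    exact Subtype.val_injective.extend_apply _ _ ⟨x, hx⟩⟩

lemma derivFn_add (g h : SmoothFn U) : derivFn (g + h) = derivFn g + derivFn h := by
  apply Subtype.ext
  funext x
  have e : ext0 (g + h) =ᶠ[nhds x.1] (ext0 g) + (ext0 h) := by
    filter_upwards [U.isOpen.mem_nhds x.2] with y hy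
    have := ext0_apply (g + h) ⟨y, hy⟩
    simp only [Pi.add_apply, ext0_apply g ⟨y, hy⟩, ext0_apply h ⟨y, hy⟩, this]
    rfl
  change deriv (ext0 (g + h)) x = deriv (ext0 g) x + deriv (ext0 h) x
  rw [e.deriv_eq, deriv_add (differentiableAt_ext0 g x) (differentiableAt_ext0 h x)]

lemma derivFn_mul (g h : SmoothFn U) : derivFn (g * h) = g * derivFn h + h * derivFn g := by
  apply Subtype.ext
  funext x
  have e : ext0 (g * h) =ᶠ[nhds x.1] (ext0 g) * (ext0 h) := by
    filter_upwards [U.isOpen.mem_nhds x.2] with y hy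
    have := ext0_apply (g * h) ⟨y, hy⟩
    simp only [Pi.mul_apply, ext0_apply g ⟨y, hy⟩, ext0_apply h ⟨y, hy⟩, this]
    rfl
  change deriv (ext0 (g * h)) x = g.1 x * deriv (ext0 h) x + h.1 x * deriv (ext0 g) x
  rw [e.deriv_eq, deriv_mul (differentiableAt_ext0 g x) (differentiableAt_ext0 h x),
    ext0_apply, ext0_apply]
  ring

/-- Smooth functions form a differential ring: `g′` is the ordinary derivative. -/
instance : Differential (SmoothFn U) where
  deriv := Derivation.mk' (AddMonoidHom.mk' derivFn derivFn_add).toIntLinearMap derivFn_mul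

/-- The coordinate function `u` on `U`. -/
def coord (U : TopologicalSpace.Opens ℝ) : SmoothFn U :=
  ⟨fun x => x.1, by
    refine (contDiff_id.contDiffOn (s := (U : Set ℝ))).congr fun x hx => ?_
    exact Subtype.val_injective.extend_apply _ _ ⟨x, hx⟩⟩

end SmoothFn

end Smooth

/-! Differential polynomials in `u` and their bracket. -/

section DiffPoly

variable {R : Type*} [CommRing R] [Differential R]

/-- The sequence `g, g′, g″, …` of derivatives of a function `g` of `u`. -/
def derivs (g : R) (k : ℕ) : R := (fun h : R => h′)^[k] g

/-- Differential polynomials: polynomials in the jet variables `u_x, u_xx, …` whose coefficients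
are functions of `u` (elements of `R`). The variable `X k` is the `(k+1)`-st derivative
`u_(k+1)` of `u` with respect to `x`. -/
abbrev DiffPoly (R : Type*) [CommRing R] := MvPolynomial ℕ R

/-- `u_x` -/
abbrev u₁ : DiffPoly R := X 0

/-- `u_xx` -/
abbrev u₂ : DiffPoly R := X 1

/-- `u_xxx` -/
abbrev u₃ : DiffPoly R := X 2

/-- `u_xxxx` -/
abbrev u₄ : DiffPoly R := X 3

/-- `u_xxxxx` -/
abbrev u₅ : DiffPoly R := X 4

/-- The partial derivative `∂F/∂u_(j)`: for `j = 0` the coefficients, which are functions of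
`u = u_(0)`, are differentiated; for `j = k + 1` it is the derivative in the variable `X k`. -/
def jetPartial (j : ℕ) (F : DiffPoly R) : DiffPoly R :=
  match j with
  | 0 => ∑ m ∈ F.support, monomial m ((F.coeff m)′)
  | k + 1 => pderiv k F

/-- Only finitely many of the partial derivatives of a differential polynomial are nonzero. -/
lemma finite_support_jetPartial (F : DiffPoly R) :
    (Function.support fun j => jetPartial j F).Finite := by
  refine ((F.vars.image Nat.succ) ∪ {0}).finite_toSet.subset fun j hj => ?_
  rcases j with _ | k
  · simp
  · have hk : k ∈ F.vars := by
      by_contra h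
      exact hj (pderiv_eq_zero_of_notMem_vars h)
    simp [hk]

/-- The total derivative `∂_x F = ∑_j u_(j+1) ∂F/∂u_(j)` (a finite sum). -/
def totalDeriv (F : DiffPoly R) : DiffPoly R := ∑ᶠ j : ℕ, X j * jetPartial j F

/-- The bracket of one-forms
`{α, β} = ∑_j (∂_x^{j+1} β · ∂α/∂u_(j) - ∂_x^{j+1} α · ∂β/∂u_(j))` (a finite sum). -/
def formBracket (α β : DiffPoly R) : DiffPoly R :=
  ∑ᶠ j : ℕ, (totalDeriv^[j + 1] β * jetPartial j α - totalDeriv^[j + 1] α * jetPartial j β)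

/-- The bracket extended to formal power series in `ε` by `ε`-bilinearity. -/
def seriesBracket (α β : PowerSeries (DiffPoly R)) : PowerSeries (DiffPoly R) :=
  PowerSeries.mk fun n => ∑ p ∈ Finset.HasAntidiagonal.antidiagonal n,
    formBracket (PowerSeries.coeff p.1 α) (PowerSeries.coeff p.2 β)

/-- `F` is a homogeneous differential polynomial of degree `n`, where functions of `u` have
degree `0` and `u_(k)` has degree `k`. -/
def IsHomogOfDegree (F : DiffPoly R) (n : ℕ) : Prop :=
  IsWeightedHomogeneous (fun k : ℕ => k + 1) F n

/-- `ω = f(u) + ∑_{n ≥ 1} ε^n g_n` with `g_n` a homogeneous differential polynomial of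
degree `n`. -/
def IsDeformation (f : R) (ω : PowerSeries (DiffPoly R)) : Prop :=
  PowerSeries.coeff 0 ω = C f ∧ ∀ n, IsHomogOfDegree (PowerSeries.coeff n ω) n

/-- `{α, β} = O(ε^{k+1})`. -/
def InInvolutionUpTo (k : ℕ) (α β : PowerSeries (DiffPoly R)) : Prop :=
  ∀ n ≤ k, PowerSeries.coeff n (seriesBracket α β) = 0

/-- `u_t = ∂_x ω` is integrable up to the order `ε^k`: every function `f` of `u` has a
deformation `ω_f` with `{ω, ω_f} = O(ε^{k+1})`. -/
def IsIntegrableUpTo (k : ℕ) (ω : PowerSeries (DiffPoly R)) : Prop :=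
  ∀ f : R, ∃ ωf, IsDeformation f ωf ∧ InInvolutionUpTo k ω ωf

/-- No term of order `ε^n`, `n ≥ 2`, contains `u_x`: `∂ω_n/∂u_x = 0` for all `n ≥ 2`. -/
def IsNormal (ω : PowerSeries (DiffPoly R)) : Prop :=
  ∀ n, 2 ≤ n → jetPartial 1 (PowerSeries.coeff n ω) = 0

end DiffPoly

/-! The coefficients of the normal form and of the commuting flows. The arguments `a`, `f` are
the sequences of derivatives: `a k`, `f k` stand for the `k`-th derivatives of `a(u)`, `f(u)`. -/

section Coefficients

variable {R : Type*} [CommRing R] [Algebra ℚ R]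

def normalD2 (a : ℕ → R) : R :=
  ((-5/32 : ℚ) • (a 0 ^ 3 * a 4)) + ((-31/24 : ℚ) • (a 0 ^ 2 * a 1 * a 3))
    + ((-3/4 : ℚ) • (a 0 ^ 2 * a 2 ^ 2)) + ((-2 : ℚ) • (a 0 * a 1 ^ 2 * a 2))

def normalE2 (a : ℕ → R) : R :=
  ((-49/240 : ℚ) • (a 0 ^ 4 * a 5)) + ((-299/96 : ℚ) • (a 0 ^ 3 * a 1 * a 4))
    + ((-115/24 : ℚ) • (a 0 ^ 3 * a 2 * a 3)) + ((-305/24 : ℚ) • (a 0 ^ 2 * a 1 ^ 2 * a 3))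
    + ((-117/8 : ℚ) • (a 0 ^ 2 * a 1 * a 2 ^ 2)) + ((-13 : ℚ) • (a 0 * a 1 ^ 3 * a 2))

def flowA (a f : ℕ → R) : R :=
  ((1/2 : ℚ) • (a 0 * f 2))

def flowB1 (a f : ℕ → R) (b₁ : R) : R :=
  ((1/2 : ℚ) • (b₁ * f 2)) + ((1/6 : ℚ) • (a 0 ^ 2 * f 3))

def flowB2 (a f : ℕ → R) (b₁ : R) : R :=
  ((1/4 : ℚ) • (b₁ * f 3)) + ((1/4 : ℚ) • (a 0 * a 1 * f 3)) + ((1/8 : ℚ) • (a 0 ^ 2 * f 4))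

def flowC1 (a f : ℕ → R) (c₁ : R) : R :=
  ((1/2 : ℚ) • (c₁ * f 2)) + ((1/3 : ℚ) • (a 0 ^ 2 * a 1 * f 3))
    + ((1/24 : ℚ) • (a 0 ^ 3 * f 4))

def flowC2 (a f : ℕ → R) (c₁ : R) : R :=
  ((3/4 : ℚ) • (c₁ * f 3)) + ((7/24 : ℚ) • (a 0 ^ 2 * a 2 * f 3))
    + ((11/12 : ℚ) • (a 0 * a 1 ^ 2 * f 3)) + ((5/6 : ℚ) • (a 0 ^ 2 * a 1 * f 4))
    + ((1/12 : ℚ) • (a 0 ^ 3 * f 5))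

def flowC3 (a f : ℕ → R) (c₁ : R) : R :=
  ((1/6 : ℚ) • (c₁ * f 4)) + ((1/18 : ℚ) • (a 0 ^ 2 * a 3 * f 3))
    + ((1/3 : ℚ) • (a 0 * a 1 * a 2 * f 3)) + ((1/6 : ℚ) • (a 0 ^ 2 * a 2 * f 4))
    + ((11/24 : ℚ) • (a 0 * a 1 ^ 2 * f 4)) + ((1/4 : ℚ) • (a 0 ^ 2 * a 1 * f 5))
    + ((1/48 : ℚ) • (a 0 ^ 3 * f 6))

def flowD1 (a f : ℕ → R) (d₁ : R) : R :=
  ((1/2 : ℚ) • (d₁ * f 2)) + ((1/6 : ℚ) • (a 0 ^ 3 * a 2 * f 3))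
    + ((1/2 : ℚ) • (a 0 ^ 2 * a 1 ^ 2 * f 3)) + ((1/8 : ℚ) • (a 0 ^ 3 * a 1 * f 4))
    + ((1/120 : ℚ) • (a 0 ^ 4 * f 5))

def flowD2 (a f : ℕ → R) (d₁ : R) : R :=
  (d₁ * f 3) + ((1/6 : ℚ) • (a 0 ^ 3 * a 3 * f 3)) + ((7/4 : ℚ) • (a 0 ^ 2 * a 1 * a 2 * f 3))
    + ((3/2 : ℚ) • (a 0 * a 1 ^ 3 * f 3)) + ((9/16 : ℚ) • (a 0 ^ 3 * a 2 * f 4))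
    + ((15/8 : ℚ) • (a 0 ^ 2 * a 1 ^ 2 * f 4)) + ((3/8 : ℚ) • (a 0 ^ 3 * a 1 * f 5))
    + ((1/48 : ℚ) • (a 0 ^ 4 * f 6))

def flowD3 (a f : ℕ → R) (d₁ d₂ : R) : R :=
  ((1/2 : ℚ) • (d₂ * f 2)) + ((3/4 : ℚ) • (d₁ * f 3)) + ((1/72 : ℚ) • (a 0 ^ 3 * a 3 * f 3))
    + ((17/24 : ℚ) • (a 0 ^ 2 * a 1 * a 2 * f 3)) + ((11/12 : ℚ) • (a 0 * a 1 ^ 3 * f 3))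
    + ((17/48 : ℚ) • (a 0 ^ 3 * a 2 * f 4)) + ((5/4 : ℚ) • (a 0 ^ 2 * a 1 ^ 2 * f 4))
    + ((1/4 : ℚ) • (a 0 ^ 3 * a 1 * f 5)) + ((1/72 : ℚ) • (a 0 ^ 4 * f 6))

def flowD4 (a f : ℕ → R) (d₁ d₂ : R) : R :=
  ((1/5 : ℚ) • (d₂ * f 3)) + (d₁ * f 4) + ((1/12 : ℚ) • (a 0 ^ 3 * a 4 * f 3))
    + ((29/30 : ℚ) • (a 0 ^ 2 * a 1 * a 3 * f 3)) + ((9/10 : ℚ) • (a 0 ^ 2 * a 2 ^ 2 * f 3))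
    + ((29/10 : ℚ) • (a 0 * a 1 ^ 2 * a 2 * f 3)) + ((1/3 : ℚ) • (a 0 ^ 3 * a 3 * f 4))
    + ((4 : ℚ) • (a 0 ^ 2 * a 1 * a 2 * f 4)) + ((27/8 : ℚ) • (a 0 * a 1 ^ 3 * f 4))
    + ((3/4 : ℚ) • (a 0 ^ 3 * a 2 * f 5)) + ((21/8 : ℚ) • (a 0 ^ 2 * a 1 ^ 2 * f 5))
    + ((7/16 : ℚ) • (a 0 ^ 3 * a 1 * f 6)) + ((1/48 : ℚ) • (a 0 ^ 4 * f 7))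

def flowD5 (a f : ℕ → R) (d₁ : R) : R :=
  ((1/8 : ℚ) • (d₁ * f 5)) + ((1/144 : ℚ) • (a 0 ^ 3 * a 5 * f 3))
    + ((13/144 : ℚ) • (a 0 ^ 2 * a 1 * a 4 * f 3))
    + ((23/144 : ℚ) • (a 0 ^ 2 * a 2 * a 3 * f 3)) + ((7/18 : ℚ) • (a 0 * a 1 ^ 2 * a 3 * f 3))
    + ((3/16 : ℚ) • (a 0 * a 1 * a 2 ^ 2 * f 3)) + ((23/576 : ℚ) • (a 0 ^ 3 * a 4 * f 4))
    + ((73/144 : ℚ) • (a 0 ^ 2 * a 1 * a 3 * f 4)) + ((19/48 : ℚ) • (a 0 ^ 2 * a 2 ^ 2 * f 4))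
    + ((4/3 : ℚ) • (a 0 * a 1 ^ 2 * a 2 * f 4)) + ((13/144 : ℚ) • (a 0 ^ 3 * a 3 * f 5))
    + ((47/48 : ℚ) • (a 0 ^ 2 * a 1 * a 2 * f 5)) + ((3/4 : ℚ) • (a 0 * a 1 ^ 3 * f 5))
    + ((1/8 : ℚ) • (a 0 ^ 3 * a 2 * f 6)) + ((7/16 : ℚ) • (a 0 ^ 2 * a 1 ^ 2 * f 6))
    + ((1/16 : ℚ) • (a 0 ^ 3 * a 1 * f 7)) + ((1/384 : ℚ) • (a 0 ^ 4 * f 8))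

def flowE1 (a f : ℕ → R) (e₁ : R) : R :=
  ((1/2 : ℚ) • (e₁ * f 2)) + ((1/18 : ℚ) • (a 0 ^ 4 * a 3 * f 3))
    + ((2/3 : ℚ) • (a 0 ^ 3 * a 1 * a 2 * f 3)) + ((2/3 : ℚ) • (a 0 ^ 2 * a 1 ^ 3 * f 3))
    + ((1/16 : ℚ) • (a 0 ^ 4 * a 2 * f 4)) + ((1/4 : ℚ) • (a 0 ^ 3 * a 1 ^ 2 * f 4))
    + ((1/30 : ℚ) • (a 0 ^ 4 * a 1 * f 5)) + ((1/720 : ℚ) • (a 0 ^ 5 * f 6))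

def flowE2 (a f : ℕ → R) (e₁ : R) : R :=
  ((5/4 : ℚ) • (e₁ * f 3)) + ((1/16 : ℚ) • (a 0 ^ 4 * a 4 * f 3))
    + ((79/72 : ℚ) • (a 0 ^ 3 * a 1 * a 3 * f 3)) + ((19/24 : ℚ) • (a 0 ^ 3 * a 2 ^ 2 * f 3))
    + ((67/12 : ℚ) • (a 0 ^ 2 * a 1 ^ 2 * a 2 * f 3)) + ((9/4 : ℚ) • (a 0 * a 1 ^ 4 * f 3))
    + ((37/144 : ℚ) • (a 0 ^ 4 * a 3 * f 4)) + ((155/48 : ℚ) • (a 0 ^ 3 * a 1 * a 2 * f 4))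
    + ((7/2 : ℚ) • (a 0 ^ 2 * a 1 ^ 3 * f 4)) + ((59/240 : ℚ) • (a 0 ^ 4 * a 2 * f 5))
    + ((21/20 : ℚ) • (a 0 ^ 3 * a 1 ^ 2 * f 5)) + ((7/60 : ℚ) • (a 0 ^ 4 * a 1 * f 6))
    + ((1/240 : ℚ) • (a 0 ^ 5 * f 7))

def flowE3 (a f : ℕ → R) (e₁ e₂ : R) : R :=
  ((1/2 : ℚ) • (e₂ * f 2)) + ((5/2 : ℚ) • (e₁ * f 3)) + ((-35/576 : ℚ) • (a 0 ^ 4 * a 4 * f 3))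
    + ((13/144 : ℚ) • (a 0 ^ 3 * a 1 * a 3 * f 3)) + ((7/24 : ℚ) • (a 0 ^ 3 * a 2 ^ 2 * f 3))
    + ((31/6 : ℚ) • (a 0 ^ 2 * a 1 ^ 2 * a 2 * f 3)) + ((10/3 : ℚ) • (a 0 * a 1 ^ 4 * f 3))
    + ((17/48 : ℚ) • (a 0 ^ 4 * a 3 * f 4)) + ((241/48 : ℚ) • (a 0 ^ 3 * a 1 * a 2 * f 4))
    + ((35/6 : ℚ) • (a 0 ^ 2 * a 1 ^ 3 * f 4)) + ((19/48 : ℚ) • (a 0 ^ 4 * a 2 * f 5))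
    + ((7/4 : ℚ) • (a 0 ^ 3 * a 1 ^ 2 * f 5)) + ((7/36 : ℚ) • (a 0 ^ 4 * a 1 * f 6))
    + ((1/144 : ℚ) • (a 0 ^ 5 * f 7))

def flowE4 (a f : ℕ → R) (e₁ e₂ : R) : R :=
  ((1/12 : ℚ) • (e₂ * f 3)) + ((5/3 : ℚ) • (e₁ * f 4)) + ((17/576 : ℚ) • (a 0 ^ 4 * a 5 * f 3))
    + ((743/1152 : ℚ) • (a 0 ^ 3 * a 1 * a 4 * f 3))
    + ((101/72 : ℚ) • (a 0 ^ 3 * a 2 * a 3 * f 3))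
    + ((383/96 : ℚ) • (a 0 ^ 2 * a 1 ^ 2 * a 3 * f 3))
    + ((167/24 : ℚ) • (a 0 ^ 2 * a 1 * a 2 ^ 2 * f 3))
    + ((23/3 : ℚ) • (a 0 * a 1 ^ 3 * a 2 * f 3)) + ((49/288 : ℚ) • (a 0 ^ 4 * a 4 * f 4))
    + ((13/4 : ℚ) • (a 0 ^ 3 * a 1 * a 3 * f 4)) + ((61/24 : ℚ) • (a 0 ^ 3 * a 2 ^ 2 * f 4))
    + ((215/12 : ℚ) • (a 0 ^ 2 * a 1 ^ 2 * a 2 * f 4)) + ((85/12 : ℚ) • (a 0 * a 1 ^ 4 * f 4))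
    + ((67/144 : ℚ) • (a 0 ^ 4 * a 3 * f 5)) + ((299/48 : ℚ) • (a 0 ^ 3 * a 1 * a 2 * f 5))
    + ((7 : ℚ) • (a 0 ^ 2 * a 1 ^ 3 * f 5)) + ((19/48 : ℚ) • (a 0 ^ 4 * a 2 * f 6))
    + ((7/4 : ℚ) • (a 0 ^ 3 * a 1 ^ 2 * f 6)) + ((1/6 : ℚ) • (a 0 ^ 4 * a 1 * f 7))
    + ((1/192 : ℚ) • (a 0 ^ 5 * f 8))

def flowE5 (a f : ℕ → R) (e₁ e₂ : R) : R :=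
  ((11/28 : ℚ) • (e₂ * f 3)) + ((5/2 : ℚ) • (e₁ * f 4)) + ((1/144 : ℚ) • (a 0 ^ 4 * a 5 * f 3))
    + ((545/2688 : ℚ) • (a 0 ^ 3 * a 1 * a 4 * f 3))
    + ((121/112 : ℚ) • (a 0 ^ 3 * a 2 * a 3 * f 3))
    + ((1241/672 : ℚ) • (a 0 ^ 2 * a 1 ^ 2 * a 3 * f 3))
    + ((87/14 : ℚ) • (a 0 ^ 2 * a 1 * a 2 ^ 2 * f 3))
    + ((253/42 : ℚ) • (a 0 * a 1 ^ 3 * a 2 * f 3)) + ((85/1152 : ℚ) • (a 0 ^ 4 * a 4 * f 4))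
    + ((85/32 : ℚ) • (a 0 ^ 3 * a 1 * a 3 * f 4)) + ((121/48 : ℚ) • (a 0 ^ 3 * a 2 ^ 2 * f 4))
    + ((965/48 : ℚ) • (a 0 ^ 2 * a 1 ^ 2 * a 2 * f 4)) + ((55/6 : ℚ) • (a 0 * a 1 ^ 4 * f 4))
    + ((79/144 : ℚ) • (a 0 ^ 4 * a 3 * f 5)) + ((383/48 : ℚ) • (a 0 ^ 3 * a 1 * a 2 * f 5))
    + ((28/3 : ℚ) • (a 0 ^ 2 * a 1 ^ 3 * f 5)) + ((149/288 : ℚ) • (a 0 ^ 4 * a 2 * f 6))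
    + ((7/3 : ℚ) • (a 0 ^ 3 * a 1 ^ 2 * f 6)) + ((2/9 : ℚ) • (a 0 ^ 4 * a 1 * f 7))
    + ((1/144 : ℚ) • (a 0 ^ 5 * f 8))

def flowE6 (a f : ℕ → R) (e₁ e₂ : R) : R :=
  ((1/12 : ℚ) • (e₂ * f 4)) + ((5/4 : ℚ) • (e₁ * f 5)) + ((31/3456 : ℚ) • (a 0 ^ 4 * a 6 * f 3))
    + ((137/576 : ℚ) • (a 0 ^ 3 * a 1 * a 5 * f 3))
    + ((91/192 : ℚ) • (a 0 ^ 3 * a 2 * a 4 * f 3)) + ((113/288 : ℚ) • (a 0 ^ 3 * a 3 ^ 2 * f 3))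
    + ((1055/576 : ℚ) • (a 0 ^ 2 * a 1 ^ 2 * a 4 * f 3))
    + ((599/96 : ℚ) • (a 0 ^ 2 * a 1 * a 2 * a 3 * f 3))
    + ((47/48 : ℚ) • (a 0 ^ 2 * a 2 ^ 3 * f 3)) + ((85/16 : ℚ) • (a 0 * a 1 ^ 3 * a 3 * f 3))
    + ((11/3 : ℚ) • (a 0 * a 1 ^ 2 * a 2 ^ 2 * f 3)) + ((5/64 : ℚ) • (a 0 ^ 4 * a 5 * f 4))
    + ((1865/1152 : ℚ) • (a 0 ^ 3 * a 1 * a 4 * f 4))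
    + ((89/24 : ℚ) • (a 0 ^ 3 * a 2 * a 3 * f 4))
    + ((997/96 : ℚ) • (a 0 ^ 2 * a 1 ^ 2 * a 3 * f 4))
    + ((103/6 : ℚ) • (a 0 ^ 2 * a 1 * a 2 ^ 2 * f 4))
    + ((37/2 : ℚ) • (a 0 * a 1 ^ 3 * a 2 * f 4)) + ((127/576 : ℚ) • (a 0 ^ 4 * a 4 * f 5))
    + ((629/144 : ℚ) • (a 0 ^ 3 * a 1 * a 3 * f 5)) + ((85/24 : ℚ) • (a 0 ^ 3 * a 2 ^ 2 * f 5))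
    + ((145/6 : ℚ) • (a 0 ^ 2 * a 1 ^ 2 * a 2 * f 5)) + ((37/4 : ℚ) • (a 0 * a 1 ^ 4 * f 5))
    + ((95/216 : ℚ) • (a 0 ^ 4 * a 3 * f 6)) + ((221/36 : ℚ) • (a 0 ^ 3 * a 1 * a 2 * f 6))
    + ((7 : ℚ) • (a 0 ^ 2 * a 1 ^ 3 * f 6)) + ((1/3 : ℚ) • (a 0 ^ 4 * a 2 * f 7))
    + ((3/2 : ℚ) • (a 0 ^ 3 * a 1 ^ 2 * f 7)) + ((1/8 : ℚ) • (a 0 ^ 4 * a 1 * f 8))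
    + ((1/288 : ℚ) • (a 0 ^ 5 * f 9))

def flowE7 (a f : ℕ → R) (e₁ : R) : R :=
  ((1/10 : ℚ) • (e₁ * f 6)) + ((1/1440 : ℚ) • (a 0 ^ 4 * a 7 * f 3))
    + ((3/160 : ℚ) • (a 0 ^ 3 * a 1 * a 6 * f 3)) + ((1/24 : ℚ) • (a 0 ^ 3 * a 2 * a 5 * f 3))
    + ((173/2880 : ℚ) • (a 0 ^ 3 * a 3 * a 4 * f 3))
    + ((7/48 : ℚ) • (a 0 ^ 2 * a 1 ^ 2 * a 5 * f 3))
    + ((37/60 : ℚ) • (a 0 ^ 2 * a 1 * a 2 * a 4 * f 3))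
    + ((151/480 : ℚ) • (a 0 ^ 2 * a 2 ^ 2 * a 3 * f 3))
    + ((79/360 : ℚ) • (a 0 ^ 2 * a 1 * a 3 ^ 2 * f 3))
    + ((23/48 : ℚ) • (a 0 * a 1 ^ 3 * a 4 * f 3))
    + ((69/80 : ℚ) • (a 0 * a 1 ^ 2 * a 2 * a 3 * f 3))
    + ((13/160 : ℚ) • (a 0 * a 1 * a 2 ^ 3 * f 3)) + ((31/5760 : ℚ) • (a 0 ^ 4 * a 6 * f 4))
    + ((121/960 : ℚ) • (a 0 ^ 3 * a 1 * a 5 * f 4))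
    + ((181/640 : ℚ) • (a 0 ^ 3 * a 2 * a 4 * f 4))
    + ((281/1440 : ℚ) • (a 0 ^ 3 * a 3 ^ 2 * f 4))
    + ((61/64 : ℚ) • (a 0 ^ 2 * a 1 ^ 2 * a 4 * f 4))
    + ((737/240 : ℚ) • (a 0 ^ 2 * a 1 * a 2 * a 3 * f 4))
    + ((9/16 : ℚ) • (a 0 ^ 2 * a 2 ^ 3 * f 4)) + ((107/48 : ℚ) • (a 0 * a 1 ^ 3 * a 3 * f 4))
    + ((17/8 : ℚ) • (a 0 * a 1 ^ 2 * a 2 ^ 2 * f 4)) + ((91/4800 : ℚ) • (a 0 ^ 4 * a 5 * f 5))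
    + ((127/320 : ℚ) • (a 0 ^ 3 * a 1 * a 4 * f 5))
    + ((79/96 : ℚ) • (a 0 ^ 3 * a 2 * a 3 * f 5))
    + ((49/20 : ℚ) • (a 0 ^ 2 * a 1 ^ 2 * a 3 * f 5))
    + ((115/32 : ℚ) • (a 0 ^ 2 * a 1 * a 2 ^ 2 * f 5))
    + ((79/20 : ℚ) • (a 0 * a 1 ^ 3 * a 2 * f 5)) + ((211/5760 : ℚ) • (a 0 ^ 4 * a 4 * f 6))
    + ((323/480 : ℚ) • (a 0 ^ 3 * a 1 * a 3 * f 6))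
    + ((251/480 : ℚ) • (a 0 ^ 3 * a 2 ^ 2 * f 6))
    + ((409/120 : ℚ) • (a 0 ^ 2 * a 1 ^ 2 * a 2 * f 6)) + ((97/80 : ℚ) • (a 0 * a 1 ^ 4 * f 6))
    + ((7/144 : ℚ) • (a 0 ^ 4 * a 3 * f 7)) + ((2/3 : ℚ) • (a 0 ^ 3 * a 1 * a 2 * f 7))
    + ((3/4 : ℚ) • (a 0 ^ 2 * a 1 ^ 3 * f 7)) + ((1/32 : ℚ) • (a 0 ^ 4 * a 2 * f 8))
    + ((9/64 : ℚ) • (a 0 ^ 3 * a 1 ^ 2 * f 8)) + ((1/96 : ℚ) • (a 0 ^ 4 * a 1 * f 9))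
    + ((1/3840 : ℚ) • (a 0 ^ 5 * f 10))

end Coefficients

end

/-!
Write `T g = {u², g}`. At the order `ε^n` the equation `{ω, ω_f} = 0` reads `T g_n + H_n = 0`,
where `g_n` is the term of order `ε^n` of `ω_f` and `H_n` is the sum of the brackets
`{ω_i, g_(n-i)}` with `1 ≤ i ≤ n`. So the flow is found order by order, and everything rests on the
operator `T`.

Since `∂_x` is a derivation, `-T = ∑_k (c_k u_x u_(k+1) + S_k) ∂/∂u_(k+1)` with positive integers
`c_k` and polynomials `S_k` in `u_xx, u_xxx, …`. In particular `T` raises the degree in `u_x` by at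
most one, and its part of degree one multiplies each monomial by `u_x` and an integer that is nonzero
unless the monomial is `1`. Hence `T` is injective on differential polynomials without constant
term, and no nonzero value of `T` there is free of `u_x` (`eq_zero_of_coeff_bracket`). Conversely,
triangular elimination with respect to the degree in `u_x` solves `T g + H = ρ` for every `H` that
is homogeneous of degree at least two, with a remainder `ρ` free of `u_x`. Both `g` and `ρ` are then
unique, and the equation `T g + H = 0` is solvable exactly if `ρ = 0`
(`eq_and_eq_zero_of_bracket_add_eq`).

Up to the fifth order the stated flow solves the equations (`order_one`, …, `order_five`). The
remainders at the orders three to six (`order_three_obstruction`, …, `order_six_obstruction`) are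
combinations of `a f‴ (b - (a² / 2)′)`, `a f‴ (c - (a³ / 6)″)` and so on. For `f = u³ / 6`, with
`f‴ = 1`, they vanish only if the coefficients of the normal form are the stated ones, because `a`
vanishes nowhere; and then they vanish for every `f`. At the sixth order the remainder does not
involve the terms of order `ε^6` of `ω`, so these are arbitrary. This also gives the existence of
`ω` for each `a`.

These equations are identities in the derivatives of `a`, `f` and of the free coefficients with up
to several hundred terms. They are verified by reflection: a differential polynomial is represented
by a list of pairs of integers (`JetPoly`), on which the kernel runs the operations `∂_x`,
`∂/∂u_(j)`, the bracket and the elimination. The class `Reifies` relates an expression to its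
representation.
-/

noncomputable section

/-! ### Derivations of the ring of differential polynomials -/

section Derivations

variable {R : Type*} [CommRing R] [Differential R]

lemma coeff_jetPartial_zero (F : DiffPoly R) (m : ℕ →₀ ℕ) :
    coeff m (jetPartial 0 F) = (coeff m F)′ := by
  classical
  simp only [jetPartial, coeff_sum, coeff_monomial]
  rw [Finset.sum_ite_eq' F.support m]
  split_ifs with h
  · rfl
  · rw [notMem_support_iff.mp h, map_zero]

lemma jetPartial_add (j : ℕ) (F G : DiffPoly R) :
    jetPartial j (F + G) = jetPartial j F + jetPartial j G := by
  cases j with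
  | zero => ext m; simp [coeff_jetPartial_zero]
  | succ k => simp [jetPartial]

lemma jetPartial_mul (j : ℕ) (F G : DiffPoly R) :
    jetPartial j (F * G) = F * jetPartial j G + G * jetPartial j F := by
  classical
  cases j with
  | zero =>
    ext m
    rw [mul_comm G]
    simp only [coeff_jetPartial_zero, coeff_add, coeff_mul, map_sum, ← Finset.sum_add_distrib,
      Derivation.leibniz, smul_eq_mul]
    exact Finset.sum_congr rfl fun p _ => by ring
  | succ k => simp [jetPartial, Derivation.leibniz]

/-- The partial derivative `∂/∂u_(j)` as a derivation of the ring of differential polynomials. -/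
def jetDerivation (j : ℕ) : Derivation ℤ (DiffPoly R) (DiffPoly R) :=
  Derivation.mk' (AddMonoidHom.mk' (jetPartial j) (jetPartial_add j)).toIntLinearMap
    (jetPartial_mul j)

lemma jetDerivation_apply (j : ℕ) (F : DiffPoly R) : jetDerivation j F = jetPartial j F := rfl

lemma jetPartial_zero_C (r : R) : jetPartial 0 (C r : DiffPoly R) = C r′ := by
  classical
  ext m
  rw [coeff_jetPartial_zero, coeff_C, coeff_C]
  split_ifs <;> simp

lemma jetPartial_succ_C (k : ℕ) (r : R) : jetPartial (k + 1) (C r : DiffPoly R) = 0 := by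
  simp [jetPartial]

lemma jetPartial_zero_X (k : ℕ) : jetPartial 0 (X k : DiffPoly R) = 0 := by
  classical
  ext m
  rw [coeff_jetPartial_zero, coeff_X]
  split_ifs <;> simp

lemma jetPartial_succ_X (k l : ℕ) :
    jetPartial (k + 1) (X l : DiffPoly R) = if l = k then 1 else 0 := by
  classical
  simp [jetPartial, pderiv_X, Pi.single_apply, eq_comm]

lemma finite_support_X_mul_jetPartial (F : DiffPoly R) :
    (Function.support fun j => X j * jetPartial j F).Finite :=
  (finite_support_jetPartial F).subset fun j hj h => hj (by simp [h])

lemma totalDeriv_add (F G : DiffPoly R) : totalDeriv (F + G) = totalDeriv F + totalDeriv G := by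
  simp only [totalDeriv, jetPartial_add, mul_add]
  exact finsum_add_distrib (finite_support_X_mul_jetPartial F) (finite_support_X_mul_jetPartial G)

lemma totalDeriv_mul (F G : DiffPoly R) :
    totalDeriv (F * G) = F * totalDeriv G + G * totalDeriv F := by
  have hF := finite_support_X_mul_jetPartial F
  have hG := finite_support_X_mul_jetPartial G
  simp only [totalDeriv]
  rw [mul_finsum' _ _ hG, mul_finsum' _ _ hF, ← finsum_add_distrib]
  · exact finsum_congr fun j => by rw [jetPartial_mul]; ring
  · exact hG.subset fun j hj h => hj (by simp [h])
  · exact hF.subset fun j hj h => hj (by simp [h])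

/-- The total derivative `∂_x` as a derivation of the ring of differential polynomials. -/
def totalDerivation : Derivation ℤ (DiffPoly R) (DiffPoly R) :=
  Derivation.mk' (AddMonoidHom.mk' totalDeriv totalDeriv_add).toIntLinearMap totalDeriv_mul

lemma totalDerivation_apply (F : DiffPoly R) : totalDerivation F = totalDeriv F := rfl

lemma totalDeriv_C (r : R) : totalDeriv (C r : DiffPoly R) = C r′ * X 0 := by
  rw [totalDeriv, finsum_eq_single _ 0, jetPartial_zero_C, mul_comm]
  intro j hj
  obtain ⟨k, rfl⟩ := Nat.exists_eq_succ_of_ne_zero hj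
  simp [jetPartial]

lemma totalDeriv_X (k : ℕ) : totalDeriv (X k : DiffPoly R) = X (k + 1) := by
  rw [totalDeriv, finsum_eq_single _ (k + 1), jetPartial_succ_X, if_pos rfl, mul_one]
  intro j hj
  cases j with
  | zero => rw [jetPartial_zero_X, mul_zero]
  | succ l => rw [jetPartial_succ_X, if_neg (by omega), mul_zero]

/-- The bracket is a sum over `j < N` as soon as neither argument depends on `u_(j)`, `j ≥ N`. -/
lemma formBracket_eq_sum {α β : DiffPoly R} (N : ℕ) (hα : ∀ j, N ≤ j → jetPartial j α = 0)
    (hβ : ∀ j, N ≤ j → jetPartial j β = 0) :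
    formBracket α β = ∑ j ∈ Finset.range N,
      (totalDeriv^[j + 1] β * jetPartial j α - totalDeriv^[j + 1] α * jetPartial j β) := by
  rw [formBracket, finsum_eq_sum_of_support_subset]
  intro j hj
  by_contra h
  have h' : N ≤ j := by simpa using h
  exact hj (by simp [hα j h', hβ j h'])

lemma exists_jetPartial_eq_zero (F : DiffPoly R) : ∃ N, ∀ j, N ≤ j → jetPartial j F = 0 := by
  obtain ⟨N, hN⟩ := (finite_support_jetPartial F).bddAbove
  refine ⟨N + 1, fun j hj => ?_⟩
  by_contra h
  have : j ≤ N := hN h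
  omega

lemma iterate_totalDeriv_sub (n : ℕ) (F G : DiffPoly R) :
    totalDeriv^[n] (F - G) = totalDeriv^[n] F - totalDeriv^[n] G := by
  induction n generalizing F G with
  | zero => rfl
  | succ n ih =>
    rw [Function.iterate_succ_apply, Function.iterate_succ_apply, Function.iterate_succ_apply, ← ih]
    exact congrArg _ (map_sub totalDerivation F G)

lemma iterate_totalDeriv_nsmul (n m : ℕ) (F : DiffPoly R) :
    totalDeriv^[n] (m • F) = m • totalDeriv^[n] F := by
  induction n generalizing F with
  | zero => rfl
  | succ n ih =>
    rw [Function.iterate_succ_apply, Function.iterate_succ_apply, ← ih]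
    exact congrArg _ (map_nsmul totalDerivation m F)

lemma formBracket_sub_right (α β γ : DiffPoly R) :
    formBracket α (β - γ) = formBracket α β - formBracket α γ := by
  have hs (j : ℕ) : jetPartial j (β - γ) = jetPartial j β - jetPartial j γ :=
    map_sub (jetDerivation j) β γ
  obtain ⟨A, hA⟩ := exists_jetPartial_eq_zero α
  obtain ⟨B, hB⟩ := exists_jetPartial_eq_zero β
  obtain ⟨G, hG⟩ := exists_jetPartial_eq_zero γ
  have hA' : ∀ j, A + B + G ≤ j → jetPartial j α = 0 := fun j hj => hA j (by omega)
  have hB' : ∀ j, A + B + G ≤ j → jetPartial j β = 0 := fun j hj => hB j (by omega)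
  have hG' : ∀ j, A + B + G ≤ j → jetPartial j γ = 0 := fun j hj => hG j (by omega)
  rw [formBracket_eq_sum _ hA' hB', formBracket_eq_sum _ hA' hG',
    formBracket_eq_sum _ hA' fun j hj => by rw [hs, hB' j hj, hG' j hj, sub_zero],
    ← Finset.sum_sub_distrib]
  refine Finset.sum_congr rfl fun j _ => ?_
  rw [iterate_totalDeriv_sub, hs]
  ring

lemma formBracket_nsmul_nsmul (m n : ℕ) (α β : DiffPoly R) :
    formBracket (m • α) (n • β) = (m * n) • formBracket α β := by
  have hs (k j : ℕ) (γ : DiffPoly R) : jetPartial j (k • γ) = k • jetPartial j γ :=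
    map_nsmul (jetDerivation j) k γ
  obtain ⟨A, hA⟩ := exists_jetPartial_eq_zero α
  obtain ⟨B, hB⟩ := exists_jetPartial_eq_zero β
  have hA' : ∀ j, A + B ≤ j → jetPartial j α = 0 := fun j hj => hA j (by omega)
  have hB' : ∀ j, A + B ≤ j → jetPartial j β = 0 := fun j hj => hB j (by omega)
  rw [formBracket_eq_sum _ hA' hB',
    formBracket_eq_sum (A + B) (fun j hj => by rw [hs, hA' j hj, smul_zero])
      (fun j hj => by rw [hs, hB' j hj, smul_zero]), Finset.smul_sum]
  refine Finset.sum_congr rfl fun j _ => ?_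
  rw [iterate_totalDeriv_nsmul, iterate_totalDeriv_nsmul, hs, hs]
  simp only [nsmul_eq_mul]
  push_cast
  ring

lemma derivs_succ (g : R) (k : ℕ) : derivs g (k + 1) = (derivs g k)′ :=
  Function.iterate_succ_apply' _ _ _

end Derivations

/-! ### A computable model of differential polynomials -/

section Reflection

/-- Differential polynomials of the computable model: lists of terms, each with a key and an
integer coefficient. The key of a monomial has in base `256` the exponents as its digits. The digit
in position `10 * k` belongs to the jet variable `u_(k)`, including `u_(0) = u`, and that in
position `10 * k + n`, `0 < n < 10`, to the `k`-th derivative of the `n`-th coefficient function.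

The operations below are run by the kernel. They are written with recursors because these reduce
faster than definitions by structural recursion. -/
abbrev JetPoly := List (ℕ × ℤ)

namespace JetPoly

/-- `List.foldr`, by the recursor. -/
def fold {α β : Type} (f : α → β → β) (b : β) (l : List α) : β :=
  List.rec b (fun a _ ih => f a ih) l

/-- `cond`, by the recursor. -/
def sel {α : Type} (b : Bool) (x y : α) : α := Bool.rec y x b

/-- The exponent of the `i`-th variable. -/
def digit (i k : ℕ) : ℕ := Nat.mod (Nat.div k (Nat.pow 256 i)) 256

/-- Whether an integer is zero. -/
def isZeroInt (c : ℤ) : Bool := Int.rec (fun n => Nat.beq n 0) (fun _ => false) c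

/-- A term in front of a polynomial, unless its coefficient is zero. -/
def consTerm (k : ℕ) (c : ℤ) (p : JetPoly) : JetPoly := sel (isZeroInt c) p ((k, c) :: p)

/-- The sum of two polynomials with increasing keys. -/
def add (p : JetPoly) : JetPoly → JetPoly :=
  List.rec (fun q => q) (fun s p ihp q =>
    List.rec (s :: p) (fun t q ihq =>
      sel (Nat.beq s.1 t.1) (consTerm s.1 (Int.add s.2 t.2) (ihp q))
        (sel (Nat.ble s.1 t.1) (s :: ihp (t :: q)) (t :: ihq))) q) p

/-- The product with a term. -/
def mulTerm (k : ℕ) (c : ℤ) (p : JetPoly) : JetPoly :=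
  fold (fun t q => (Nat.add k t.1, Int.mul c t.2) :: q) [] p

/-- The product, as a sum over the terms of the first factor. -/
def mulAux (p q : JetPoly) : JetPoly := fold (fun s r => add (mulTerm s.1 s.2 q) r) [] p

/-- The number of terms. -/
def size (p : JetPoly) : ℕ := fold (fun _ n => Nat.succ n) 0 p

/-- The product, as a sum over the terms of the shorter factor. -/
def mul (p q : JetPoly) : JetPoly :=
  List.rec [] (fun _ _ _ => sel (Nat.ble (size p) (size q)) (mulAux p q) (mulAux q p)) p

/-- The power. -/
def pow (p : JetPoly) (n : ℕ) : JetPoly := Nat.rec [(0, 1)] (fun _ ih => mul p ih) n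

/-- The derivative with respect to the `i`-th variable. -/
def varDeriv (i : ℕ) (p : JetPoly) : JetPoly :=
  fold (fun t q => sel (Nat.beq (digit i t.1) 0) q
    ((Nat.sub t.1 (Nat.pow 256 i), Int.mul (Int.ofNat (digit i t.1)) t.2) :: q)) [] p

/-- A number whose nonzero digits are those that are nonzero in some key. -/
def support (p : JetPoly) : ℕ := fold (fun t n => Nat.lor t.1 n) 0 p

/-- A number of variables, in the order of positions, that suffices for `p`. -/
def numVars (p : JetPoly) : ℕ := Nat.succ (Nat.div (Nat.log2 (support p)) 8)

/-- The derivation with the values `ρ` on the variables. -/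
def derive (ρ : ℕ → JetPoly) (p : JetPoly) : JetPoly :=
  Nat.rec [] (fun i ih =>
    sel (Nat.beq (digit i (support p)) 0) ih (add (mul (ρ i) (varDeriv i p)) ih)) (numVars p)

/-- The total derivatives of the variables. -/
def totalRule (i : ℕ) : JetPoly :=
  [(Nat.add (Nat.pow 256 (Nat.add i 10)) (sel (Nat.beq (Nat.mod i 10) 0) 0 (Nat.pow 256 10)), 1)]

/-- The derivatives of the variables with respect to `u`. -/
def coeffRule (i : ℕ) : JetPoly :=
  sel (Nat.beq i 0) [(0, 1)]
    (sel (Nat.beq (Nat.mod i 10) 0) [] [(Nat.pow 256 (Nat.add i 10), 1)])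

/-- The derivative with respect to `u_(j)`. -/
def partialDeriv (j : ℕ) (p : JetPoly) : JetPoly :=
  Nat.rec (derive coeffRule p) (fun j _ => varDeriv (Nat.mul 10 (Nat.succ j)) p) j

/-- The sum of `∂_x^{i+1} D · ∂α/∂u_(j+i)` over `i < N`. -/
def bracketSum (α : JetPoly) (N : ℕ) : ℕ → JetPoly → JetPoly :=
  Nat.rec (fun _ _ => []) (fun _ ih j D =>
    add (mul (partialDeriv j α) (derive totalRule D)) (ih (Nat.succ j) (derive totalRule D))) N

/-- A number `N` such that `p` depends only on `u_(j)` with `j < N`. -/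
def order (p : JetPoly) : ℕ := Nat.succ (Nat.div (numVars p) 10)

/-- The bracket of forms. -/
def bracket (α β : JetPoly) : JetPoly :=
  add (bracketSum α (order α) 0 β)
    (mulTerm 0 (Int.negSucc 0) (bracketSum β (order β) 0 α))

/-- The weight of a key, where `u_(j)` has weight `j`, as a sum over `j < N`. -/
def weight (N k : ℕ) : ℕ :=
  Nat.rec 0 (fun j ih => Nat.add (Nat.mul j (digit (Nat.mul 10 j) k)) ih) N

/-- Whether all terms have weight `n`. -/
def isHomog (n : ℕ) (p : JetPoly) : Bool :=
  fold (fun t b => sel (Nat.beq (weight (order p) t.1) n) b false) true p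

/-- Whether there are no terms. -/
def isZero (p : JetPoly) : Bool := List.rec true (fun _ _ _ => false) p

/-- The coefficient with which `-{u², ·}` maps a monomial to its product with `u_x`. -/
def diagCoeff (N k : ℕ) : ℕ :=
  Nat.rec 0 (fun j ih => Nat.add (Nat.mul (digit (Nat.mul 10 j) k)
    (Nat.rec 0 (fun i _ => Nat.rec 2 (fun _ _ => Nat.mul 2 (Nat.succ j)) i) j)) ih) N

/-- The terms divisible by exactly the `d`-th power of `u_x`, divided by `u_x` and by the
coefficient of `-{u², ·}`. -/
def peel (d : ℕ) (p : JetPoly) : JetPoly :=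
  fold (fun t q => sel (Nat.beq (digit 10 t.1) d)
    ((Nat.sub t.1 (Nat.pow 256 10), Int.tdiv t.2
      (Int.ofNat (diagCoeff (order p) (Nat.sub t.1 (Nat.pow 256 10))))) :: q) q) [] p

/-- Triangular elimination: a polynomial `g` such that `{u², g} + p` does not contain `u_x`,
provided that the divisions by integers are exact. -/
def primitive (d : ℕ) : JetPoly → JetPoly :=
  Nat.rec (fun _ => []) (fun d ih p => add (peel (Nat.succ d) p)
    (ih (add (bracket [(2, 1)] (peel (Nat.succ d) p)) p))) d

/-- Whether all exponents are at most `d`. -/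
def isBounded (d : ℕ) (p : JetPoly) : Bool :=
  fold (fun t b => sel b (Nat.rec true (fun i ih => sel (Nat.ble (digit i t.1) d) ih false)
    (numVars p)) false) true p

/-- Whether `g` is homogeneous of degree `n` and solves `{u², g} + p = q`. The bounds on the
exponents and on the order of `g` exclude carries between the digits of the keys of `{u², g}`. -/
def isSolution (n : ℕ) (p q g : JetPoly) : Bool :=
  sel (isBounded 100 g) (sel (Nat.ble (order g) 20 && isHomog n g)
    (isZero (add (add (bracket [(2, 1)] g) p) (mulTerm 0 (Int.negSucc 0) q))) false) false

/-! ### Correctness of the computable model -/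

lemma digit_def (i k : ℕ) : digit i k = k / 256 ^ i % 256 := rfl

lemma digit_zero_left (k : ℕ) : digit 0 k = k % 256 := by simp [digit_def]

lemma digit_zero (i : ℕ) : digit i 0 = 0 := by simp [digit_def]

lemma digit_succ (i k : ℕ) : digit (i + 1) k = digit i (k / 256) := by
  rw [digit_def, digit_def, pow_succ', Nat.div_div_eq_div_mul]

lemma digit_eq_zero_of_lt {i k L : ℕ} (hk : k < 256 ^ L) (hi : L ≤ i) : digit i k = 0 := by
  rw [digit_def, Nat.div_eq_of_lt (hk.trans_le (Nat.pow_le_pow_right (by norm_num) hi))]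

/-- Exponents add as long as there is no carry. -/
lemma digit_add {a b : ℕ} (h : ∀ i, digit i a + digit i b < 256) (i : ℕ) :
    digit i (a + b) = digit i a + digit i b := by
  have h0 := h 0
  simp only [digit_zero_left] at h0
  induction i generalizing a b with
  | zero => simp only [digit_zero_left]; omega
  | succ i ih =>
    have hd : (a + b) / 256 = a / 256 + b / 256 := by omega
    have h' : ∀ i, digit i (a / 256) + digit i (b / 256) < 256 := fun i => by
      simpa only [digit_succ] using h (i + 1)
    rw [digit_succ, hd, ih h' (by simpa only [digit_zero_left] using h' 0), digit_succ, digit_succ]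

lemma digit_pow (i j : ℕ) : digit i (256 ^ j) = if i = j then 1 else 0 := by
  induction i generalizing j with
  | zero => cases j <;> simp [digit_zero_left, pow_succ]
  | succ i ih =>
    cases j with
    | zero => simp [digit_succ, digit_zero]
    | succ j => simp [digit_succ, pow_succ, ih]

lemma digit_sub_pow {i k : ℕ} (h : digit i k ≠ 0) (j : ℕ) :
    digit j (k - 256 ^ i) = digit j k - if j = i then 1 else 0 := by
  induction i generalizing k j with
  | zero =>
    rw [digit_zero_left] at h
    cases j with
    | zero => simp only [digit_zero_left, pow_zero, if_true]; omega
    | succ j =>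
      have : (k - 1) / 256 = k / 256 := by omega
      simp [digit_succ, this]
  | succ i ih =>
    rw [digit_succ] at h
    have hle : 256 * 256 ^ i ≤ k := by
      rw [← pow_succ']
      by_contra hlt
      rw [← digit_succ] at h
      exact h (digit_eq_zero_of_lt (not_le.mp hlt) le_rfl)
    cases j with
    | zero => simp [digit_zero_left, pow_succ', Nat.sub_mul_mod hle]
    | succ j => rw [digit_succ, digit_succ, pow_succ', Nat.sub_mul_div, ih h]; simp

lemma digit_eq_zero_of_lor {i a b : ℕ} (h : digit i (Nat.lor a b) = 0) :
    digit i a = 0 ∧ digit i b = 0 := by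
  have key (x y : ℕ) (hxy : (x ||| y) = 0) : x = 0 ∧ y = 0 := by
    constructor <;> apply Nat.eq_of_testBit_eq <;> intro n <;>
      have := congrArg (Nat.testBit · n) hxy <;> simp_all
  have e (x : ℕ) : digit i x = (x >>> (8 * i)) &&& (2 ^ 8 - 1) := by
    rw [Nat.and_two_pow_sub_one_eq_mod, Nat.shiftRight_eq_div_pow, digit_def, pow_mul]; rfl
  rw [e] at h
  rw [e, e]
  refine key _ _ ?_
  rw [← Nat.and_or_distrib_right, ← Nat.shiftRight_or_distrib]
  exact h

lemma digit_eq_zero_of_support {p : JetPoly} {i : ℕ} (h : digit i (support p) = 0)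
    {t : ℕ × ℤ} (ht : t ∈ p) : digit i t.1 = 0 := by
  induction p with
  | nil => simp at ht
  | cons s p ih =>
    have hs := digit_eq_zero_of_lor (show digit i (Nat.lor s.1 (support p)) = 0 from h)
    rcases List.mem_cons.mp ht with rfl | ht
    · exact hs.1
    · exact ih hs.2 ht

lemma digit_eq_zero_of_numVars {p : JetPoly} {i : ℕ} (hi : numVars p ≤ i)
    {t : ℕ × ℤ} (ht : t ∈ p) : digit i t.1 = 0 := by
  refine digit_eq_zero_of_support (digit_eq_zero_of_lt ?_ hi) ht
  calc support p < 2 ^ ((support p).log2 + 1) := Nat.lt_log2_self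
    _ ≤ 2 ^ (8 * numVars p) := by
        refine Nat.pow_le_pow_right (by norm_num) ?_
        have : numVars p = (support p).log2 / 8 + 1 := rfl
        omega
    _ = 256 ^ numVars p := by rw [pow_mul]; norm_num

variable {R : Type*} [CommRing R] [Differential R] (w : Fin 10 → R)

/-- The differential polynomial coded by a variable; `w 0` is the coordinate `u`. -/
def jetVar (w : Fin 10 → R) (i : ℕ) : DiffPoly R :=
  if i % 10 = 0 then (match i / 10 with | 0 => C (w 0) | k + 1 => X k)
  else C (derivs (w ⟨i % 10, Nat.mod_lt _ (by norm_num)⟩) (i / 10))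

/-- The monomial coded by a key. -/
def evalKey (k : ℕ) : DiffPoly R := ∏ i ∈ Finset.range k, jetVar w i ^ digit i k

/-- The value of a polynomial of the computable model. -/
def eval (p : JetPoly) : DiffPoly R := (p.map fun t => t.2 • evalKey w t.1).sum

/-- All exponents are at most `d`. Such bounds ensure that adding keys multiplies monomials: there
is no carry as long as the exponents stay below the base `256`. -/
def Bounded (d : ℕ) (p : JetPoly) : Prop := ∀ t ∈ p, ∀ i, digit i t.1 ≤ d

lemma evalKey_eq_prod {k L : ℕ} (h : ∀ i, L ≤ i → digit i k = 0) :
    evalKey w k = ∏ i ∈ Finset.range L, jetVar w i ^ digit i k := by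
  have h1 : ∀ i, k ≤ i → digit i k = 0 := fun i hi =>
    digit_eq_zero_of_lt (Nat.lt_pow_self (by norm_num)) hi
  have key (N : ℕ) (hN : ∀ i, N ≤ i → digit i k = 0) :
      ∏ i ∈ Finset.range N, jetVar w i ^ digit i k =
        ∏ i ∈ Finset.range (max k L), jetVar w i ^ digit i k := by
    rcases le_total N (max k L) with hle | hle
    · refine Finset.prod_subset (by simpa using hle) fun i _ hi => ?_
      rw [hN i (by simpa using hi), pow_zero]
    · refine (Finset.prod_subset (by simpa using hle) fun i _ hi => ?_).symm
      rw [h1 i ((le_max_left _ _).trans (by simpa using hi)), pow_zero]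
  rw [key L h, evalKey, key k h1]

lemma evalKey_add {a b : ℕ} (h : ∀ i, digit i a + digit i b < 256) :
    evalKey w (a + b) = evalKey w a * evalKey w b := by
  have hz (k i : ℕ) (hk : k ≤ a + b) (hi : a + b ≤ i) : digit i k = 0 :=
    digit_eq_zero_of_lt (Nat.lt_pow_self (by norm_num)) (hk.trans hi)
  rw [evalKey_eq_prod w (L := a + b) fun i hi => hz a i (by omega) hi,
    evalKey_eq_prod w (L := a + b) fun i hi => hz b i (by omega) hi,
    evalKey, ← Finset.prod_mul_distrib]
  exact Finset.prod_congr rfl fun i _ => by rw [digit_add h, pow_add]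

@[simp] lemma eval_nil : eval w [] = 0 := rfl
@[simp] lemma eval_cons (t : ℕ × ℤ) (p : JetPoly) :
    eval w (t :: p) = t.2 • evalKey w t.1 + eval w p := by simp [eval]

@[simp] lemma evalKey_zero : evalKey w 0 = 1 := rfl

lemma bounded_nil (d : ℕ) : Bounded d [] := by simp [Bounded]

lemma bounded_cons {d : ℕ} {t : ℕ × ℤ} {p : JetPoly} :
    Bounded d (t :: p) ↔ (∀ i, digit i t.1 ≤ d) ∧ Bounded d p := by simp [Bounded]

lemma Bounded.mono {d e : ℕ} {p : JetPoly} (h : Bounded d p) (hde : d ≤ e) : Bounded e p :=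
  fun t ht i => (h t ht i).trans hde

lemma eval_consTerm (k : ℕ) (c : ℤ) (p : JetPoly) :
    eval w (consTerm k c p) = c • evalKey w k + eval w p := by
  rcases c with (_ | n) | n
  · change eval w p = (0 : ℤ) • _ + _; simp
  · exact eval_cons w _ _
  · exact eval_cons w _ _

lemma Bounded.consTerm {d k : ℕ} (c : ℤ) {p : JetPoly} (hk : ∀ i, digit i k ≤ d)
    (hp : Bounded d p) : Bounded d (consTerm k c p) := by
  rcases c with (_ | n) | n
  · exact hp
  · exact bounded_cons.mpr ⟨hk, hp⟩
  · exact bounded_cons.mpr ⟨hk, hp⟩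

lemma add_cons_cons (s t : ℕ × ℤ) (p q : JetPoly) :
    add (s :: p) (t :: q) = sel (Nat.beq s.1 t.1) (consTerm s.1 (Int.add s.2 t.2) (add p q))
      (sel (Nat.ble s.1 t.1) (s :: add p (t :: q)) (t :: add (s :: p) q)) := rfl

lemma eval_add (p q : JetPoly) : eval w (add p q) = eval w p + eval w q := by
  induction p generalizing q with
  | nil => exact (zero_add _).symm
  | cons s p ihp =>
    induction q with
    | nil => exact (add_zero _).symm
    | cons t q ihq =>
      rw [add_cons_cons]
      cases h : Nat.beq s.1 t.1 with
      | true =>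
        change eval w (consTerm s.1 (s.2 + t.2) (add p q)) = _
        rw [eval_consTerm, ihp, add_smul, eval_cons, eval_cons, Nat.eq_of_beq_eq_true h]; abel
      | false =>
        cases Nat.ble s.1 t.1 with
        | true =>
          change eval w (s :: add p (t :: q)) = _
          rw [eval_cons, ihp, eval_cons w s p, add_assoc]
        | false =>
          change eval w (t :: add (s :: p) q) = _
          rw [eval_cons, ihq, eval_cons, eval_cons]; abel

lemma Bounded.add {d : ℕ} {p q : JetPoly} (hp : Bounded d p) (hq : Bounded d q) :
    Bounded d (p.add q) := by
  induction p generalizing q with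
  | nil => exact hq
  | cons s p ihp =>
    rw [bounded_cons] at hp
    induction q with
    | nil => exact bounded_cons.mpr hp
    | cons t q ihq =>
      have hq' := bounded_cons.mp hq
      rw [add_cons_cons]
      cases Nat.beq s.1 t.1 with
      | true => exact Bounded.consTerm _ hp.1 (ihp hp.2 hq'.2)
      | false =>
        cases Nat.ble s.1 t.1 with
        | true => exact bounded_cons.mpr ⟨hp.1, ihp hp.2 hq⟩
        | false => exact bounded_cons.mpr ⟨hq'.1, ihq hq'.2⟩

lemma mulTerm_cons (k : ℕ) (c : ℤ) (t : ℕ × ℤ) (p : JetPoly) :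
    mulTerm k c (t :: p) = (k + t.1, c * t.2) :: mulTerm k c p := rfl

lemma eval_mulTerm {d e k : ℕ} {p : JetPoly} (c : ℤ) (hk : ∀ i, digit i k ≤ d) (hp : Bounded e p)
    (h : d + e ≤ 255) :
    eval w (mulTerm k c p) = (c • evalKey w k) * eval w p ∧ Bounded (d + e) (mulTerm k c p) := by
  induction p with
  | nil => exact ⟨(mul_zero _).symm, bounded_nil _⟩
  | cons t p ih =>
    rw [bounded_cons] at hp
    have hd (i : ℕ) : digit i k + digit i t.1 < 256 := by have := hk i; have := hp.1 i; omega
    refine ⟨?_, bounded_cons.mpr ⟨fun i => ?_, (ih hp.2).2⟩⟩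
    · rw [mulTerm_cons, eval_cons, (ih hp.2).1, evalKey_add w hd, eval_cons, mul_add,
        smul_mul_smul_comm]
    · change digit i (k + t.1) ≤ d + e
      rw [digit_add hd]; exact add_le_add (hk i) (hp.1 i)

lemma eval_smul {d : ℕ} {p : JetPoly} (c : ℤ) (hp : Bounded d p) (h : d ≤ 255) :
    eval w (mulTerm 0 c p) = c • eval w p ∧ Bounded d (mulTerm 0 c p) := by
  have := eval_mulTerm w (d := 0) (k := 0) c (fun i => (digit_zero i).le) hp (by omega)
  simpa using this

lemma eval_mulAux {d e : ℕ} {p q : JetPoly} (hp : Bounded d p) (hq : Bounded e q)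
    (h : d + e ≤ 255) :
    eval w (mulAux p q) = eval w p * eval w q ∧ Bounded (d + e) (mulAux p q) := by
  induction p with
  | nil => exact ⟨(zero_mul _).symm, bounded_nil _⟩
  | cons s p ih =>
    rw [bounded_cons] at hp
    obtain ⟨h1, h2⟩ := eval_mulTerm w s.2 hp.1 hq h
    change eval w (add (mulTerm s.1 s.2 q) (mulAux p q)) = _ ∧
      Bounded _ (add (mulTerm s.1 s.2 q) (mulAux p q))
    refine ⟨?_, h2.add (ih hp.2).2⟩
    rw [eval_add, h1, (ih hp.2).1, eval_cons, add_mul]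

lemma eval_mul {d e : ℕ} {p q : JetPoly} (hp : Bounded d p) (hq : Bounded e q)
    (h : d + e ≤ 255) : eval w (mul p q) = eval w p * eval w q ∧ Bounded (d + e) (mul p q) := by
  cases p with
  | nil => exact ⟨(zero_mul _).symm, bounded_nil _⟩
  | cons s p =>
    have e1 : mul (s :: p) q = sel (Nat.ble (size (s :: p)) (size q)) (mulAux (s :: p) q)
      (mulAux q (s :: p)) := rfl
    rw [e1]
    cases Nat.ble (size (s :: p)) (size q) with
    | true => exact eval_mulAux w hp hq h
    | false =>
      have := eval_mulAux w hq hp (by omega)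
      rwa [mul_comm, add_comm e d] at this

lemma eval_pow {d : ℕ} {p : JetPoly} (hp : Bounded d p) (n : ℕ) (h : n * d ≤ 255) :
    eval w (pow p n) = eval w p ^ n ∧ Bounded (n * d) (pow p n) := by
  induction n with
  | zero =>
    refine ⟨by simp [pow], bounded_cons.mpr ⟨fun i => by simp [digit_zero], bounded_nil _⟩⟩
  | succ n ih =>
    have h' : d + n * d = (n + 1) * d := by ring
    obtain ⟨h1, h2⟩ := ih (by omega)
    have := eval_mul w hp h2 (by omega)
    rw [h1, ← pow_succ', h'] at this
    exact this

lemma eval_varDeriv (i : ℕ) (p : JetPoly) : eval w (varDeriv i p) =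
    (p.map fun t => t.2 • (digit i t.1 • evalKey w (t.1 - 256 ^ i))).sum := by
  induction p with
  | nil => rfl
  | cons t p ih =>
    have e1 : varDeriv i (t :: p) = sel (Nat.beq (digit i t.1) 0) (varDeriv i p)
      ((t.1 - 256 ^ i, (digit i t.1 : ℤ) * t.2) :: varDeriv i p) := rfl
    rw [e1, List.map_cons, List.sum_cons, ← ih]
    cases h : digit i t.1 with
    | zero => change eval w (varDeriv i p) = _; simp
    | succ n =>
      change eval w ((t.1 - 256 ^ i, ((n + 1 : ℕ) : ℤ) * t.2) :: varDeriv i p) = _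
      rw [eval_cons, mul_comm, mul_smul, natCast_zsmul]

lemma Bounded.varDeriv {d : ℕ} {p : JetPoly} (hp : Bounded d p) (i : ℕ) :
    Bounded d (varDeriv i p) := by
  induction p with
  | nil => exact bounded_nil _
  | cons t p ih =>
    rw [bounded_cons] at hp
    have e1 : JetPoly.varDeriv i (t :: p) =
      sel (Nat.beq (digit i t.1) 0) (JetPoly.varDeriv i p)
        ((t.1 - 256 ^ i, (digit i t.1 : ℤ) * t.2) :: JetPoly.varDeriv i p) := rfl
    rw [e1]
    cases h : digit i t.1 with
    | zero => exact ih hp.2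
    | succ n =>
      refine bounded_cons.mpr ⟨fun j => ?_, ih hp.2⟩
      rw [digit_sub_pow (by omega)]
      exact (Nat.sub_le _ _).trans (hp.1 j)

/-- The chain rule for a monomial. -/
lemma derivation_evalKey (Δ : Derivation ℤ (DiffPoly R) (DiffPoly R)) {k L : ℕ}
    (h : ∀ i, L ≤ i → digit i k = 0) : Δ (evalKey w k) =
      ∑ i ∈ Finset.range L, (digit i k • evalKey w (k - 256 ^ i)) * Δ (jetVar w i) := by
  classical
  have key (s : Finset ℕ) : Δ (∏ i ∈ s, jetVar w i ^ digit i k) =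
      ∑ i ∈ s, (digit i k • (jetVar w i ^ (digit i k - 1) *
        ∏ j ∈ s.erase i, jetVar w j ^ digit j k)) * Δ (jetVar w i) := by
    induction s using Finset.induction_on with
    | empty => simp
    | insert a s ha ih =>
      rw [Finset.prod_insert ha, Derivation.leibniz, ih, Finset.sum_insert ha,
        Finset.erase_insert ha, Derivation.leibniz_pow, smul_eq_mul, smul_eq_mul, smul_eq_mul,
        Finset.mul_sum, add_comm]
      congr 1
      · simp only [nsmul_eq_mul]; ring
      · refine Finset.sum_congr rfl fun i hi => ?_
        have hia : i ≠ a := fun h => ha (h ▸ hi)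
        rw [Finset.erase_insert_of_ne hia.symm,
          Finset.prod_insert (fun h => ha (Finset.mem_of_mem_erase h))]
        simp only [nsmul_eq_mul]; ring
  rw [evalKey_eq_prod w h, key]
  refine Finset.sum_congr rfl fun i hi => ?_
  rcases eq_or_ne (digit i k) 0 with h0 | h0
  · simp [h0]
  · have hL : ∀ j, L ≤ j → digit j (k - 256 ^ i) = 0 := fun j hj => by
      rw [digit_sub_pow h0, h j hj, Nat.zero_sub]
    rw [evalKey_eq_prod w hL, ← Finset.mul_prod_erase (Finset.range L)
      (fun j => jetVar w j ^ digit j (k - 256 ^ i)) hi]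
    simp only [digit_sub_pow h0 i, if_true]
    congr 3
    refine Finset.prod_congr rfl fun j hj => ?_
    rw [digit_sub_pow h0, if_neg (Finset.ne_of_mem_erase hj), Nat.sub_zero]

/-- The chain rule for a derivation, which is determined by its values on the variables. -/
lemma derivation_eval (Δ : Derivation ℤ (DiffPoly R) (DiffPoly R)) {p : JetPoly} {L : ℕ}
    (h : ∀ i, L ≤ i → ∀ t ∈ p, digit i t.1 = 0) :
    Δ (eval w p) = ∑ i ∈ Finset.range L, eval w (varDeriv i p) * Δ (jetVar w i) := by
  simp only [eval_varDeriv]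
  induction p with
  | nil => simp
  | cons t p ih =>
    rw [eval_cons, map_add, map_zsmul, ih fun i hi t ht => h i hi t (List.mem_cons_of_mem _ ht),
      derivation_evalKey w Δ fun i hi => h i hi t List.mem_cons_self, Finset.smul_sum,
      ← Finset.sum_add_distrib]
    exact Finset.sum_congr rfl fun i _ => by
      simp only [List.map_cons, List.sum_cons, add_mul, smul_mul_assoc]

lemma eval_derive (Δ : Derivation ℤ (DiffPoly R) (DiffPoly R)) (ρ : ℕ → JetPoly)
    (hρ : ∀ i, Δ (jetVar w i) = eval w (ρ i)) (hb : ∀ i, Bounded 2 (ρ i)) {p : JetPoly} {d : ℕ}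
    (hp : Bounded d p) (hd : d + 2 ≤ 255) :
    eval w (derive ρ p) = Δ (eval w p) ∧ Bounded (d + 2) (derive ρ p) := by
  rw [derivation_eval w Δ fun i hi t ht => digit_eq_zero_of_numVars hi ht]
  have key (n : ℕ) : eval w (Nat.rec [] (fun i ih => sel (Nat.beq (digit i (support p)) 0) ih
      (add (mul (ρ i) (varDeriv i p)) ih)) n : JetPoly) =
        ∑ i ∈ Finset.range n, eval w (varDeriv i p) * Δ (jetVar w i) ∧
      Bounded (d + 2) (Nat.rec [] (fun i ih => sel (Nat.beq (digit i (support p)) 0) ih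
        (add (mul (ρ i) (varDeriv i p)) ih)) n : JetPoly) := by
    induction n with
    | zero => exact ⟨rfl, bounded_nil _⟩
    | succ n ih =>
      rw [Finset.sum_range_succ, hρ n]
      obtain ⟨h1, h2⟩ := eval_mul w (hb n) (hp.varDeriv n) (by omega)
      rw [add_comm 2 d] at h2
      dsimp only
      cases h : digit n (support p) with
      | zero =>
        have hz : eval w (varDeriv n p) = 0 := by
          rw [eval_varDeriv]
          refine List.sum_eq_zero fun x hx => ?_
          obtain ⟨t, ht, rfl⟩ := List.mem_map.mp hx
          rw [digit_eq_zero_of_support h ht, zero_smul, smul_zero]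
        rw [hz, zero_mul, add_zero]
        exact ih
      | succ m =>
        refine ⟨?_, h2.add ih.2⟩
        change eval w (add (mul (ρ n) (varDeriv n p)) _) = _
        rw [eval_add, h1, ih.1, mul_comm, add_comm]
  exact key (numVars p)

lemma digit_le_one_of_lt {a : ℕ} (i j : ℕ) (h : a = 256 ^ j) : digit i a ≤ 1 := by
  rw [h, digit_pow]; split_ifs <;> omega

lemma bounded_totalRule (i : ℕ) : Bounded 2 (totalRule i) := by
  refine bounded_cons.mpr ⟨fun j => ?_, bounded_nil _⟩
  have h1 : digit j (256 ^ (i + 10)) ≤ 1 := digit_le_one_of_lt _ _ rfl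
  change digit j (256 ^ (i + 10) + sel (Nat.beq (i % 10) 0) 0 (256 ^ 10)) ≤ 2
  cases Nat.beq (i % 10) 0 with
  | true => change digit j (256 ^ (i + 10) + 0) ≤ 2; rw [add_zero]; omega
  | false =>
    change digit j (256 ^ (i + 10) + 256 ^ 10) ≤ 2
    rw [digit_add fun i => ?_]
    · have h2 : digit j (256 ^ 10) ≤ 1 := digit_le_one_of_lt _ _ rfl
      omega
    · rw [digit_pow, digit_pow]; split_ifs <;> omega

lemma bounded_coeffRule (i : ℕ) : Bounded 2 (coeffRule i) := by
  rw [coeffRule]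
  cases Nat.beq i 0 with
  | true => exact bounded_cons.mpr ⟨fun j => by simp [digit_zero], bounded_nil _⟩
  | false =>
    cases Nat.beq (Nat.mod i 10) 0 with
    | true => exact bounded_nil _
    | false =>
      change Bounded 2 [(256 ^ (i + 10), 1)]
      exact bounded_cons.mpr
        ⟨fun j => (digit_le_one_of_lt j _ rfl).trans one_le_two, bounded_nil _⟩

lemma evalKey_pow (i : ℕ) : evalKey w (256 ^ i) = jetVar w i := by
  rw [evalKey_eq_prod w (L := i + 1) fun j hj => by rw [digit_pow, if_neg (by omega)],
    Finset.prod_eq_single_of_mem i (by simp)]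
  · rw [digit_pow, if_pos rfl, pow_one]
  · intro j _ hj
    rw [digit_pow, if_neg hj, pow_zero]

lemma jetVar_zero : jetVar w 0 = C (w 0) := by simp [jetVar]

lemma jetVar_jet (k : ℕ) : jetVar w (10 * (k + 1)) = X k := by simp [jetVar]

lemma jetVar_fn (k n : ℕ) (h : n + 1 < 10) :
    jetVar w (10 * k + (n + 1)) = C (derivs (w ⟨n + 1, h⟩) k) := by
  have h1 : (10 * k + (n + 1)) % 10 = n + 1 := by omega
  have h2 : (10 * k + (n + 1)) / 10 = k := by omega
  simp [jetVar, h1, h2]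

lemma beq_eq_false {m n : ℕ} (h : m ≠ n) : Nat.beq m n = false := by
  rw [Bool.eq_false_iff]; exact fun h' => h (Nat.eq_of_beq_eq_true h')

lemma totalRule_of_eq {i : ℕ} (h : i % 10 = 0) : totalRule i = [(256 ^ (i + 10), 1)] := by
  have e1 : totalRule i = [(256 ^ (i + 10) + sel (Nat.beq (i % 10) 0) 0 (Nat.pow 256 10), 1)] := rfl
  have e2 : sel (Nat.beq 0 0) 0 (Nat.pow 256 10) = 0 := rfl
  rw [e1, h, e2, add_zero]

lemma totalRule_of_ne {i : ℕ} (h : i % 10 ≠ 0) :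
    totalRule i = [(256 ^ (i + 10) + 256 ^ 10, 1)] := by
  have e1 : totalRule i = [(256 ^ (i + 10) + sel (Nat.beq (i % 10) 0) 0 (Nat.pow 256 10), 1)] := rfl
  have e2 (m : ℕ) : sel false 0 m = m := rfl
  have e3 : Nat.pow 256 10 = 256 ^ 10 := Nat.pow_eq
  rw [e1, beq_eq_false h, e2, e3]

lemma totalDeriv_jetVar [hw : Fact ((w 0)′ = 1)] (i : ℕ) :
    totalDeriv (jetVar w i) = eval w (totalRule i) := by
  have hs (c : ℕ) : eval w [(c, 1)] = evalKey w c := by simp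
  obtain ⟨k, n, hn, rfl⟩ : ∃ k n, n < 10 ∧ i = 10 * k + n :=
    ⟨i / 10, i % 10, Nat.mod_lt _ (by norm_num), (Nat.div_add_mod i 10).symm⟩
  rcases n with _ | n
  · rw [totalRule_of_eq (by omega), hs, evalKey_pow]
    have e3 : 10 * k + 0 + 10 = 10 * (k + 1) := by omega
    rw [e3, jetVar_jet, add_zero]
    rcases k with _ | k
    · rw [mul_zero, jetVar_zero, totalDeriv_C, hw.out, C_1, one_mul]
    · rw [jetVar_jet, totalDeriv_X]
  · rw [totalRule_of_ne (by omega), hs, evalKey_add w fun j => by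
      rw [digit_pow, digit_pow]; split_ifs <;> omega, evalKey_pow, evalKey_pow]
    have e3 : 10 * k + (n + 1) + 10 = 10 * (k + 1) + (n + 1) := by omega
    have e4 : jetVar w 10 = X 0 := by simpa using jetVar_jet w 0
    rw [e3, jetVar_fn _ _ _ hn, jetVar_fn _ _ _ hn, e4, totalDeriv_C, derivs_succ]

lemma jetPartial_zero_jetVar [hw : Fact ((w 0)′ = 1)] (i : ℕ) :
    jetPartial 0 (jetVar w i) = eval w (coeffRule i) := by
  have hs (c : ℕ) : eval w [(c, 1)] = evalKey w c := by simp
  obtain ⟨k, n, hn, rfl⟩ : ∃ k n, n < 10 ∧ i = 10 * k + n :=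
    ⟨i / 10, i % 10, Nat.mod_lt _ (by norm_num), (Nat.div_add_mod i 10).symm⟩
  have e1 : coeffRule (10 * k + n) = sel (Nat.beq (10 * k + n) 0) [(0, 1)]
      (sel (Nat.beq ((10 * k + n) % 10) 0) [] [(256 ^ (10 * k + n + 10), 1)]) := rfl
  have e2 : (10 * k + n) % 10 = n := by omega
  rw [e1, e2]
  rcases n with _ | n
  · rcases k with _ | k
    · change jetPartial 0 (jetVar w 0) = eval w [(0, 1)]
      rw [jetVar_zero, jetPartial_zero_C, hw.out, hs, evalKey_zero, C_1]
    · rw [beq_eq_false (by omega)]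
      change _ = eval w []
      rw [add_zero, jetVar_jet, jetPartial_zero_X, eval_nil]
  · rw [beq_eq_false (by omega)]
    change _ = eval w [(256 ^ (10 * k + (n + 1) + 10), 1)]
    have e3 : 10 * k + (n + 1) + 10 = 10 * (k + 1) + (n + 1) := by omega
    rw [hs, evalKey_pow, e3, jetVar_fn _ _ _ hn, jetVar_fn _ _ _ hn, jetPartial_zero_C, derivs_succ]

lemma jetPartial_succ_jetVar (j i : ℕ) :
    jetPartial (j + 1) (jetVar w i) = if i = 10 * (j + 1) then 1 else 0 := by
  obtain ⟨k, n, hn, rfl⟩ : ∃ k n, n < 10 ∧ i = 10 * k + n :=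
    ⟨i / 10, i % 10, Nat.mod_lt _ (by norm_num), (Nat.div_add_mod i 10).symm⟩
  rcases n with _ | n
  · rcases k with _ | k
    · rw [if_neg (by omega)]
      change jetPartial (j + 1) (jetVar w 0) = 0
      rw [jetVar_zero, jetPartial_succ_C]
    · rw [add_zero, jetVar_jet, jetPartial_succ_X]
      exact if_congr (by omega) rfl rfl
  · rw [jetVar_fn _ _ _ hn, jetPartial_succ_C, if_neg (by omega)]

lemma eval_totalDeriv [Fact ((w 0)′ = 1)] {d : ℕ} {p : JetPoly} (hp : Bounded d p)
    (hd : d + 2 ≤ 255) : eval w (derive totalRule p) = totalDeriv (eval w p) ∧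
      Bounded (d + 2) (derive totalRule p) :=
  eval_derive w totalDerivation totalRule (totalDeriv_jetVar w) bounded_totalRule hp hd

lemma eval_partialDeriv [Fact ((w 0)′ = 1)] (j : ℕ) {d : ℕ} {p : JetPoly} (hp : Bounded d p)
    (hd : d + 2 ≤ 255) : eval w (partialDeriv j p) = jetPartial j (eval w p) ∧
      Bounded (d + 2) (partialDeriv j p) := by
  cases j with
  | zero =>
    exact eval_derive w (jetDerivation 0) coeffRule (jetPartial_zero_jetVar w)
      bounded_coeffRule hp hd
  | succ j =>
    refine ⟨?_, (hp.varDeriv _).mono (by omega)⟩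
    change eval w (varDeriv (10 * (j + 1)) p) = jetDerivation (j + 1) (eval w p)
    rw [derivation_eval w (L := max (numVars p) (10 * (j + 1) + 1)) _ fun i hi t ht =>
        digit_eq_zero_of_numVars ((le_max_left _ _).trans hi) ht,
      Finset.sum_eq_single_of_mem (10 * (j + 1))
        (Finset.mem_range.mpr (lt_of_lt_of_le (Nat.lt_succ_self _) (le_max_right _ _)))]
    · rw [jetDerivation_apply, jetPartial_succ_jetVar, if_pos rfl, mul_one]
    · intro i _ hi
      rw [jetDerivation_apply, jetPartial_succ_jetVar, if_neg hi, mul_zero]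

lemma jetPartial_eq_zero_of_order [Fact ((w 0)′ = 1)] {p : JetPoly} {j : ℕ} (h : order p ≤ j) :
    jetPartial j (eval w p) = 0 := by
  have h1 : order p = numVars p / 10 + 1 := rfl
  rcases j with _ | j
  · omega
  rw [← jetDerivation_apply, derivation_eval w (L := numVars p) _ fun i hi t ht =>
    digit_eq_zero_of_numVars hi ht]
  refine Finset.sum_eq_zero fun i hi => ?_
  have := Finset.mem_range.mp hi
  rw [jetDerivation_apply, jetPartial_succ_jetVar, if_neg (by omega), mul_zero]

lemma eval_bracketSum [Fact ((w 0)′ = 1)] {d e N : ℕ} {α D : JetPoly} (hα : Bounded d α)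
    (hD : Bounded e D) (h : d + e + 2 * N + 2 ≤ 255) (j : ℕ) :
    eval w (bracketSum α N j D) = ∑ i ∈ Finset.range N,
        totalDeriv^[i + 1] (eval w D) * jetPartial (j + i) (eval w α) ∧
      Bounded (d + e + 2 * N + 2) (bracketSum α N j D) := by
  induction N generalizing j D e with
  | zero => exact ⟨rfl, bounded_nil _⟩
  | succ N ih =>
    have e1 : bracketSum α (N + 1) j D = add (mul (partialDeriv j α) (derive totalRule D))
      (bracketSum α N (j + 1) (derive totalRule D)) := rfl
    obtain ⟨h1, h2⟩ := eval_totalDeriv w hD (by omega)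
    obtain ⟨h3, h4⟩ := eval_partialDeriv w j hα (by omega)
    obtain ⟨h5, h6⟩ := eval_mul w h4 h2 (by omega)
    obtain ⟨h7, h8⟩ := ih h2 (by omega) (j + 1)
    refine ⟨?_, e1 ▸ (h6.mono (by omega)).add (h8.mono (by omega))⟩
    rw [e1, eval_add, h5, h7, h1, h3, Finset.sum_range_succ', add_comm]
    congr 1
    · refine Finset.sum_congr rfl fun i _ => ?_
      rw [← Function.iterate_succ_apply, add_assoc j, add_comm 1 i]
    · rw [mul_comm]; rfl

lemma eval_bracket [Fact ((w 0)′ = 1)] {d e : ℕ} {α β : JetPoly} (hα : Bounded d α)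
    (hβ : Bounded e β) (h : d + e + 2 * (order α + order β) + 2 ≤ 255) :
    eval w (bracket α β) = formBracket (eval w α) (eval w β) ∧
      Bounded (d + e + 2 * (order α + order β) + 2) (bracket α β) := by
  obtain ⟨h1, h2⟩ := eval_bracketSum w (N := order α) hα hβ (by omega) 0
  obtain ⟨h3, h4⟩ := eval_bracketSum w (N := order β) hβ hα (by omega) 0
  obtain ⟨h5, h6⟩ := eval_smul w (Int.negSucc 0) h4 (by omega)
  refine ⟨?_, (h2.mono (by omega)).add (h6.mono (by omega))⟩
  rw [bracket, eval_add, h5, h1, h3, formBracket_eq_sum (order α + order β)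
    (fun j hj => jetPartial_eq_zero_of_order w (by omega))
    (fun j hj => jetPartial_eq_zero_of_order w (by omega)), Finset.sum_sub_distrib,
    Int.negSucc_eq, Nat.cast_zero, zero_add, neg_smul, one_smul, sub_eq_add_neg]
  simp only [zero_add]
  congr 1
  · refine Finset.sum_subset (by simp) fun i _ hi => ?_
    rw [jetPartial_eq_zero_of_order w (by simpa using hi), mul_zero]
  · refine congrArg _ (Finset.sum_subset (by simp) fun i _ hi => ?_)
    rw [jetPartial_eq_zero_of_order w (by simpa using hi), mul_zero]

lemma eval_of_isZero {p : JetPoly} (h : isZero p = true) : eval w p = 0 := by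
  cases p with
  | nil => rfl
  | cons t p => cases h

lemma isHomogOfDegree_jetVar (i : ℕ) :
    IsHomogOfDegree (jetVar w i) (if i % 10 = 0 then i / 10 else 0) := by
  rw [jetVar, IsHomogOfDegree]
  by_cases h : i % 10 = 0
  · rw [if_pos h, if_pos h]
    cases i / 10 with
    | zero => exact isWeightedHomogeneous_C _ _
    | succ k => exact isWeightedHomogeneous_X R _ k
  · rw [if_neg h, if_neg h]
    exact isWeightedHomogeneous_C _ _

lemma weight_eq (N k : ℕ) : weight N k = ∑ j ∈ Finset.range N, j * digit (10 * j) k := by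
  induction N with
  | zero => rfl
  | succ N ih =>
    change N * digit (10 * N) k + weight N k = _
    rw [Finset.sum_range_succ, ih, add_comm]

lemma isHomogOfDegree_evalKey {N k : ℕ} (h : ∀ i, 10 * N ≤ i → digit i k = 0) :
    IsHomogOfDegree (evalKey w k) (weight N k) := by
  have e1 : weight N k = ∑ i ∈ Finset.range (10 * N),
      digit i k • (if i % 10 = 0 then i / 10 else 0) := by
    clear h
    rw [weight_eq]
    induction N with
    | zero => rfl
    | succ N ih =>
      have hz : ∑ i ∈ Finset.range 9, digit (10 * N + (i + 1)) k •
          (if (10 * N + (i + 1)) % 10 = 0 then (10 * N + (i + 1)) / 10 else 0) = 0 := by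
        refine Finset.sum_eq_zero fun i hi => ?_
        rw [if_neg (by have := Finset.mem_range.mp hi; omega), smul_zero]
      rw [Finset.sum_range_succ, ih, mul_add, mul_one, Finset.sum_range_add,
        Finset.sum_range_succ' _ 9, hz]
      simp [mul_comm]
  rw [evalKey_eq_prod w h, e1]
  exact IsWeightedHomogeneous.prod _ _ _ fun i _ => (isHomogOfDegree_jetVar w i).pow _

lemma isHomogOfDegree_eval {n : ℕ} {p : JetPoly} (h : isHomog n p = true) :
    IsHomogOfDegree (eval w p) n := by
  have hN : 10 * order p ≥ numVars p := by
    have : order p = numVars p / 10 + 1 := rfl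
    omega
  have hk : ∀ t ∈ p, weight (order p) t.1 = n := by
    have key (N : ℕ) (q : JetPoly)
        (hq : fold (fun t b => sel (Nat.beq (weight N t.1) n) b false) true q = true) :
        ∀ t ∈ q, weight N t.1 = n := by
      induction q with
      | nil => simp
      | cons t q ih =>
        have e1 : fold (fun t b => sel (Nat.beq (weight N t.1) n) b false) true (t :: q) =
          sel (Nat.beq (weight N t.1) n)
            (fold (fun t b => sel (Nat.beq (weight N t.1) n) b false) true q) false := rfl
        rw [e1] at hq
        cases hb : Nat.beq (weight N t.1) n with
        | true =>
          rw [hb] at hq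
          exact List.forall_mem_cons.mpr ⟨Nat.eq_of_beq_eq_true hb, ih hq⟩
        | false => rw [hb] at hq; cases hq
    exact key _ _ h
  refine (weightedHomogeneousSubmodule R (fun k : ℕ => k + 1) n).toAddSubgroup.list_sum_mem ?_
  intro x hx
  obtain ⟨t, ht, rfl⟩ := List.mem_map.mp hx
  refine (weightedHomogeneousSubmodule R (fun k : ℕ => k + 1) n).toAddSubgroup.zsmul_mem ?_ _
  rw [← hk t ht]
  exact isHomogOfDegree_evalKey w fun i hi => digit_eq_zero_of_numVars (hN.le.trans hi) ht

lemma bounded_of_isBounded {d : ℕ} {p : JetPoly} (h : isBounded d p = true) : Bounded d p := by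
  have key (N : ℕ) (q : JetPoly) (hq : fold (fun t b => sel b (Nat.rec true
      (fun i ih => sel (Nat.ble (digit i t.1) d) ih false) N) false) true q = true) :
      ∀ t ∈ q, ∀ i < N, digit i t.1 ≤ d := by
    induction q with
    | nil => simp
    | cons t q ih =>
      have hN (M : ℕ) (hM : (Nat.rec true (fun i ih => sel (Nat.ble (digit i t.1) d) ih false) M :
          Bool) = true) : ∀ i < M, digit i t.1 ≤ d := by
        induction M with
        | zero => simp
        | succ M ihM =>
          dsimp only at hM
          cases hb : Nat.ble (digit M t.1) d with
          | true =>
            rw [hb] at hM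
            intro i hi
            rcases Nat.lt_succ_iff_lt_or_eq.mp hi with hi | rfl
            · exact ihM hM i hi
            · exact Nat.le_of_ble_eq_true hb
          | false => rw [hb] at hM; cases hM
      have e1 : fold (fun t b => sel b (Nat.rec true
          (fun i ih => sel (Nat.ble (digit i t.1) d) ih false) N) false) true (t :: q) =
        sel (fold (fun t b => sel b (Nat.rec true
          (fun i ih => sel (Nat.ble (digit i t.1) d) ih false) N) false) true q)
          (Nat.rec true (fun i ih => sel (Nat.ble (digit i t.1) d) ih false) N) false := rfl
      rw [e1] at hq
      cases hb : fold (fun t b => sel b (Nat.rec true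
          (fun i ih => sel (Nat.ble (digit i t.1) d) ih false) N) false) true q with
      | true =>
        rw [hb] at hq
        exact List.forall_mem_cons.mpr ⟨hN N hq, ih hb⟩
      | false => rw [hb] at hq; cases hq
  intro t ht i
  rcases lt_or_ge i (numVars p) with hi | hi
  · exact key (numVars p) p h t ht i hi
  · rw [digit_eq_zero_of_numVars hi ht]; exact Nat.zero_le _

lemma bracket_add_eq_of_isSolution [Fact ((w 0)′ = 1)] {n d : ℕ} {p q g : JetPoly}
    (hq : Bounded d q) (hd : d ≤ 255)
    (h : isSolution n p q g = true) :
    IsHomogOfDegree (eval w g) n ∧ formBracket (C (w 0 ^ 2)) (eval w g) + eval w p = eval w q := by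
  rw [isSolution] at h
  cases h1 : isBounded 100 g with
  | false => rw [h1] at h; cases h
  | true =>
    rw [h1] at h
    change sel (Nat.ble (order g) 20 && isHomog n g) _ false = true at h
    cases h2 : Nat.ble (order g) 20 && isHomog n g with
    | false => rw [h2] at h; cases h
    | true =>
      rw [h2] at h
      rw [Bool.and_eq_true] at h2
      have ho := Nat.le_of_ble_eq_true h2.1
      refine ⟨isHomogOfDegree_eval w h2.2, ?_⟩
      have hu : eval w [(2, 1)] = C (w 0 ^ 2) := by
        have : evalKey w 2 = C (w 0) ^ 2 := by
          change evalKey w (256 ^ 0 + 256 ^ 0) = _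
          rw [evalKey_add w fun i => by rw [digit_pow]; split_ifs <;> omega, evalKey_pow,
            jetVar_zero, sq]
        rw [eval_cons, this, C_pow]; simp
      have hb : Bounded 2 [(2, 1)] := bounded_cons.mpr ⟨fun i => by
        cases i with
        | zero => exact le_rfl
        | succ i => rw [digit_succ, Nat.div_eq_of_lt (by norm_num), digit_zero]; omega,
          bounded_nil _⟩
      have ho' : order [(2, 1)] = 1 := by decide
      have h3 := eval_of_isZero w h
      rw [eval_add, eval_add, (eval_smul w (Int.negSucc 0) hq hd).1,
        (eval_bracket w hb (bounded_of_isBounded h1) (by omega)).1, hu] at h3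
      rw [← sub_eq_zero, ← h3]
      simp [sub_eq_add_neg]

/-- The least common multiple. -/
def lcm (m n : ℕ) : ℕ := Nat.div (Nat.mul m n) (Nat.gcd m n)

/-- The product with a natural number. -/
def scale (n : ℕ) (p : JetPoly) : JetPoly := sel (Nat.beq n 1) p (mulTerm 0 (Int.ofNat n) p)

lemma eval_scale {d : ℕ} {p : JetPoly} (n : ℕ) (hp : Bounded d p) (h : d ≤ 255) :
    eval w (scale n p) = n • eval w p ∧ Bounded d (scale n p) := by
  rw [scale]
  cases hn : Nat.beq n 1 with
  | true => rw [Nat.eq_of_beq_eq_true hn, one_smul]; exact ⟨rfl, hp⟩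
  | false =>
    have := eval_smul w (Int.ofNat n) hp h
    rw [Int.ofNat_eq_natCast, natCast_zsmul] at this
    exact this

end JetPoly

/-! ### Translation of differential polynomials into the model -/

/-- The polynomial `p` of the computable model, with exponents at most `d`, represents the
differential polynomial `F` with denominator `N`. These data are output parameters: instance search
finds them by recursion on the expression `F`. -/
class Reifies {R : Type*} [CommRing R] [Differential R] (w : Fin 10 → R) (F : DiffPoly R)
    (N d : outParam ℕ) (p : outParam JetPoly) : Prop where
  ne_zero : N ≠ 0
  bounded : d ≤ 255 → p.Bounded d
  eq : d ≤ 255 → N • F = p.eval w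

namespace Reifies
variable {R : Type*} [CommRing R] [Differential R] (w : Fin 10 → R) (F G : DiffPoly R) (r s : R)
  (M N d e : ℕ) (p q : JetPoly)

instance add [hF : Reifies w F M d p] [hG : Reifies w G N e q] :
    Reifies w (F + G) (JetPoly.lcm M N) (max d e)
      (((JetPoly.scale (Nat.div (JetPoly.lcm M N) M) p)).add
        (JetPoly.scale (Nat.div (JetPoly.lcm M N) N) q)) where
  ne_zero := Nat.lcm_ne_zero hF.ne_zero hG.ne_zero
  bounded h := by
    have hd := le_max_left d e
    have he := le_max_right d e
    exact ((JetPoly.eval_scale w _ (hF.bounded (by omega)) (by omega)).2.mono hd).add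
      ((JetPoly.eval_scale w _ (hG.bounded (by omega)) (by omega)).2.mono he)
  eq h := by
    have hd := le_max_left d e
    have he := le_max_right d e
    have h1 : M.lcm N / M * M = M.lcm N := Nat.div_mul_cancel (Nat.dvd_lcm_left M N)
    have h2 : M.lcm N / N * N = M.lcm N := Nat.div_mul_cancel (Nat.dvd_lcm_right M N)
    rw [JetPoly.eval_add, (JetPoly.eval_scale w _ (hF.bounded (by omega)) (by omega)).1,
      (JetPoly.eval_scale w _ (hG.bounded (by omega)) (by omega)).1, ← hF.eq (by omega),
      ← hG.eq (by omega), smul_smul, smul_smul]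
    change M.lcm N • (F + G) = (M.lcm N / M * M) • F + (M.lcm N / N * N) • G
    rw [h1, h2, smul_add]

instance mul [hF : Reifies w F M d p] [hG : Reifies w G N e q] :
    Reifies w (F * G) (M * N) (d + e) (p.mul q) where
  ne_zero := mul_ne_zero hF.ne_zero hG.ne_zero
  bounded h := (JetPoly.eval_mul w (hF.bounded (by omega)) (hG.bounded (by omega)) h).2
  eq h := by
    rw [(JetPoly.eval_mul w (hF.bounded (by omega)) (hG.bounded (by omega)) h).1,
      ← hF.eq (by omega), ← hG.eq (by omega), smul_mul_smul_comm]

instance pow (n : ℕ) [hF : Reifies w F N d p] :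
    Reifies w (F ^ n) (N ^ n) (n * d) (p.pow n) := by
  have key (h : n * d ≤ 255) : (p.pow n).Bounded (n * d) ∧ N ^ n • F ^ n = (p.pow n).eval w := by
    rcases n with _ | n
    · have := JetPoly.eval_pow w (JetPoly.bounded_nil 0) 0 (by omega)
      simp only [pow_zero, one_smul, zero_mul] at this ⊢
      exact ⟨this.2, this.1.symm⟩
    · have hd : d ≤ 255 := (Nat.le_mul_of_pos_left d n.succ_pos).trans h
      have := JetPoly.eval_pow w (hF.bounded hd) (n + 1) h
      rw [← hF.eq hd, smul_pow] at this
      exact ⟨this.2, this.1.symm⟩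
  exact ⟨pow_ne_zero _ hF.ne_zero, fun h => (key h).1, fun h => (key h).2⟩

instance bracket [Fact ((w 0)′ = 1)] [hF : Reifies w F M d p] [hG : Reifies w G N e q] :
    Reifies w (formBracket F G) (M * N) (d + e + 2 * (p.order + q.order) + 2) (p.bracket q) where
  ne_zero := mul_ne_zero hF.ne_zero hG.ne_zero
  bounded h := (JetPoly.eval_bracket w (hF.bounded (by omega)) (hG.bounded (by omega)) h).2
  eq h := by
    rw [(JetPoly.eval_bracket w (hF.bounded (by omega)) (hG.bounded (by omega)) h).1,
      ← hF.eq (by omega), ← hG.eq (by omega), formBracket_nsmul_nsmul]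

lemma of_pow {i : ℕ} (h : F = JetPoly.jetVar w i) : Reifies w F 1 1 [(256 ^ i, 1)] where
  ne_zero := one_ne_zero
  bounded _ := JetPoly.bounded_cons.mpr
    ⟨fun _ => JetPoly.digit_le_one_of_lt _ _ rfl, JetPoly.bounded_nil _⟩
  eq _ := by rw [one_smul, JetPoly.eval_cons, JetPoly.evalKey_pow, h]; simp

instance X (k : ℕ) : Reifies w (X k) 1 1 [(256 ^ (10 * (k + 1)), 1)] :=
  of_pow w _ (JetPoly.jetVar_jet w k).symm

instance C_apply (n : Fin 10) : Reifies w (C (w n)) 1 1 [(256 ^ n.val, 1)] := by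
  refine of_pow w _ ?_
  obtain ⟨n, hn⟩ := n
  rcases n with _ | n
  · exact (JetPoly.jetVar_zero w).symm
  · simpa using! (JetPoly.jetVar_fn w 0 n hn).symm

instance C_add [h : Reifies w (C r + C s) N d p] : Reifies w (C (r + s)) N d p := by
  rwa [MvPolynomial.C_add]

instance C_mul [h : Reifies w (C r * C s) N d p] : Reifies w (C (r * s)) N d p := by
  rwa [MvPolynomial.C_mul]

instance C_pow (n : ℕ) [h : Reifies w (C r ^ n) N d p] : Reifies w (C (r ^ n)) N d p := by
  rwa [MvPolynomial.C_pow]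

instance C_smul [Algebra ℚ R] (c : ℚ) [hr : Reifies w (C r) N d p] :
    Reifies w (C (c • r)) (N * c.den) d (p.mulTerm 0 c.num) where
  ne_zero := mul_ne_zero hr.ne_zero c.den_ne_zero
  bounded h := (JetPoly.eval_smul w _ (hr.bounded h) h).2
  eq h := by
    rw [(JetPoly.eval_smul w _ (hr.bounded h) h).1, ← hr.eq h, smul_comm, mul_smul]
    congr 1
    have e1 : (c.den : ℚ) * c = c.num := Rat.den_mul_eq_num c
    have e2 : c.den • (c • r) = c.num • r := by
      rw [← Nat.cast_smul_eq_nsmul ℚ, smul_smul, e1, Int.cast_smul_eq_zsmul]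
    rw [← map_nsmul (C : R →+* DiffPoly R), e2, map_zsmul (C : R →+* DiffPoly R)]

instance C_sub [Algebra ℚ R] [h : Reifies w (C r + C ((-1 : ℚ) • s)) N d p] :
    Reifies w (C (r - s)) N d p := by
  rwa [← MvPolynomial.C_add, neg_smul, one_smul, ← sub_eq_add_neg] at h

instance C_derivs [Fact ((w 0)′ = 1)] (k : ℕ) [hr : Reifies w (C r) N d p] :
    Reifies w (C (derivs r k)) N (d + 2 * k) ((JetPoly.partialDeriv 0)^[k] p) := by
  have key (h : d + 2 * k ≤ 255) : ((JetPoly.partialDeriv 0)^[k] p).Bounded (d + 2 * k) ∧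
      N • C (derivs r k) = ((JetPoly.partialDeriv 0)^[k] p).eval w := by
    induction k with
    | zero => exact ⟨hr.bounded h, hr.eq h⟩
    | succ k ih =>
      obtain ⟨h1, h2⟩ := ih (by omega)
      obtain ⟨h3, h4⟩ := JetPoly.eval_partialDeriv w 0 h1 (by omega)
      rw [Function.iterate_succ_apply', h3, ← h2, derivs_succ, ← jetPartial_zero_C]
      exact ⟨h4, (map_nsmul (jetDerivation 0) N _).symm⟩
  exact ⟨hr.ne_zero, fun h => (key h).1, fun h => (key h).2⟩

end Reifies

section Check
variable {R : Type*} [CommRing R] [Algebra ℚ R]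

lemma eq_of_nsmul_eq_nsmul {F G : DiffPoly R} {n : ℕ} (hn : n ≠ 0) (h : n • F = n • G) :
    F = G := by
  have := congrArg ((n : ℚ)⁻¹ • ·) h
  simpa [← Nat.cast_smul_eq_nsmul ℚ, smul_smul, hn] using this

lemma isHomogOfDegree_of_nsmul {F : DiffPoly R} {n N : ℕ} (hN : N ≠ 0)
    (h : IsHomogOfDegree (N • F) n) : IsHomogOfDegree F n := by
  intro m hm
  refine h fun h0 => hm ?_
  rw [coeff_smul, ← Nat.cast_smul_eq_nsmul ℚ] at h0
  simpa [smul_smul, hN] using congrArg ((N : ℚ)⁻¹ • ·) h0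

variable [Differential R] (w : Fin 10 → R) {F ρ : DiffPoly R} {M N d e : ℕ} {p q : JetPoly}


/-- A polynomial identity is checked by expanding it in the computable model. The bound `255` on the
exponents excludes carries. -/
lemma eq_zero_of_isZero [hF : Reifies w F N d p]
    (h : (Nat.ble d 255 && p.isZero) = true) : F = 0 := by
  rw [Bool.and_eq_true] at h
  refine eq_of_nsmul_eq_nsmul hF.ne_zero ?_
  rw [hF.eq (Nat.le_of_ble_eq_true h.1), JetPoly.eval_of_isZero w h.2, smul_zero]

/-- The equation `{u², g} + F = ρ` is solved by triangular elimination in the computable model. Both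
sides are multiplied by `t` times a common denominator, which has to be large enough to make all
divisions in the elimination exact. -/
lemma exists_bracket_add_eq [Fact ((w 0)′ = 1)] (n t : ℕ) [hF : Reifies w F N d p]
    [hρ : Reifies w ρ M e q] (ht : t ≠ 0) (hde : (Nat.ble d 255 && Nat.ble e 255) = true)
    (h : JetPoly.isSolution n (p.scale (t * Nat.div (JetPoly.lcm N M) N))
      (q.scale (t * Nat.div (JetPoly.lcm N M) M))
      ((p.scale (t * Nat.div (JetPoly.lcm N M) N)).primitive (n + 1)) = true) :
    ∃ g, IsHomogOfDegree g n ∧ formBracket (C (w 0 ^ 2)) g + F = ρ := by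
  rw [Bool.and_eq_true] at hde
  have hd := Nat.le_of_ble_eq_true hde.1
  have he := Nat.le_of_ble_eq_true hde.2
  have hN : Nat.div (JetPoly.lcm N M) N * N = N.lcm M := Nat.div_mul_cancel (Nat.dvd_lcm_left N M)
  have hM : Nat.div (JetPoly.lcm N M) M * M = N.lcm M := Nat.div_mul_cancel (Nat.dvd_lcm_right N M)
  set K := Nat.div (JetPoly.lcm N M) N
  set L := Nat.div (JetPoly.lcm N M) M
  have h0 : t * N.lcm M ≠ 0 := mul_ne_zero ht (Nat.lcm_ne_zero hF.ne_zero hρ.ne_zero)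
  obtain ⟨h1, h2⟩ := JetPoly.eval_scale w (t * K) (hF.bounded hd) hd
  obtain ⟨h3, h4⟩ := JetPoly.eval_scale w (t * L) (hρ.bounded he) he
  obtain ⟨h5, h6⟩ := JetPoly.bracket_add_eq_of_isSolution w h4 he h
  rw [h1, h3, ← hF.eq hd, ← hρ.eq he, smul_smul, smul_smul, mul_assoc, mul_assoc, hN, hM] at h6
  set g' := ((p.scale (t * K)).primitive (n + 1)).eval w
  have hg : (t * N.lcm M) • ((t * N.lcm M : ℕ) : ℚ)⁻¹ • g' = g' := by
    rw [← Nat.cast_smul_eq_nsmul ℚ, smul_smul, mul_inv_cancel₀ (Nat.cast_ne_zero.mpr h0),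
      one_smul]
  refine ⟨((t * N.lcm M : ℕ) : ℚ)⁻¹ • g', isHomogOfDegree_of_nsmul h0 (by rwa [hg]), ?_⟩
  refine eq_of_nsmul_eq_nsmul h0 ?_
  have h7 := formBracket_nsmul_nsmul 1 (t * N.lcm M) (C (w 0 ^ 2)) (((t * N.lcm M : ℕ) : ℚ)⁻¹ • g')
  rw [one_smul, one_mul, hg] at h7
  rw [smul_add, ← h7, h6]

end Check

end Reflection

/-! ### Triangularity of the bracket with `u²` -/

section Leading

variable {R : Type*} [CommRing R]

/-- The polynomials in `u_xx, u_xxx, …` with integer coefficients. -/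
def constSubalgebra (R : Type*) [CommRing R] : Subalgebra ℤ (DiffPoly R) :=
  Algebra.adjoin ℤ (Set.range fun k : ℕ => (X (k + 1) : DiffPoly R))

lemma X_succ_mem (k : ℕ) : (X (k + 1) : DiffPoly R) ∈ constSubalgebra R :=
  Algebra.subset_adjoin ⟨k, rfl⟩

lemma coeff_eq_zero_of_mem {S : DiffPoly R} (h : S ∈ constSubalgebra R) {m : ℕ →₀ ℕ}
    (hm : m 0 ≠ 0) : coeff m S = 0 := by
  classical
  have hv : 0 ∉ S.vars := by
    induction h using Algebra.adjoin_induction with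
    | mem S hS =>
      obtain ⟨k, rfl⟩ := hS
      intro h
      obtain ⟨d, hd, hd0⟩ := (mem_vars_iff_mem_support 0).mp h
      rw [mem_support_iff, coeff_X] at hd
      split_ifs at hd with h'
      · rw [← h'] at hd0; simp at hd0
      · exact hd rfl
    | algebraMap r =>
      have : algebraMap ℤ (DiffPoly R) r = C (r : R) := by simp
      rw [this, vars_C]; simp
    | add S T _ _ hS hT =>
      intro h
      rcases Finset.mem_union.mp (vars_add_subset S T h) with h | h
      exacts [hS h, hT h]
    | mul S T _ _ hS hT =>
      intro h
      rcases Finset.mem_union.mp (vars_mul S T h) with h | h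
      exacts [hS h, hT h]
  by_contra hc
  exact hv ((mem_vars_iff_mem_support 0).mpr ⟨m, mem_support_iff.mpr hc, by simpa using hm⟩)

variable [Differential R]

lemma totalDeriv_mem {S : DiffPoly R} (h : S ∈ constSubalgebra R) :
    totalDeriv S ∈ constSubalgebra R := by
  rw [← totalDerivation_apply]
  induction h using Algebra.adjoin_induction with
  | mem S hS =>
    obtain ⟨k, rfl⟩ := hS
    rw [totalDerivation_apply, totalDeriv_X]
    exact X_succ_mem _
  | algebraMap r => rw [Derivation.map_algebraMap]; exact zero_mem _
  | add S T _ _ hS hT => rw [map_add]; exact add_mem hS hT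
  | mul S T hS' hT' hS hT =>
    rw [Derivation.leibniz]
    exact add_mem (mul_mem hS' hT) (mul_mem hT' hS)

/-- The leading part of the total derivatives of `x ^ 2` for the coordinate `x = u`. -/
lemma iterate_totalDeriv_sq {x : R} (hx : x′ = 1) (k : ℕ) :
    ∃ c : ℕ, c ≠ 0 ∧ ∃ S ∈ constSubalgebra R, totalDeriv^[k + 2] (C (x ^ 2)) =
      2 * C x * X (k + 1) + (c : DiffPoly R) * (X 0 * X k) + S := by
  have hC : totalDerivation (C x : DiffPoly R) = X 0 := by
    rw [totalDerivation_apply, totalDeriv_C, hx, C_1, one_mul]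
  have hX (k : ℕ) : totalDerivation (X k : DiffPoly R) = X (k + 1) := totalDeriv_X k
  have h2 : totalDerivation (2 : DiffPoly R) = 0 := by
    exact_mod_cast Derivation.map_natCast totalDerivation 2
  have step : totalDeriv (C (x ^ 2) : DiffPoly R) = 2 * C x * X 0 := by
    rw [C_pow, ← totalDerivation_apply, Derivation.leibniz_pow, hC]
    simp; ring
  induction k with
  | zero =>
    refine ⟨2, two_ne_zero, 0, zero_mem _, ?_⟩
    change totalDeriv (totalDeriv _) = _
    rw [step, ← totalDerivation_apply]
    simp only [Derivation.leibniz, hC, hX, h2, smul_eq_mul]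
    push_cast; ring
  | succ k ih =>
    obtain ⟨c, hc, S, hS, h⟩ := ih
    have hc' : totalDerivation (c : DiffPoly R) = 0 := Derivation.map_natCast _ c
    have h' : totalDeriv^[k + 1 + 2] (C (x ^ 2) : DiffPoly R) = 2 * C x * X (k + 1 + 1) +
        ((c + 2 : ℕ) : DiffPoly R) * (X 0 * X (k + 1)) +
        ((c : DiffPoly R) * (X 1 * X k) + totalDeriv S) := by
      rw [Function.iterate_succ_apply', h, ← totalDerivation_apply, ← totalDerivation_apply]
      simp only [map_add, Derivation.leibniz, hC, hX, h2, hc', smul_eq_mul]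
      push_cast; ring
    have hcm (n : ℕ) : (n : DiffPoly R) ∈ constSubalgebra R := natCast_mem _ n
    rcases k with _ | k
    · refine ⟨c + 2 + c, by omega, totalDeriv S, totalDeriv_mem hS, ?_⟩
      rw [h']; push_cast; ring
    · exact ⟨c + 2, by omega, _, add_mem (mul_mem (hcm c) (mul_mem (X_succ_mem 0) (X_succ_mem k)))
        (totalDeriv_mem hS), h'⟩

/-- The terms of `{u², F}` with the factor `2u` cancel, since
`∂_x F = ∑_j u_(j+1) ∂F/∂u_(j)`. -/
lemma formBracket_sq_eq {x : R} (hx : x′ = 1) (F : DiffPoly R) : ∃ (N : ℕ) (c : ℕ → ℕ)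
    (S : ℕ → DiffPoly R), (∀ k, c k ≠ 0) ∧ (∀ k, S k ∈ constSubalgebra R) ∧
      (∀ k, N ≤ k → pderiv k F = 0) ∧ formBracket (C (x ^ 2)) F =
        -∑ k ∈ Finset.range N, ((c k : DiffPoly R) * (X 0 * X k) + S k) * pderiv k F := by
  choose c hc S hS h using iterate_totalDeriv_sq (R := R) hx
  obtain ⟨N, hN⟩ := exists_jetPartial_eq_zero F
  refine ⟨N, c, S, hc, hS, fun k hk => hN (k + 1) (by omega), ?_⟩
  have h0 : jetPartial 0 (C (x ^ 2) : DiffPoly R) = 2 * C x := by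
    have h2 : (C (2 : R) : DiffPoly R) = 2 := map_ofNat C 2
    rw [jetPartial_zero_C, Derivation.leibniz_pow, hx]
    simp [h2]
  have hD : totalDeriv F = ∑ j ∈ Finset.range (N + 1), X j * jetPartial j F := by
    rw [totalDeriv, finsum_eq_sum_of_support_subset]
    intro j hj
    by_contra hj'
    exact hj (by simp [hN j (by simp at hj'; omega)])
  have h1 : totalDeriv (C (x ^ 2) : DiffPoly R) = 2 * C x * X 0 := by
    rw [totalDeriv_C, ← jetPartial_zero_C, h0]
  rw [formBracket_eq_sum (N + 1) (fun j hj => by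
      obtain ⟨k, rfl⟩ := Nat.exists_eq_succ_of_ne_zero (show j ≠ 0 by omega)
      exact jetPartial_succ_C k _) (fun j hj => hN j (by omega)),
    Finset.sum_sub_distrib, Finset.sum_range_succ']
  simp only [jetPartial_succ_C, mul_zero, Finset.sum_const_zero, zero_add, h0]
  rw [Function.iterate_one, hD, Finset.sum_mul, ← Finset.sum_sub_distrib, Finset.sum_range_succ',
    ← Finset.sum_neg_distrib, Function.iterate_one, h1]
  have : (X 0 * jetPartial 0 F * (2 * C x) - 2 * C x * X 0 * jetPartial 0 F) = 0 := by ring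
  rw [this, add_zero]
  refine Finset.sum_congr rfl fun k _ => ?_
  rw [h k]
  simp only [jetPartial]
  ring

/-- The operator `{u², ·}` is triangular: its part that raises the degree in `u_x` multiplies each
monomial by `u_x` and a nonzero integer. Hence a differential polynomial without constant term is
zero if its image does not contain `u_x`. -/
theorem eq_zero_of_coeff_bracket [Algebra ℚ R] {x : R} (hx : x′ = 1) {F : DiffPoly R}
    (h0 : coeff 0 F = 0) (hT : ∀ m, m 0 ≠ 0 → coeff m (formBracket (C (x ^ 2)) F) = 0) :
    F = 0 := by
  classical
  by_contra hF
  obtain ⟨N, c, S, hc, hS, hN, hB⟩ := formBracket_sq_eq hx F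
  obtain ⟨m, hm, hmax⟩ := F.support.exists_max_image (fun m => m 0) (support_nonempty.mpr hF)
  have hm0 : coeff m F ≠ 0 := mem_support_iff.mp hm
  have hz (q : ℕ →₀ ℕ) (hq : m 0 < q 0) : coeff q F = 0 := by
    by_contra h
    exact absurd (hmax q (mem_support_iff.mpr h)) (not_le.mpr hq)
  -- `m` is of maximal degree in `u_x`, so only the terms `u_x u_(k+1) ∂F/∂u_(k+1)` contribute.
  have key : coeff (Finsupp.single 0 1 + m) (formBracket (C (x ^ 2)) F) =
      -((∑ k ∈ Finset.range N, c k * m k : ℕ) * coeff m F) := by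
    rw [hB, coeff_neg, coeff_sum, Nat.cast_sum, Finset.sum_mul]
    congr 1
    refine Finset.sum_congr rfl fun k _ => ?_
    have e1 : ((c k : DiffPoly R) * (X 0 * X k) + S k) * pderiv k F =
        X 0 * (C (c k : R) * (X k * pderiv k F)) + S k * pderiv k F := by
      rw [map_natCast]; ring
    have e2 : coeff (Finsupp.single 0 1 + m) (S k * pderiv k F) = 0 := by
      rw [coeff_mul]
      refine Finset.sum_eq_zero fun p hp => ?_
      by_cases hp0 : p.1 0 = 0
      · have := DFunLike.congr_fun (Finset.HasAntidiagonal.mem_antidiagonal.mp hp) 0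
        simp only [Finsupp.add_apply, Finsupp.single_eq_same, hp0] at this
        rw [coeff_pderiv, hz, zero_mul, mul_zero]
        rw [Finsupp.add_apply]; omega
      · rw [coeff_eq_zero_of_mem (hS k) hp0, zero_mul]
    have e3 : coeff m (X k * pderiv k F) = m k * coeff m F := by
      rw [coeff_X_mul']
      split_ifs with hk
      · have h1 : 1 ≤ m k := Nat.one_le_iff_ne_zero.mpr (Finsupp.mem_support_iff.mp hk)
        have h2 : m - Finsupp.single k 1 + Finsupp.single k 1 = m :=
          tsub_add_cancel_of_le (Finsupp.single_le_iff.mpr h1)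
        rw [coeff_pderiv, h2, mul_comm]
        congr 1
        rw [Finsupp.tsub_apply, Finsupp.single_eq_same]
        exact_mod_cast congrArg (Nat.cast : ℕ → R) (Nat.sub_add_cancel h1)
      · rw [Finsupp.notMem_support_iff.mp hk, Nat.cast_zero, zero_mul]
    rw [e1, coeff_add, e2, add_zero, coeff_X_mul, coeff_C_mul, e3]
    push_cast; ring
  have hreg (n : ℕ) (hn : n ≠ 0) (h : (n : R) * coeff m F = 0) : False := by
    rw [← nsmul_eq_mul, ← Nat.cast_smul_eq_nsmul ℚ] at h
    exact hm0 (by simpa [smul_smul, hn] using congrArg ((n : ℚ)⁻¹ • ·) h)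
  have hne : m ≠ 0 := by rintro rfl; exact hm0 h0
  obtain ⟨k, hk⟩ := Finsupp.ne_iff.mp hne
  have hkN : k < N := by
    by_contra hkN
    have h1 : 1 ≤ m k := Nat.one_le_iff_ne_zero.mpr hk
    have h2 : m - Finsupp.single k 1 + Finsupp.single k 1 = m :=
      tsub_add_cancel_of_le (Finsupp.single_le_iff.mpr h1)
    have h3 := congrArg (coeff (m - Finsupp.single k 1)) (hN k (not_lt.mp hkN))
    rw [coeff_pderiv, h2, coeff_zero] at h3
    have h4 : (m - Finsupp.single k 1 : ℕ →₀ ℕ) k + 1 = m k := by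
      rw [Finsupp.tsub_apply, Finsupp.single_eq_same]; exact Nat.sub_add_cancel h1
    have h5 : ((m k : ℕ) : R) * coeff m F = 0 := by
      rw [← h4, mul_comm]; exact_mod_cast h3
    exact hreg _ hk h5
  rw [hT _ (by simp), eq_comm, neg_eq_zero] at key
  have hsum : (∑ k ∈ Finset.range N, c k * m k) ≠ 0 := by
    intro h
    exact mul_ne_zero (hc k) hk (Finset.sum_eq_zero_iff.mp h k (Finset.mem_range.mpr hkN))
  exact hreg _ hsum key

end Leading

/-! ### The equations of commutativity, order by order -/

section Orders

variable {R : Type*} [CommRing R] [Differential R] [Algebra ℚ R]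

/-- The first-order term of the flow of `f`. -/
def flowPoly1 (a f : R) : DiffPoly R := C (flowA (derivs a) (derivs f)) * u₁

/-- The second-order term of the flow of `f`. -/
def flowPoly2 (a f b : R) : DiffPoly R :=
  C (flowB1 (derivs a) (derivs f) b) * u₂ + C (flowB2 (derivs a) (derivs f) b) * u₁ ^ 2

/-- The third-order term of the flow of `f`. -/
def flowPoly3 (a f c : R) : DiffPoly R :=
  C (flowC1 (derivs a) (derivs f) c) * u₃ + C (flowC2 (derivs a) (derivs f) c) * (u₁ * u₂)
    + C (flowC3 (derivs a) (derivs f) c) * u₁ ^ 3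

/-- The fourth-order term of the flow of `f`. -/
def flowPoly4 (a f d₁ d₂ : R) : DiffPoly R :=
  C (flowD1 (derivs a) (derivs f) d₁) * u₄ + C (flowD2 (derivs a) (derivs f) d₁) * (u₁ * u₃)
    + C (flowD3 (derivs a) (derivs f) d₁ d₂) * u₂ ^ 2
    + C (flowD4 (derivs a) (derivs f) d₁ d₂) * (u₁ ^ 2 * u₂)
    + C (flowD5 (derivs a) (derivs f) d₁) * u₁ ^ 4

/-- The fifth-order term of the flow of `f`. -/
def flowPoly5 (a f e₁ e₂ : R) : DiffPoly R :=
  C (flowE1 (derivs a) (derivs f) e₁) * u₅ + C (flowE2 (derivs a) (derivs f) e₁) * (u₁ * u₄)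
    + C (flowE3 (derivs a) (derivs f) e₁ e₂) * (u₂ * u₃)
    + C (flowE4 (derivs a) (derivs f) e₁ e₂) * (u₁ ^ 2 * u₃)
    + C (flowE5 (derivs a) (derivs f) e₁ e₂) * (u₁ * u₂ ^ 2)
    + C (flowE6 (derivs a) (derivs f) e₁ e₂) * (u₁ ^ 3 * u₂)
    + C (flowE7 (derivs a) (derivs f) e₁) * u₁ ^ 5

/-- The second-order coefficient of an integrable normal form. -/
def normalB (a : R) : R := (1 / 2 : ℚ) • derivs (a ^ 2) 1

/-- The third-order coefficient of an integrable normal form. -/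
def normalC (a : R) : R := (1 / 6 : ℚ) • derivs (a ^ 3) 2

/-- The coefficient of `u_xxxx` in an integrable normal form. -/
def normalD (a : R) : R := (1 / 24 : ℚ) • derivs (a ^ 4) 3

/-- The coefficient of `u_xxxxx` in an integrable normal form. -/
def normalE (a : R) : R := (1 / 120 : ℚ) • derivs (a ^ 5) 4

/-! In the following equations `w 0` is the coordinate `u`, `w 1` is `a` and `w 2` is `f`; the
further entries of `w` are the coefficients of the normal form that the equation leaves free. An
equation `{u², g} + H = 0` says that the terms of order `ε^n` in `{ω, ω_f}` cancel, where `g` is the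
term of order `ε^n` in `ω_f` and `H` collects the brackets with the lower terms of `ω_f`. -/

variable (w : Fin 10 → R)

set_option synthInstance.maxHeartbeats 1000000
set_option synthInstance.maxSize 100000
set_option maxHeartbeats 1000000
set_option maxRecDepth 10000

theorem order_zero (hw : (w 0)′ = 1) : formBracket (C (w 0 ^ 2)) (C (w 1)) = 0 := by
  have := Fact.mk hw
  exact eq_zero_of_isZero w (by decide +kernel)

/-- The power `w 0 ^ 0` stands for `1`. -/
theorem third_derivative_cubic (hw : (w 0)′ = 1) :
    C (derivs ((1 / 6 : ℚ) • w 0 ^ 3) 3 - w 0 ^ 0) = (0 : DiffPoly R) := by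
  have := Fact.mk hw
  exact eq_zero_of_isZero w (by decide +kernel)

theorem order_one (hw : (w 0)′ = 1) : formBracket (C (w 0 ^ 2)) (flowPoly1 (w 1) (w 2)) +
    formBracket (C (w 1) * u₁) (C (w 2)) = 0 := by
  have := Fact.mk hw
  unfold flowPoly1 flowA
  exact eq_zero_of_isZero w (by decide +kernel)

theorem order_two (hw : (w 0)′ = 1) : formBracket (C (w 0 ^ 2)) (flowPoly2 (w 1) (w 2) (w 3)) +
    (formBracket (C (w 1) * u₁) (flowPoly1 (w 1) (w 2)) +
      formBracket (C (w 3) * u₂) (C (w 2))) = 0 := by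
  have := Fact.mk hw
  unfold flowPoly1 flowPoly2 flowA flowB1 flowB2
  exact eq_zero_of_isZero w (by decide +kernel)

/-- At the third order the equation is solvable up to a multiple of `u_xx²`, the obstruction to
`b = (a² / 2)′`. -/
theorem order_three_obstruction (hw : (w 0)′ = 1) : ∃ g, IsHomogOfDegree g 3 ∧
    formBracket (C (w 0 ^ 2)) g +
    (formBracket (C (w 1) * u₁) (flowPoly2 (w 1) (w 2) (w 3)) +
      formBracket (C (w 3) * u₂) (flowPoly1 (w 1) (w 2)) +
      formBracket (C (w 4) * u₃) (C (w 2))) =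
    C ((1 / 8 : ℚ) • (w 1 * derivs (w 2) 3 * (w 3 - normalB (w 1)))) * u₂ ^ 2 := by
  have := Fact.mk hw
  unfold normalB flowPoly1 flowPoly2 flowA flowB1 flowB2
  exact exists_bracket_add_eq w 3 24 (by norm_num) (by decide +kernel) (by decide +kernel)

theorem order_three (hw : (w 0)′ = 1) : formBracket (C (w 0 ^ 2)) (flowPoly3 (w 1) (w 2) (w 3)) +
    (formBracket (C (w 1) * u₁) (flowPoly2 (w 1) (w 2) (normalB (w 1))) +
      formBracket (C (normalB (w 1)) * u₂) (flowPoly1 (w 1) (w 2)) +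
      formBracket (C (w 3) * u₃) (C (w 2))) = 0 := by
  have := Fact.mk hw
  unfold normalB flowPoly1 flowPoly2 flowPoly3 flowA flowB1 flowB2 flowC1 flowC2 flowC3
  exact eq_zero_of_isZero w (by decide +kernel)

/-- The obstruction to `c = (a³ / 6)″` at the fourth order. -/
theorem order_four_obstruction (hw : (w 0)′ = 1) : ∃ g, IsHomogOfDegree g 4 ∧
    formBracket (C (w 0 ^ 2)) g +
    (formBracket (C (w 1) * u₁) (flowPoly3 (w 1) (w 2) (w 3)) +
      formBracket (C (normalB (w 1)) * u₂) (flowPoly2 (w 1) (w 2) (normalB (w 1))) +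
      formBracket (C (w 3) * u₃) (flowPoly1 (w 1) (w 2)) +
      formBracket (C (w 4) * u₄ + C (w 5) * u₂ ^ 2) (C (w 2))) =
    C ((1 / 2 : ℚ) • (w 1 * derivs (w 2) 3 * (w 3 - normalC (w 1)))) * (u₂ * u₃) := by
  have := Fact.mk hw
  unfold normalB normalC flowPoly1 flowPoly2 flowPoly3 flowA flowB1 flowB2 flowC1 flowC2 flowC3
  exact exists_bracket_add_eq w 4 360 (by norm_num) (by decide +kernel) (by decide +kernel)

theorem order_four (hw : (w 0)′ = 1) :
    formBracket (C (w 0 ^ 2)) (flowPoly4 (w 1) (w 2) (w 3) (w 4)) +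
    (formBracket (C (w 1) * u₁) (flowPoly3 (w 1) (w 2) (normalC (w 1))) +
      formBracket (C (normalB (w 1)) * u₂) (flowPoly2 (w 1) (w 2) (normalB (w 1))) +
      formBracket (C (normalC (w 1)) * u₃) (flowPoly1 (w 1) (w 2)) +
      formBracket (C (w 3) * u₄ + C (w 4) * u₂ ^ 2) (C (w 2))) = 0 := by
  have := Fact.mk hw
  unfold normalB normalC flowPoly1 flowPoly2 flowPoly3 flowPoly4 flowA flowB1 flowB2 flowC1 flowC2
    flowC3 flowD1 flowD2 flowD3 flowD4 flowD5
  exact eq_zero_of_isZero w (by decide +kernel)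

/-- The obstructions to `d₁ = (a⁴ / 24)‴` and to the formula for `d₂` at the fifth order. -/
theorem order_five_obstruction (hw : (w 0)′ = 1) : ∃ g, IsHomogOfDegree g 5 ∧
    formBracket (C (w 0 ^ 2)) g +
    (formBracket (C (w 1) * u₁) (flowPoly4 (w 1) (w 2) (w 3) (w 4)) +
      formBracket (C (normalB (w 1)) * u₂) (flowPoly3 (w 1) (w 2) (normalC (w 1))) +
      formBracket (C (normalC (w 1)) * u₃) (flowPoly2 (w 1) (w 2) (normalB (w 1))) +
      formBracket (C (w 3) * u₄ + C (w 4) * u₂ ^ 2) (flowPoly1 (w 1) (w 2)) +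
      formBracket (C (w 5) * u₅ + C (w 6) * (u₂ * u₃)) (C (w 2))) =
    C ((3 / 4 : ℚ) • (w 1 * derivs (w 2) 3 * (w 3 - normalD (w 1)))) * (u₂ * u₄) +
    C ((2 / 3 : ℚ) • (w 1 * derivs (w 2) 3 * (w 3 - normalD (w 1)))) * u₃ ^ 2 +
    C ((32 / 35 : ℚ) • (w 1 * derivs (w 2) 3 * (w 4 - normalD2 (derivs (w 1)))) -
      ((1 / 14 : ℚ) • (w 1 * derivs (w 2) 4) + (2 / 7 : ℚ) • (derivs (w 1) 1 * derivs (w 2) 3)) *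
        (w 3 - normalD (w 1))) * u₂ ^ 3 := by
  have := Fact.mk hw
  unfold normalB normalC normalD normalD2 flowPoly1 flowPoly2 flowPoly3 flowPoly4 flowA flowB1
    flowB2 flowC1 flowC2 flowC3 flowD1 flowD2 flowD3 flowD4 flowD5
  exact exists_bracket_add_eq w 5 2520 (by norm_num) (by decide +kernel) (by decide +kernel)

theorem order_five (hw : (w 0)′ = 1) :
    formBracket (C (w 0 ^ 2)) (flowPoly5 (w 1) (w 2) (w 3) (w 4)) +
    (formBracket (C (w 1) * u₁)
        (flowPoly4 (w 1) (w 2) (normalD (w 1)) (normalD2 (derivs (w 1)))) +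
      formBracket (C (normalB (w 1)) * u₂) (flowPoly3 (w 1) (w 2) (normalC (w 1))) +
      formBracket (C (normalC (w 1)) * u₃) (flowPoly2 (w 1) (w 2) (normalB (w 1))) +
      formBracket (C (normalD (w 1)) * u₄ + C (normalD2 (derivs (w 1))) * u₂ ^ 2)
        (flowPoly1 (w 1) (w 2)) +
      formBracket (C (w 3) * u₅ + C (w 4) * (u₂ * u₃)) (C (w 2))) = 0 := by
  have := Fact.mk hw
  unfold normalB normalC normalD normalD2 flowPoly1 flowPoly2 flowPoly3 flowPoly4 flowPoly5 flowA
    flowB1 flowB2 flowC1 flowC2 flowC3 flowD1 flowD2 flowD3 flowD4 flowD5 flowE1 flowE2 flowE3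
    flowE4 flowE5 flowE6 flowE7
  exact eq_zero_of_isZero w (by decide +kernel)

/-- The obstructions to `e₁ = (a⁵ / 120)⁗` and to the formula for `e₂` at the sixth order. The
terms of order `ε^6` of the normal form do not enter them. -/
theorem order_six_obstruction (hw : (w 0)′ = 1) : ∃ g, IsHomogOfDegree g 6 ∧
    formBracket (C (w 0 ^ 2)) g +
    (formBracket (C (w 1) * u₁) (flowPoly5 (w 1) (w 2) (w 3) (w 4)) +
      formBracket (C (normalB (w 1)) * u₂)
        (flowPoly4 (w 1) (w 2) (normalD (w 1)) (normalD2 (derivs (w 1)))) +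
      formBracket (C (normalC (w 1)) * u₃) (flowPoly3 (w 1) (w 2) (normalC (w 1))) +
      formBracket (C (normalD (w 1)) * u₄ + C (normalD2 (derivs (w 1))) * u₂ ^ 2)
        (flowPoly2 (w 1) (w 2) (normalB (w 1))) +
      formBracket (C (w 3) * u₅ + C (w 4) * (u₂ * u₃)) (flowPoly1 (w 1) (w 2)) +
      formBracket (C (w 5) * X 5 + C (w 6) * (u₂ * u₄) + C (w 7) * u₃ ^ 2 + C (w 8) * u₂ ^ 3)
        (C (w 2))) =
    C (w 1 * derivs (w 2) 3 * (w 3 - normalE (w 1))) * (u₂ * u₅) +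
    C ((5 / 2 : ℚ) • (w 1 * derivs (w 2) 3 * (w 3 - normalE (w 1)))) * (u₃ * u₄) +
    C ((45 / 28 : ℚ) • (w 1 * derivs (w 2) 3 * (w 4 - normalE2 (derivs (w 1)))) -
      ((5 / 8 : ℚ) • (w 1 * derivs (w 2) 4) + (15 / 8 : ℚ) • (derivs (w 1) 1 * derivs (w 2) 3)) *
        (w 3 - normalE (w 1))) * (u₂ ^ 2 * u₃) := by
  have := Fact.mk hw
  unfold normalB normalC normalD normalE normalD2 normalE2 flowPoly1 flowPoly2 flowPoly3 flowPoly4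
    flowPoly5 flowA flowB1 flowB2 flowC1 flowC2 flowC3 flowD1 flowD2 flowD3 flowD4 flowD5 flowE1
    flowE2 flowE3 flowE4 flowE5 flowE6 flowE7
  exact exists_bracket_add_eq w 6 5040 (by norm_num) (by decide +kernel) (by decide +kernel)

end Orders

/-! ### Homogeneous differential polynomials and series -/

section Series

variable {R : Type*} [CommRing R]

/-- The series with the given terms of order at most six and no others. -/
def seriesOfTerms (g₀ g₁ g₂ g₃ g₄ g₅ g₆ : DiffPoly R) : PowerSeries (DiffPoly R) :=
  PowerSeries.mk fun n => match n with
    | 0 => g₀ | 1 => g₁ | 2 => g₂ | 3 => g₃ | 4 => g₄ | 5 => g₅ | 6 => g₆ | _ => 0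

lemma isDeformation_seriesOfTerms {f : R} {g₁ g₂ g₃ g₄ g₅ g₆ : DiffPoly R}
    (h₁ : IsHomogOfDegree g₁ 1) (h₂ : IsHomogOfDegree g₂ 2) (h₃ : IsHomogOfDegree g₃ 3)
    (h₄ : IsHomogOfDegree g₄ 4) (h₅ : IsHomogOfDegree g₅ 5) (h₆ : IsHomogOfDegree g₆ 6) :
    IsDeformation f (seriesOfTerms (C f) g₁ g₂ g₃ g₄ g₅ g₆) := by
  refine ⟨PowerSeries.coeff_mk _ _, fun n => ?_⟩
  rw [seriesOfTerms, PowerSeries.coeff_mk]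
  match n with
  | 0 => exact isWeightedHomogeneous_C _ _
  | 1 => exact h₁
  | 2 => exact h₂
  | 3 => exact h₃
  | 4 => exact h₄
  | 5 => exact h₅
  | 6 => exact h₆
  | n + 7 => exact isWeightedHomogeneous_zero _ _ _

lemma IsHomogOfDegree.C_mul {F : DiffPoly R} {n : ℕ} (h : IsHomogOfDegree F n) (r : R) :
    IsHomogOfDegree (C r * F) n := by
  have := (isWeightedHomogeneous_C (fun k : ℕ => k + 1) r).mul h
  rwa [zero_add] at this

lemma isHomogOfDegree_X (k : ℕ) : IsHomogOfDegree (X k : DiffPoly R) (k + 1) :=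
  isWeightedHomogeneous_X R _ k

/-- The differential polynomials without `u_x`. -/
def freeOfFirst (R : Type*) [CommRing R] : Subalgebra R (DiffPoly R) := supported R {k | k ≠ 0}

lemma C_mul_mem_freeOfFirst (r : R) {F : DiffPoly R} (h : F ∈ freeOfFirst R) :
    C r * F ∈ freeOfFirst R :=
  mul_mem (Subalgebra.algebraMap_mem _ r) h

lemma X_mem_freeOfFirst (k : ℕ) : (X (k + 1) : DiffPoly R) ∈ freeOfFirst R :=
  Algebra.subset_adjoin ⟨k + 1, k.succ_ne_zero, rfl⟩

lemma coeff_eq_zero_of_mem_freeOfFirst {F : DiffPoly R} (h : F ∈ freeOfFirst R) {m : ℕ →₀ ℕ}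
    (hm : m 0 ≠ 0) : coeff m F = 0 := by
  by_contra hc
  exact mem_supported.mp h ((mem_vars_iff_mem_support 0).mpr
    ⟨m, mem_support_iff.mpr hc, by simpa using hm⟩) rfl

lemma coeffs_of_five {r s t : R}
    (h : C r * (u₂ * u₄) + C s * u₃ ^ 2 + C t * u₂ ^ 3 = (0 : DiffPoly R)) :
    s = 0 ∧ t = 0 := by
  constructor
  · simpa using congrArg (MvPolynomial.eval fun k => if k = 2 then 1 else 0) h
  · simpa using congrArg (MvPolynomial.eval fun k => if k = 1 then 1 else 0) h

lemma coeffs_of_six {r s t : R}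
    (h : C r * (u₂ * u₅) + C s * (u₃ * u₄) + C t * (u₂ ^ 2 * u₃) = (0 : DiffPoly R)) :
    r = 0 ∧ t = 0 := by
  constructor
  · simpa using congrArg (MvPolynomial.eval fun k => if k = 1 ∨ k = 4 then 1 else 0) h
  · simpa using congrArg (MvPolynomial.eval fun k => if k = 1 ∨ k = 2 then 1 else 0) h

section
variable [Algebra ℚ R]

lemma eq_of_smul_mul_sub_eq_zero {a t y z : R} (ha : ∀ r, a * r = 0 → r = 0) (ht : t = 1) {q : ℚ}
    (hq : q ≠ 0) (h : q • (a * t * (y - z)) = 0) : y = z := by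
  have := congrArg (q⁻¹ • ·) h
  simp only [smul_smul, inv_mul_cancel₀ hq, one_smul, smul_zero, ht, mul_one] at this
  exact sub_eq_zero.mp (ha _ this)

end

variable [Differential R]

lemma coeff_seriesBracket (n : ℕ) (α β : PowerSeries (DiffPoly R)) :
    PowerSeries.coeff n (seriesBracket α β) =
      formBracket (PowerSeries.coeff 0 α) (PowerSeries.coeff n β) + ∑ k ∈ Finset.range n,
        formBracket (PowerSeries.coeff (k + 1) α) (PowerSeries.coeff (n - (k + 1)) β) := by
  rw [seriesBracket, PowerSeries.coeff_mk, Finset.Nat.sum_antidiagonal_eq_sum_range_succ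
    fun i j => formBracket (PowerSeries.coeff i α) (PowerSeries.coeff j β),
    Finset.sum_range_succ', add_comm, Nat.sub_zero]

variable [Algebra ℚ R]

/-- At each order `n ≥ 1`, the equation `{u², g} + H = ρ` with `ρ` free of `u_x` determines both `g`
and `ρ`. -/
lemma eq_and_eq_zero_of_bracket_add_eq {x : R} (hx : x′ = 1) {n : ℕ} (hn : n ≠ 0)
    {g g' H ρ : DiffPoly R} (hg : IsHomogOfDegree g n) (hg' : IsHomogOfDegree g' n)
    (h : formBracket (C (x ^ 2)) g + H = 0) (h' : formBracket (C (x ^ 2)) g' + H = ρ)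
    (hρ : ρ ∈ freeOfFirst R) : g = g' ∧ ρ = 0 := by
  have hc {F : DiffPoly R} (hF : IsHomogOfDegree F n) : coeff 0 F = 0 := by
    by_contra hF0
    exact hn (by simpa using (hF hF0).symm)
  have e : g = g' := by
    refine (sub_eq_zero.mp (eq_zero_of_coeff_bracket hx (by rw [coeff_sub, hc hg', hc hg, sub_zero])
      fun m hm => ?_)).symm
    have : formBracket (C (x ^ 2)) (g' - g) = ρ := by
      rw [formBracket_sub_right, ← h', ← sub_zero (_ + H), ← h]; abel
    rw [this]
    exact coeff_eq_zero_of_mem_freeOfFirst hρ hm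
  exact ⟨e, by rw [← h', ← e, h]⟩

lemma eq_of_bracket_add_eq {x : R} (hx : x′ = 1) {n : ℕ} (hn : n ≠ 0)
    {g g' H : DiffPoly R} (hg : IsHomogOfDegree g n) (hg' : IsHomogOfDegree g' n)
    (h : formBracket (C (x ^ 2)) g + H = 0) (h' : formBracket (C (x ^ 2)) g' + H = 0) : g = g' :=
  (eq_and_eq_zero_of_bracket_add_eq hx hn hg hg' h h' (zero_mem _)).1

/-- A homogeneous differential polynomial of degree six without `u_x`. -/
lemma exists_eq_of_isHomogOfDegree_six {F : DiffPoly R} (hF : IsHomogOfDegree F 6)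
    (h1 : jetPartial 1 F = 0) : ∃ p q r s : R,
      F = C p * X 5 + C q * (u₂ * u₄) + C r * u₃ ^ 2 + C s * u₂ ^ 3 := by
  classical
  have hm0 {m : ℕ →₀ ℕ} (hm : coeff m F ≠ 0) : m 0 = 0 := by
    by_contra h0
    have h2 : 1 ≤ m 0 := Nat.one_le_iff_ne_zero.mpr h0
    have h3 : m - Finsupp.single 0 1 + Finsupp.single 0 1 = m :=
      tsub_add_cancel_of_le (Finsupp.single_le_iff.mpr h2)
    have h4 := congrArg (coeff (m - Finsupp.single 0 1)) (show pderiv 0 F = 0 from h1)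
    have h5 : (m - Finsupp.single 0 1 : ℕ →₀ ℕ) 0 + 1 = m 0 := by
      rw [Finsupp.tsub_apply, Finsupp.single_eq_same]; exact Nat.sub_add_cancel h2
    have h6 : ((m 0 : ℕ) : R) * coeff m F = 0 := by
      rw [coeff_pderiv, h3, coeff_zero, mul_comm] at h4
      rw [← h5]; exact_mod_cast h4
    rw [← nsmul_eq_mul, ← Nat.cast_smul_eq_nsmul ℚ] at h6
    exact hm (by simpa [smul_smul, h0] using congrArg (((m 0 : ℕ) : ℚ)⁻¹ • ·) h6)
  have hm {m : ℕ →₀ ℕ} (hm : coeff m F ≠ 0) : m = Finsupp.single 5 1 ∨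
      m = Finsupp.single 1 1 + Finsupp.single 3 1 ∨ m = Finsupp.single 2 2 ∨
      m = Finsupp.single 1 3 := by
    have hw : m.sum (fun k c => c * (k + 1)) = 6 := by
      have := hF hm
      rwa [Finsupp.weight_apply] at this
    have hk (k : ℕ) (hk : 6 ≤ k) : m k = 0 := by
      by_contra h
      have h2 : m k * (k + 1) ≤ m.sum fun k c => c * (k + 1) :=
        Finset.single_le_sum (f := fun k => m k * (k + 1)) (fun _ _ => Nat.zero_le _)
          (Finsupp.mem_support_iff.mpr h)
      have h3 : 1 * (k + 1) ≤ m k * (k + 1) :=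
        Nat.mul_le_mul_right _ (Nat.one_le_iff_ne_zero.mpr h)
      omega
    have hs : m.support ⊆ Finset.range 6 := fun k h => by
      by_contra h'
      exact Finsupp.mem_support_iff.mp h (hk k (by simpa using h'))
    rw [Finsupp.sum_of_support_subset m hs _ (by simp)] at hw
    simp only [Finset.sum_range_succ, Finset.sum_range_zero, hm0 hm] at hw
    have ext' {m' : ℕ →₀ ℕ} (h : ∀ k < 6, m k = m' k) (h' : ∀ k, 6 ≤ k → m' k = 0) : m = m' := by
      ext k
      rcases lt_or_ge k 6 with h6 | h6
      · exact h k h6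
      · rw [hk k h6, h' k h6]
    have cases4 : (m 1 = 0 ∧ m 2 = 0 ∧ m 3 = 0 ∧ m 4 = 0 ∧ m 5 = 1) ∨
        (m 1 = 1 ∧ m 2 = 0 ∧ m 3 = 1 ∧ m 4 = 0 ∧ m 5 = 0) ∨
        (m 1 = 0 ∧ m 2 = 2 ∧ m 3 = 0 ∧ m 4 = 0 ∧ m 5 = 0) ∨
        (m 1 = 3 ∧ m 2 = 0 ∧ m 3 = 0 ∧ m 4 = 0 ∧ m 5 = 0) := by
      clear * - hw
      generalize m 1 = a at *
      generalize m 2 = b at *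
      generalize m 3 = c at *
      generalize m 4 = d at *
      generalize m 5 = e at *
      have h2 : b ≤ 2 := by omega
      have h3 : c ≤ 1 := by omega
      have h4 : d ≤ 1 := by omega
      interval_cases b <;> interval_cases c <;> interval_cases d <;> omega
    have hz := hm0 hm
    refine cases4.imp (fun h => ?_) (Or.imp (fun h => ?_) (Or.imp (fun h => ?_) fun h => ?_)) <;>
    · obtain ⟨e1, e2, e3, e4, e5⟩ := h
      refine ext' (fun k hk6 => ?_) fun k hk6 => ?_
      · interval_cases k <;> simp [hz, e1, e2, e3, e4, e5]
      · simp only [Finsupp.add_apply, Finsupp.single_apply]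
        split_ifs <;> omega
  refine ⟨coeff (Finsupp.single 5 1) F, coeff (Finsupp.single 1 1 + Finsupp.single 3 1) F,
    coeff (Finsupp.single 2 2) F, coeff (Finsupp.single 1 3) F, ?_⟩
  -- `F` is the sum of its terms at the four exponents found above.
  have e1 : (X 5 : DiffPoly R) = monomial (Finsupp.single 5 1) 1 := rfl
  have e2 : (u₂ * u₄ : DiffPoly R) = monomial (Finsupp.single 1 1 + Finsupp.single 3 1) 1 := by
    rw [u₂, u₄, X, X, monomial_mul, one_mul]
  have e3 : (u₃ ^ 2 : DiffPoly R) = monomial (Finsupp.single 2 2) 1 := X_pow_eq_monomial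
  have e4 : (u₂ ^ 3 : DiffPoly R) = monomial (Finsupp.single 1 3) 1 := X_pow_eq_monomial
  rw [e1, e2, e3, e4]
  simp only [C_mul_monomial, mul_one]
  have hne {i j : ℕ →₀ ℕ} (k : ℕ) (h : i k ≠ j k) : i ≠ j := fun e => h (by rw [e])
  have n12 : (Finsupp.single 5 1 : ℕ →₀ ℕ) ≠ Finsupp.single 1 1 + Finsupp.single 3 1 :=
    hne 5 (by simp)
  have n13 : (Finsupp.single 5 1 : ℕ →₀ ℕ) ≠ Finsupp.single 2 2 :=
    hne 5 (by simp)
  have n14 : (Finsupp.single 5 1 : ℕ →₀ ℕ) ≠ Finsupp.single 1 3 :=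
    hne 5 (by simp)
  have n23 : (Finsupp.single 1 1 + Finsupp.single 3 1 : ℕ →₀ ℕ) ≠ Finsupp.single 2 2 :=
    hne 1 (by simp)
  have n24 : (Finsupp.single 1 1 + Finsupp.single 3 1 : ℕ →₀ ℕ) ≠ Finsupp.single 1 3 :=
    hne 1 (by simp)
  have n34 : (Finsupp.single 2 2 : ℕ →₀ ℕ) ≠ Finsupp.single 1 3 :=
    hne 1 (by simp)
  ext m
  simp only [coeff_add, coeff_monomial]
  by_cases hc : coeff m F = 0
  · split_ifs <;> simp_all
  · rcases hm hc with rfl | rfl | rfl | rfl <;>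
      simp [n12, n13, n14, n23, n24, n34, n12.symm, n13.symm, n14.symm, n23.symm, n24.symm,
        n34.symm]

end Series

/-! ### Integrability of normal forms -/

section Integrability

variable {R : Type*} [CommRing R] [Differential R]

section
variable [Algebra ℚ R]

lemma isHomogOfDegree_flowPoly1 (a f : R) : IsHomogOfDegree (flowPoly1 a f) 1 :=
  (isHomogOfDegree_X 0).C_mul _

lemma isHomogOfDegree_flowPoly2 (a f b : R) : IsHomogOfDegree (flowPoly2 a f b) 2 :=
  .add ((isHomogOfDegree_X 1).C_mul _) (((isHomogOfDegree_X 0).pow 2).C_mul _)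

lemma isHomogOfDegree_flowPoly3 (a f c : R) : IsHomogOfDegree (flowPoly3 a f c) 3 :=
  .add (.add ((isHomogOfDegree_X 2).C_mul _)
    (((isHomogOfDegree_X 0).mul (isHomogOfDegree_X 1)).C_mul _))
    (((isHomogOfDegree_X 0).pow 3).C_mul _)

lemma isHomogOfDegree_flowPoly4 (a f d₁ d₂ : R) : IsHomogOfDegree (flowPoly4 a f d₁ d₂) 4 :=
  .add (.add (.add (.add ((isHomogOfDegree_X 3).C_mul _)
    (((isHomogOfDegree_X 0).mul (isHomogOfDegree_X 2)).C_mul _))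
    (((isHomogOfDegree_X 1).pow 2).C_mul _))
    ((((isHomogOfDegree_X 0).pow 2).mul (isHomogOfDegree_X 1)).C_mul _))
    (((isHomogOfDegree_X 0).pow 4).C_mul _)

lemma isHomogOfDegree_flowPoly5 (a f e₁ e₂ : R) : IsHomogOfDegree (flowPoly5 a f e₁ e₂) 5 :=
  .add (.add (.add (.add (.add (.add ((isHomogOfDegree_X 4).C_mul _)
    (((isHomogOfDegree_X 0).mul (isHomogOfDegree_X 3)).C_mul _))
    (((isHomogOfDegree_X 1).mul (isHomogOfDegree_X 2)).C_mul _))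
    ((((isHomogOfDegree_X 0).pow 2).mul (isHomogOfDegree_X 2)).C_mul _))
    (((isHomogOfDegree_X 0).mul ((isHomogOfDegree_X 1).pow 2)).C_mul _))
    ((((isHomogOfDegree_X 0).pow 3).mul (isHomogOfDegree_X 1)).C_mul _))
    (((isHomogOfDegree_X 0).pow 5).C_mul _)

end

/-- The terms of order at most five of a deformation of `x ^ 2` in normal form. -/
structure HasNormalCoeffs (ω : PowerSeries (DiffPoly R)) (x a b c d₁ d₂ e₁ e₂ : R) : Prop where
  zero : PowerSeries.coeff 0 ω = C (x ^ 2)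
  one : PowerSeries.coeff 1 ω = C a * u₁
  two : PowerSeries.coeff 2 ω = C b * u₂
  three : PowerSeries.coeff 3 ω = C c * u₃
  four : PowerSeries.coeff 4 ω = C d₁ * u₄ + C d₂ * u₂ ^ 2
  five : PowerSeries.coeff 5 ω = C e₁ * u₅ + C e₂ * (u₂ * u₃)

namespace HasNormalCoeffs

variable {ω : PowerSeries (DiffPoly R)} {x a b c d₁ d₂ e₁ e₂ : R}

lemma coeff_one_bracket (hω : HasNormalCoeffs ω x a b c d₁ d₂ e₁ e₂)
    (ωf : PowerSeries (DiffPoly R)) :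
    PowerSeries.coeff 1 (seriesBracket ω ωf) = formBracket (C (x ^ 2)) (PowerSeries.coeff 1 ωf) +
      formBracket (C a * u₁) (PowerSeries.coeff 0 ωf) := by
  simp only [coeff_seriesBracket, Finset.sum_range_succ, Finset.sum_range_zero, zero_add,
    hω.zero, hω.one, Nat.sub_self]

lemma coeff_two_bracket (hω : HasNormalCoeffs ω x a b c d₁ d₂ e₁ e₂)
    (ωf : PowerSeries (DiffPoly R)) :
    PowerSeries.coeff 2 (seriesBracket ω ωf) = formBracket (C (x ^ 2)) (PowerSeries.coeff 2 ωf) +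
      (formBracket (C a * u₁) (PowerSeries.coeff 1 ωf) +
        formBracket (C b * u₂) (PowerSeries.coeff 0 ωf)) := by
  simp only [coeff_seriesBracket, Finset.sum_range_succ, Finset.sum_range_zero, zero_add,
    hω.zero, hω.one, hω.two, Nat.reduceAdd, Nat.reduceSub]

lemma coeff_three_bracket (hω : HasNormalCoeffs ω x a b c d₁ d₂ e₁ e₂)
    (ωf : PowerSeries (DiffPoly R)) :
    PowerSeries.coeff 3 (seriesBracket ω ωf) = formBracket (C (x ^ 2)) (PowerSeries.coeff 3 ωf) +
      (formBracket (C a * u₁) (PowerSeries.coeff 2 ωf) +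
        formBracket (C b * u₂) (PowerSeries.coeff 1 ωf) +
        formBracket (C c * u₃) (PowerSeries.coeff 0 ωf)) := by
  simp only [coeff_seriesBracket, Finset.sum_range_succ, Finset.sum_range_zero, zero_add,
    hω.zero, hω.one, hω.two, hω.three, Nat.reduceAdd, Nat.reduceSub]

lemma coeff_four_bracket (hω : HasNormalCoeffs ω x a b c d₁ d₂ e₁ e₂)
    (ωf : PowerSeries (DiffPoly R)) :
    PowerSeries.coeff 4 (seriesBracket ω ωf) = formBracket (C (x ^ 2)) (PowerSeries.coeff 4 ωf) +
      (formBracket (C a * u₁) (PowerSeries.coeff 3 ωf) +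
        formBracket (C b * u₂) (PowerSeries.coeff 2 ωf) +
        formBracket (C c * u₃) (PowerSeries.coeff 1 ωf) +
        formBracket (C d₁ * u₄ + C d₂ * u₂ ^ 2) (PowerSeries.coeff 0 ωf)) := by
  simp only [coeff_seriesBracket, Finset.sum_range_succ, Finset.sum_range_zero, zero_add,
    hω.zero, hω.one, hω.two, hω.three, hω.four, Nat.reduceAdd, Nat.reduceSub]

lemma coeff_five_bracket (hω : HasNormalCoeffs ω x a b c d₁ d₂ e₁ e₂)
    (ωf : PowerSeries (DiffPoly R)) :
    PowerSeries.coeff 5 (seriesBracket ω ωf) = formBracket (C (x ^ 2)) (PowerSeries.coeff 5 ωf) +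
      (formBracket (C a * u₁) (PowerSeries.coeff 4 ωf) +
        formBracket (C b * u₂) (PowerSeries.coeff 3 ωf) +
        formBracket (C c * u₃) (PowerSeries.coeff 2 ωf) +
        formBracket (C d₁ * u₄ + C d₂ * u₂ ^ 2) (PowerSeries.coeff 1 ωf) +
        formBracket (C e₁ * u₅ + C e₂ * (u₂ * u₃)) (PowerSeries.coeff 0 ωf)) := by
  simp only [coeff_seriesBracket, Finset.sum_range_succ, Finset.sum_range_zero, zero_add,
    hω.zero, hω.one, hω.two, hω.three, hω.four, hω.five, Nat.reduceAdd, Nat.reduceSub]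

lemma coeff_six_bracket (hω : HasNormalCoeffs ω x a b c d₁ d₂ e₁ e₂)
    (ωf : PowerSeries (DiffPoly R)) :
    PowerSeries.coeff 6 (seriesBracket ω ωf) = formBracket (C (x ^ 2)) (PowerSeries.coeff 6 ωf) +
      (formBracket (C a * u₁) (PowerSeries.coeff 5 ωf) +
        formBracket (C b * u₂) (PowerSeries.coeff 4 ωf) +
        formBracket (C c * u₃) (PowerSeries.coeff 3 ωf) +
        formBracket (C d₁ * u₄ + C d₂ * u₂ ^ 2) (PowerSeries.coeff 2 ωf) +
        formBracket (C e₁ * u₅ + C e₂ * (u₂ * u₃)) (PowerSeries.coeff 1 ωf) +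
        formBracket (PowerSeries.coeff 6 ω) (PowerSeries.coeff 0 ωf)) := by
  simp only [coeff_seriesBracket, Finset.sum_range_succ, Finset.sum_range_zero, zero_add,
    hω.zero, hω.one, hω.two, hω.three, hω.four, hω.five, Nat.reduceAdd, Nat.reduceSub]

variable [Algebra ℚ R]

lemma coeff_zero_bracket (hω : HasNormalCoeffs ω x a b c d₁ d₂ e₁ e₂)
    (hx : x′ = 1) {ωf : PowerSeries (DiffPoly R)} {f : R} (h0 : PowerSeries.coeff 0 ωf = C f) :
    PowerSeries.coeff 0 (seriesBracket ω ωf) = 0 := by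
  rw [coeff_seriesBracket, hω.zero, h0, Finset.sum_range_zero, add_zero]
  exact order_zero ![x, f, 0, 0, 0, 0, 0, 0, 0, 0] hx

end HasNormalCoeffs

variable [Algebra ℚ R]

/-- The cubic `f = x ^ 3 / 6`, for which `f‴ = 1`. -/
def cubic (x : R) : R := (1 / 6 : ℚ) • x ^ 3

lemma derivs_cubic_three {x : R} (hx : x′ = 1) : derivs (cubic x) 3 = 1 := by
  have := third_derivative_cubic ![x, 0, 0, 0, 0, 0, 0, 0, 0, 0] hx
  rw [map_eq_zero_iff _ (C_injective ℕ R), sub_eq_zero] at this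
  exact this.trans (pow_zero x)

/-- The coefficients of an integrable normal form up to the fourth order. The obstructions at the
orders three, four and five are evaluated at the flow of the cubic. -/
theorem coeffs_eq_of_isIntegrableUpTo_five {ω : PowerSeries (DiffPoly R)}
    {x a b c d₁ d₂ e₁ e₂ : R} (hx : x′ = 1) (ha : ∀ r, a * r = 0 → r = 0)
    (hω : HasNormalCoeffs ω x a b c d₁ d₂ e₁ e₂) (h : IsIntegrableUpTo 5 ω) :
    b = normalB a ∧ c = normalC a ∧ d₁ = normalD a ∧ d₂ = normalD2 (derivs a) := by
  obtain ⟨ωf, ⟨h0, hom⟩, hinv⟩ := h (cubic x)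
  have hf3 := derivs_cubic_three hx
  set f := cubic x
  have H1 := hinv 1 (by norm_num)
  rw [hω.coeff_one_bracket, h0] at H1
  have g1 := eq_of_bracket_add_eq hx one_ne_zero (hom 1) (isHomogOfDegree_flowPoly1 a f) H1
    (order_one ![x, a, f, 0, 0, 0, 0, 0, 0, 0] hx)
  have H2 := hinv 2 (by norm_num)
  rw [hω.coeff_two_bracket, h0, g1] at H2
  have g2 := eq_of_bracket_add_eq hx two_ne_zero (hom 2) (isHomogOfDegree_flowPoly2 a f b) H2
    (order_two ![x, a, f, b, 0, 0, 0, 0, 0, 0] hx)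
  have H3 := hinv 3 (by norm_num)
  rw [hω.coeff_three_bracket, h0, g1, g2] at H3
  obtain rfl : b = normalB a := by
    obtain ⟨g, hg, hρ⟩ := order_three_obstruction ![x, a, f, b, c, 0, 0, 0, 0, 0] hx
    have h3 := (eq_and_eq_zero_of_bracket_add_eq hx three_ne_zero (hom 3) hg H3 hρ
      (C_mul_mem_freeOfFirst _ (pow_mem (X_mem_freeOfFirst 0) 2))).2
    refine eq_of_smul_mul_sub_eq_zero ha hf3 (q := 1 / 8) (by norm_num) ?_
    simpa using congrArg (MvPolynomial.eval fun _ => 1) h3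
  have g3 := eq_of_bracket_add_eq hx three_ne_zero (hom 3) (isHomogOfDegree_flowPoly3 a f c) H3
    (order_three ![x, a, f, c, 0, 0, 0, 0, 0, 0] hx)
  have H4 := hinv 4 (by norm_num)
  rw [hω.coeff_four_bracket, h0, g1, g2, g3] at H4
  obtain rfl : c = normalC a := by
    obtain ⟨g, hg, hρ⟩ := order_four_obstruction ![x, a, f, c, d₁, d₂, 0, 0, 0, 0] hx
    have h4 := (eq_and_eq_zero_of_bracket_add_eq hx four_ne_zero (hom 4) hg H4 hρ
      (C_mul_mem_freeOfFirst _ (mul_mem (X_mem_freeOfFirst 0) (X_mem_freeOfFirst 1)))).2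
    refine eq_of_smul_mul_sub_eq_zero ha hf3 (q := 1 / 2) (by norm_num) ?_
    simpa using congrArg (MvPolynomial.eval fun _ => 1) h4
  have g4 := eq_of_bracket_add_eq hx four_ne_zero (hom 4) (isHomogOfDegree_flowPoly4 a f d₁ d₂) H4
    (order_four ![x, a, f, d₁, d₂, 0, 0, 0, 0, 0] hx)
  have H5 := hinv 5 (by norm_num)
  rw [hω.coeff_five_bracket, h0, g1, g2, g3, g4] at H5
  obtain ⟨g, hg, hρ⟩ := order_five_obstruction ![x, a, f, d₁, d₂, e₁, e₂, 0, 0, 0] hx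
  have h5 := (eq_and_eq_zero_of_bracket_add_eq hx (by norm_num) (hom 5) hg H5 hρ
    (add_mem (add_mem
      (C_mul_mem_freeOfFirst _ (mul_mem (X_mem_freeOfFirst 0) (X_mem_freeOfFirst 2)))
      (C_mul_mem_freeOfFirst _ (pow_mem (X_mem_freeOfFirst 1) 2)))
      (C_mul_mem_freeOfFirst _ (pow_mem (X_mem_freeOfFirst 0) 3)))).2
  obtain ⟨k1, k2⟩ := coeffs_of_five h5
  have hd : d₁ = normalD a := eq_of_smul_mul_sub_eq_zero ha hf3 (q := 2 / 3) (by norm_num) k1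
  refine ⟨rfl, rfl, hd, eq_of_smul_mul_sub_eq_zero ha hf3 (q := 32 / 35) (by norm_num) ?_⟩
  have hd' : d₁ - normalD a = 0 := sub_eq_zero.mpr hd
  change _ - _ * (d₁ - normalD a) = 0 at k2
  rw [hd', mul_zero, sub_zero] at k2
  exact k2

/-- The flows that commute up to the fifth order. -/
theorem inInvolutionUpTo_five_iff {ω : PowerSeries (DiffPoly R)} {x a e₁ e₂ : R} (hx : x′ = 1)
    (hω : HasNormalCoeffs ω x a (normalB a) (normalC a) (normalD a) (normalD2 (derivs a)) e₁ e₂)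
    {f : R} {ωf : PowerSeries (DiffPoly R)} (hωf : IsDeformation f ωf) :
    InInvolutionUpTo 5 ω ωf ↔
      PowerSeries.coeff 1 ωf = flowPoly1 a f ∧
      PowerSeries.coeff 2 ωf = flowPoly2 a f (normalB a) ∧
      PowerSeries.coeff 3 ωf = flowPoly3 a f (normalC a) ∧
      PowerSeries.coeff 4 ωf = flowPoly4 a f (normalD a) (normalD2 (derivs a)) ∧
      PowerSeries.coeff 5 ωf = flowPoly5 a f e₁ e₂ := by
  obtain ⟨h0, hom⟩ := hωf
  have L1 := order_one ![x, a, f, 0, 0, 0, 0, 0, 0, 0] hx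
  have L2 := order_two ![x, a, f, normalB a, 0, 0, 0, 0, 0, 0] hx
  have L3 := order_three ![x, a, f, normalC a, 0, 0, 0, 0, 0, 0] hx
  have L4 := order_four ![x, a, f, normalD a, normalD2 (derivs a), 0, 0, 0, 0, 0] hx
  have L5 := order_five ![x, a, f, e₁, e₂, 0, 0, 0, 0, 0] hx
  constructor
  · intro hinv
    have H1 := hinv 1 (by norm_num)
    rw [hω.coeff_one_bracket, h0] at H1
    have g1 := eq_of_bracket_add_eq hx one_ne_zero (hom 1) (isHomogOfDegree_flowPoly1 a f) H1 L1
    have H2 := hinv 2 (by norm_num)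
    rw [hω.coeff_two_bracket, h0, g1] at H2
    have g2 := eq_of_bracket_add_eq hx two_ne_zero (hom 2)
      (isHomogOfDegree_flowPoly2 a f (normalB a)) H2 L2
    have H3 := hinv 3 (by norm_num)
    rw [hω.coeff_three_bracket, h0, g1, g2] at H3
    have g3 := eq_of_bracket_add_eq hx three_ne_zero (hom 3)
      (isHomogOfDegree_flowPoly3 a f (normalC a)) H3 L3
    have H4 := hinv 4 (by norm_num)
    rw [hω.coeff_four_bracket, h0, g1, g2, g3] at H4
    have g4 := eq_of_bracket_add_eq hx four_ne_zero (hom 4)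
      (isHomogOfDegree_flowPoly4 a f (normalD a) (normalD2 (derivs a))) H4 L4
    have H5 := hinv 5 (by norm_num)
    rw [hω.coeff_five_bracket, h0, g1, g2, g3, g4] at H5
    exact ⟨g1, g2, g3, g4, eq_of_bracket_add_eq hx (by norm_num) (hom 5)
      (isHomogOfDegree_flowPoly5 a f e₁ e₂) H5 L5⟩
  · rintro ⟨g1, g2, g3, g4, g5⟩ n hn
    interval_cases n
    · exact hω.coeff_zero_bracket hx h0
    · rw [hω.coeff_one_bracket, h0, g1]; exact L1
    · rw [hω.coeff_two_bracket, h0, g1, g2]; exact L2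
    · rw [hω.coeff_three_bracket, h0, g1, g2, g3]; exact L3
    · rw [hω.coeff_four_bracket, h0, g1, g2, g3, g4]; exact L4
    · rw [hω.coeff_five_bracket, h0, g1, g2, g3, g4, g5]; exact L5

theorem isIntegrableUpTo_five_iff {ω : PowerSeries (DiffPoly R)} {x a b c d₁ d₂ e₁ e₂ : R}
    (hx : x′ = 1) (ha : ∀ r, a * r = 0 → r = 0)
    (hω : HasNormalCoeffs ω x a b c d₁ d₂ e₁ e₂) :
    IsIntegrableUpTo 5 ω ↔
      b = normalB a ∧ c = normalC a ∧ d₁ = normalD a ∧ d₂ = normalD2 (derivs a) := by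
  refine ⟨coeffs_eq_of_isIntegrableUpTo_five hx ha hω, ?_⟩
  rintro ⟨rfl, rfl, rfl, rfl⟩ f
  have hdef : IsDeformation f _ := isDeformation_seriesOfTerms (isHomogOfDegree_flowPoly1 a f)
    (isHomogOfDegree_flowPoly2 a f (normalB a)) (isHomogOfDegree_flowPoly3 a f (normalC a))
    (isHomogOfDegree_flowPoly4 a f (normalD a) (normalD2 (derivs a)))
    (isHomogOfDegree_flowPoly5 a f e₁ e₂) (isWeightedHomogeneous_zero _ _ _)
  refine ⟨_, hdef, (inInvolutionUpTo_five_iff hx hω hdef).mpr ?_⟩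
  simp only [seriesOfTerms, PowerSeries.coeff_mk, and_self]

theorem isIntegrableUpTo_six_iff {ω : PowerSeries (DiffPoly R)} {x a b c d₁ d₂ e₁ e₂ : R}
    (hx : x′ = 1) (ha : ∀ r, a * r = 0 → r = 0)
    (hω : HasNormalCoeffs ω x a b c d₁ d₂ e₁ e₂)
    (hom6 : IsHomogOfDegree (PowerSeries.coeff 6 ω) 6)
    (hnormal : jetPartial 1 (PowerSeries.coeff 6 ω) = 0) :
    IsIntegrableUpTo 6 ω ↔
      b = normalB a ∧ c = normalC a ∧ d₁ = normalD a ∧ d₂ = normalD2 (derivs a) ∧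
        e₁ = normalE a ∧ e₂ = normalE2 (derivs a) := by
  obtain ⟨p, q, r, s, h6⟩ := exists_eq_of_isHomogOfDegree_six hom6 hnormal
  have hfree : ∀ y z t : R, C y * (u₂ * u₅) + C z * (u₃ * u₄) + C t * (u₂ ^ 2 * u₃) ∈
      freeOfFirst R := fun y z t => add_mem (add_mem
    (C_mul_mem_freeOfFirst _ (mul_mem (X_mem_freeOfFirst 0) (X_mem_freeOfFirst 3)))
    (C_mul_mem_freeOfFirst _ (mul_mem (X_mem_freeOfFirst 1) (X_mem_freeOfFirst 2))))
    (C_mul_mem_freeOfFirst _ (mul_mem (pow_mem (X_mem_freeOfFirst 0) 2) (X_mem_freeOfFirst 1)))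
  constructor
  · intro h
    obtain ⟨rfl, rfl, rfl, rfl⟩ := (isIntegrableUpTo_five_iff hx ha hω).mp fun f =>
      (h f).imp fun _ hf => ⟨hf.1, fun n hn => hf.2 n (by omega)⟩
    obtain ⟨ωf, hdef, hinv⟩ := h (cubic x)
    obtain ⟨g1, g2, g3, g4, g5⟩ := (inInvolutionUpTo_five_iff hx hω hdef).mp
      fun n hn => hinv n (by omega)
    have hf3 := derivs_cubic_three hx
    set f := cubic x
    have H6 := hinv 6 le_rfl
    rw [hω.coeff_six_bracket, hdef.1, g1, g2, g3, g4, g5, h6] at H6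
    obtain ⟨g, hg, hρ⟩ := order_six_obstruction ![x, a, f, e₁, e₂, p, q, r, s, 0] hx
    obtain ⟨k1, k2⟩ := coeffs_of_six (eq_and_eq_zero_of_bracket_add_eq hx (by norm_num) (hdef.2 6)
      hg H6 hρ (hfree _ _ _)).2
    have he : e₁ = normalE a := eq_of_smul_mul_sub_eq_zero ha hf3 one_ne_zero
      ((one_smul ℚ _).trans k1)
    refine ⟨rfl, rfl, rfl, rfl, he,
      eq_of_smul_mul_sub_eq_zero ha hf3 (q := 45 / 28) (by norm_num) ?_⟩
    have he' : e₁ - normalE a = 0 := sub_eq_zero.mpr he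
    change _ - _ * (e₁ - normalE a) = 0 at k2
    rw [he', mul_zero, sub_zero] at k2
    exact k2
  · rintro ⟨rfl, rfl, rfl, rfl, rfl, rfl⟩ f
    obtain ⟨g, hg, hρ⟩ := order_six_obstruction
      ![x, a, f, normalE a, normalE2 (derivs a), p, q, r, s, 0] hx
    have hdef : IsDeformation f _ := isDeformation_seriesOfTerms (isHomogOfDegree_flowPoly1 a f)
      (isHomogOfDegree_flowPoly2 a f (normalB a)) (isHomogOfDegree_flowPoly3 a f (normalC a))
      (isHomogOfDegree_flowPoly4 a f (normalD a) (normalD2 (derivs a)))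
      (isHomogOfDegree_flowPoly5 a f (normalE a) (normalE2 (derivs a))) hg
    refine ⟨_, hdef, fun n hn => ?_⟩
    rcases Nat.lt_or_eq_of_le hn with hn | rfl
    · refine (inInvolutionUpTo_five_iff hx hω hdef).mpr ?_ n (by omega)
      simp only [seriesOfTerms, PowerSeries.coeff_mk, and_self]
    · rw [hω.coeff_six_bracket, h6]
      simp only [seriesOfTerms, PowerSeries.coeff_mk]
      refine hρ.trans ?_
      change C (a * derivs f 3 * (normalE a - normalE a)) * (u₂ * u₅) +
        C ((5 / 2 : ℚ) • (a * derivs f 3 * (normalE a - normalE a))) * (u₃ * u₄) +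
        C ((45 / 28 : ℚ) • (a * derivs f 3 * (normalE2 (derivs a) - normalE2 (derivs a))) -
          _ * (normalE a - normalE a)) * (u₂ ^ 2 * u₃) = 0
      simp only [sub_self, mul_zero, smul_zero, map_zero, zero_mul, add_zero]

end Integrability

/-! ### Smooth functions on an open set -/

section SmoothFunctions

variable {U : TopologicalSpace.Opens ℝ}

lemma SmoothFn.coord_deriv : (SmoothFn.coord U)′ = 1 := by
  apply Subtype.ext
  funext x
  have e : SmoothFn.ext0 (SmoothFn.coord U) =ᶠ[nhds x.1] id := by
    filter_upwards [U.isOpen.mem_nhds x.2] with y hy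
    exact SmoothFn.ext0_apply _ ⟨y, hy⟩
  change deriv (SmoothFn.ext0 (SmoothFn.coord U)) x = 1
  rw [e.deriv_eq, deriv_id]

lemma SmoothFn.eq_zero_of_mul_eq_zero {a : SmoothFn U} (ha : ∀ u : U, a.1 u ≠ 0) (r : SmoothFn U)
    (h : a * r = 0) : r = 0 := by
  apply Subtype.ext
  funext u
  have : a.1 u * r.1 u = 0 := congrFun (congrArg Subtype.val h) u
  exact (mul_eq_zero.mp this).resolve_left (ha u)

end SmoothFunctions

/-! ### The classification over an open set -/

theorem mainTheorem2 (U : TopologicalSpace.Opens ℝ) (a : SmoothFn U)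
    (ha : ∀ u : U, a.1 u ≠ 0) :
    -- every normal form with viscous coefficient `a`, written out up to `ε^5`
    (∀ (ω : PowerSeries (DiffPoly (SmoothFn U))) (b₁ c₁ d₁ d₂ e₁ e₂ : SmoothFn U),
      IsDeformation (SmoothFn.coord U ^ 2) ω → IsNormal ω →
      PowerSeries.coeff 1 ω = C a * u₁ →
      PowerSeries.coeff 2 ω = C b₁ * u₂ →
      PowerSeries.coeff 3 ω = C c₁ * u₃ →
      PowerSeries.coeff 4 ω = C d₁ * u₄ + C d₂ * u₂ ^ 2 →
      PowerSeries.coeff 5 ω = C e₁ * u₅ + C e₂ * (u₂ * u₃) →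
      -- integrability up to the order `ε^5`
      (IsIntegrableUpTo 5 ω ↔
        (b₁ = (1 / 2 : ℚ) • derivs (a ^ 2) 1 ∧
          c₁ = (1 / 6 : ℚ) • derivs (a ^ 3) 2 ∧
          d₁ = (1 / 24 : ℚ) • derivs (a ^ 4) 3 ∧
          d₂ = normalD2 (derivs a))) ∧
      -- integrability up to the order `ε^6`
      (IsIntegrableUpTo 6 ω ↔
        (b₁ = (1 / 2 : ℚ) • derivs (a ^ 2) 1 ∧
          c₁ = (1 / 6 : ℚ) • derivs (a ^ 3) 2 ∧
          d₁ = (1 / 24 : ℚ) • derivs (a ^ 4) 3 ∧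
          d₂ = normalD2 (derivs a) ∧
          e₁ = (1 / 120 : ℚ) • derivs (a ^ 5) 4 ∧
          e₂ = normalE2 (derivs a))) ∧
      -- the commuting flows up to the order `ε^5`
      (IsIntegrableUpTo 5 ω →
        ∀ (f : SmoothFn U) (ωf : PowerSeries (DiffPoly (SmoothFn U))), IsDeformation f ωf →
          (InInvolutionUpTo 5 ω ωf ↔
            (PowerSeries.coeff 1 ωf = C (flowA (derivs a) (derivs f)) * u₁ ∧
            PowerSeries.coeff 2 ωf =
              C (flowB1 (derivs a) (derivs f) b₁) * u₂
              + C (flowB2 (derivs a) (derivs f) b₁) * u₁ ^ 2 ∧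
            PowerSeries.coeff 3 ωf =
              C (flowC1 (derivs a) (derivs f) c₁) * u₃
              + C (flowC2 (derivs a) (derivs f) c₁) * (u₁ * u₂)
              + C (flowC3 (derivs a) (derivs f) c₁) * u₁ ^ 3 ∧
            PowerSeries.coeff 4 ωf =
              C (flowD1 (derivs a) (derivs f) d₁) * u₄
              + C (flowD2 (derivs a) (derivs f) d₁) * (u₁ * u₃)
              + C (flowD3 (derivs a) (derivs f) d₁ d₂) * u₂ ^ 2
              + C (flowD4 (derivs a) (derivs f) d₁ d₂) * (u₁ ^ 2 * u₂)
              + C (flowD5 (derivs a) (derivs f) d₁) * u₁ ^ 4 ∧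
            PowerSeries.coeff 5 ωf =
              C (flowE1 (derivs a) (derivs f) e₁) * u₅
              + C (flowE2 (derivs a) (derivs f) e₁) * (u₁ * u₄)
              + C (flowE3 (derivs a) (derivs f) e₁ e₂) * (u₂ * u₃)
              + C (flowE4 (derivs a) (derivs f) e₁ e₂) * (u₁ ^ 2 * u₃)
              + C (flowE5 (derivs a) (derivs f) e₁ e₂) * (u₁ * u₂ ^ 2)
              + C (flowE6 (derivs a) (derivs f) e₁ e₂) * (u₁ ^ 3 * u₂)
              + C (flowE7 (derivs a) (derivs f) e₁) * u₁ ^ 5)))) ∧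
    -- the function `a` is a free parameter
    (∃ ω : PowerSeries (DiffPoly (SmoothFn U)),
      IsDeformation (SmoothFn.coord U ^ 2) ω ∧ IsNormal ω ∧
        PowerSeries.coeff 1 ω = C a * u₁ ∧ IsIntegrableUpTo 6 ω) := by
  have hx := SmoothFn.coord_deriv (U := U)
  have ha' := SmoothFn.eq_zero_of_mul_eq_zero ha
  refine ⟨fun ω b₁ c₁ d₁ d₂ e₁ e₂ hdef hnormal h1 h2 h3 h4 h5 => ?_, ?_⟩
  · have hω : HasNormalCoeffs ω (SmoothFn.coord U) a b₁ c₁ d₁ d₂ e₁ e₂ :=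
      ⟨hdef.1, h1, h2, h3, h4, h5⟩
    refine ⟨isIntegrableUpTo_five_iff hx ha' hω,
      isIntegrableUpTo_six_iff hx ha' hω (hdef.2 6) (hnormal 6 (by norm_num)), ?_⟩
    intro hint f ωf hf
    obtain ⟨rfl, rfl, rfl, rfl⟩ := (isIntegrableUpTo_five_iff hx ha' hω).mp hint
    exact inInvolutionUpTo_five_iff hx hω hf
  · set ω := seriesOfTerms (C (SmoothFn.coord U ^ 2)) (C a * u₁) (C (normalB a) * u₂)
      (C (normalC a) * u₃) (C (normalD a) * u₄ + C (normalD2 (derivs a)) * u₂ ^ 2)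
      (C (normalE a) * u₅ + C (normalE2 (derivs a)) * (u₂ * u₃)) 0 with hωdef
    have hω : HasNormalCoeffs ω (SmoothFn.coord U) a (normalB a) (normalC a) (normalD a)
        (normalD2 (derivs a)) (normalE a) (normalE2 (derivs a)) := by
      constructor <;> exact PowerSeries.coeff_mk _ _
    have hfree {n : ℕ} {F : DiffPoly (SmoothFn U)} (hF : PowerSeries.coeff n ω = F)
        (h : jetPartial 1 F = 0) : jetPartial 1 (PowerSeries.coeff n ω) = 0 := by rw [hF, h]
    have hdef : IsDeformation (SmoothFn.coord U ^ 2) ω := isDeformation_seriesOfTerms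
      ((isHomogOfDegree_X 0).C_mul _) ((isHomogOfDegree_X 1).C_mul _)
      ((isHomogOfDegree_X 2).C_mul _)
      (.add ((isHomogOfDegree_X 3).C_mul _) (((isHomogOfDegree_X 1).pow 2).C_mul _))
      (.add ((isHomogOfDegree_X 4).C_mul _)
        (((isHomogOfDegree_X 1).mul (isHomogOfDegree_X 2)).C_mul _))
      (isWeightedHomogeneous_zero _ _ _)
    have hnormal : IsNormal ω := by
      intro n hn
      have hz : jetPartial 1 (0 : DiffPoly (SmoothFn U)) = 0 := map_zero (jetDerivation 1)
      match n, hn with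
      | 2, _ => rw [hω.two]; simp [jetPartial]
      | 3, _ => rw [hω.three]; simp [jetPartial]
      | 4, _ => rw [hω.four]; simp [jetPartial]
      | 5, _ => rw [hω.five]; simp [jetPartial]
      | 6, _ => exact hfree (PowerSeries.coeff_mk _ _) hz
      | n + 7, _ => exact hfree (PowerSeries.coeff_mk _ _) hz
    exact ⟨ω, hdef, hnormal, hω.one, (isIntegrableUpTo_six_iff hx ha' hω (hdef.2 6)
      (hnormal 6 (by norm_num))).mpr ⟨rfl, rfl, rfl, rfl, rfl, rfl⟩⟩

end
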